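/- There are constants $c>0$, $C,d\in\mathbb N$ and a single randomized algorithm (a program of a random access machine with fair coin flips, under the logarithmic cost criterion) with the following property. Let $G$ be a graph on the vertex set $\{0,\dots,n-1\}$ with maximum degree $\Delta$, let $k\ge 0$ be an integer such that $G$ is $k$-colorable, and let $s$ be the number of proper $k$-colorings $V(G)\to\{0,\dots,k-1\}$ of $G$. Let a path decomposition of $G$ be given, that is, a sequence of $p$ sets of vertices (bags) such that every vertex lies in some bag, the two ends of every edge lie in a common bag, and the bags that contain a given vertex are consecutive; let its width $w$ be the largest size of a bag minus one (in particular, $w=\operatorname{pw}(G)$ if the decomposition is optimal). Then the algorithm, given $G$, $k$ and the path decomposition (but not $s$), with probability at least $c$ halts within time $$\left(\lfloor \Delta/2\rfloor+1\right)^{w}\cdot C\,(n+p+1)^{d}\cdot s$$ and outputs a proper $k$-coloring of $G$. (For path decompositions without repeated consecutive bags, $p\le 2n+1$, so the factor $C(n+p+1)^d$ is polynomial in $n$; for $n=0$ the width is read as $0$.) -/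

import Mathlib

/-! ### Graphs: path decompositions -/

/-- A path decomposition of `G` with `p` bags (in the order of the path): every vertex lies in some
bag, both ends of every edge lie in a common bag, and the bags containing a given vertex form an
interval. -/
structure PathDecomposition {V : Type*} (G : SimpleGraph V) (p : ℕ) where
  bag : Fin p → Finset V
  exists_mem_bag : ∀ v : V, ∃ i, v ∈ bag i
  exists_bag_of_adj : ∀ u v : V, G.Adj u v → ∃ i, u ∈ bag i ∧ v ∈ bag i
  mem_bag_of_le : ∀ (v : V) (i j l : Fin p), i ≤ j → j ≤ l → v ∈ bag i → v ∈ bag l → v ∈ bag j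

/-- The width of a path decomposition: the largest cardinality of a bag, minus one. -/
def PathDecomposition.width {V : Type*} {G : SimpleGraph V} {p : ℕ}
    (P : PathDecomposition G p) : ℕ :=
  (Finset.univ.sup fun i => (P.bag i).card) - 1

/-! ### The machine model: a random access machine with coin flips, under the logarithmic cost
criterion

The machine has registers and an unbounded memory of cells indexed by natural numbers; registers
and cells hold natural numbers. A program is a fixed finite term. Every operation costs one plus
the binary lengths of the numbers (values and addresses) that it handles. -/

namespace RAM

/-- The arithmetic operations of the machine (subtraction is truncated at zero). -/
inductive BinOp
  | add | sub | mul | div | mod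

/-- The result of an arithmetic operation. -/
def BinOp.eval : BinOp → ℕ → ℕ → ℕ
  | .add, a, b => a + b
  | .sub, a, b => a - b
  | .mul, a, b => a * b
  | .div, a, b => a / b
  | .mod, a, b => a % b

/-- Expressions: numerals, registers, memory cells (with a computed address), arithmetic. -/
inductive Exp
  | const (c : ℕ)
  | reg (r : ℕ)
  | cell (addr : Exp)
  | op (o : BinOp) (a b : Exp)

/-- Programs. Tests are for being nonzero. -/
inductive Prog
  | skip
  | assign (r : ℕ) (e : Exp)
  | store (addr e : Exp)
  | flip (r : ℕ)
  | seq (A B : Prog)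
  | ifte (e : Exp) (A B : Prog)
  | loop (e : Exp) (A : Prog)

/-- A state: the contents of the registers and of the memory, and the number of coins flipped so
far. -/
structure State where
  reg : ℕ → ℕ
  mem : ℕ → ℕ
  coins : ℕ

/-- The value of an expression. -/
def Exp.eval (σ : State) : Exp → ℕ
  | .const c => c
  | .reg r => σ.reg r
  | .cell a => σ.mem (a.eval σ)
  | .op o a b => o.eval (a.eval σ) (b.eval σ)

/-- The cost of evaluating an expression: every node of the expression costs one plus the binary
length of its value (so that operands and addresses are charged too). -/
def Exp.cost (σ : State) : Exp → ℕ
  | .const c => 1 + Nat.size c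
  | .reg r => 1 + Nat.size (σ.reg r)
  | .cell a => a.cost σ + 1 + Nat.size (σ.mem (a.eval σ))
  | .op o a b => a.cost σ + b.cost σ + 1 + Nat.size (o.eval (a.eval σ) (b.eval σ))

/-- `Exec ω A σ t τ`: when the outcomes of the successive coin flips are `ω 0, ω 1, …`, the program
`A` started in state `σ` halts in state `τ`, at total cost `t`. -/
inductive Exec (ω : ℕ → Bool) : Prog → State → ℕ → State → Prop
  | skip (σ : State) : Exec ω .skip σ 1 σ
  | assign (r : ℕ) (e : Exp) (σ : State) :
      Exec ω (.assign r e) σ (1 + e.cost σ)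
        { σ with reg := Function.update σ.reg r (e.eval σ) }
  | store (a e : Exp) (σ : State) :
      Exec ω (.store a e) σ (1 + a.cost σ + e.cost σ)
        { σ with mem := Function.update σ.mem (a.eval σ) (e.eval σ) }
  | flip (r : ℕ) (σ : State) :
      Exec ω (.flip r) σ 1
        { σ with
          reg := Function.update σ.reg r (ω σ.coins).toNat
          coins := σ.coins + 1 }
  | seq {A B : Prog} {σ τ ρ : State} {t u : ℕ} :
      Exec ω A σ t τ → Exec ω B τ u ρ → Exec ω (.seq A B) σ (t + u) ρ
  | ifte_true {e : Exp} {A B : Prog} {σ τ : State} {t : ℕ} :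
      e.eval σ ≠ 0 → Exec ω A σ t τ → Exec ω (.ifte e A B) σ (1 + e.cost σ + t) τ
  | ifte_false {e : Exp} {A B : Prog} {σ τ : State} {t : ℕ} :
      e.eval σ = 0 → Exec ω B σ t τ → Exec ω (.ifte e A B) σ (1 + e.cost σ + t) τ
  | loop_true {e : Exp} {A : Prog} {σ τ ρ : State} {t u : ℕ} :
      e.eval σ ≠ 0 → Exec ω A σ t τ → Exec ω (.loop e A) τ u ρ →
        Exec ω (.loop e A) σ (1 + e.cost σ + t + u) ρ
  | loop_false {e : Exp} {A : Prog} {σ : State} :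
      e.eval σ = 0 → Exec ω (.loop e A) σ (1 + e.cost σ) σ

/-- The machine is deterministic once the outcomes of the coin flips are fixed. -/
theorem Exec.deterministic {ω : ℕ → Bool} {A : Prog} {σ τ τ' : State} {t t' : ℕ}
    (h : Exec ω A σ t τ) (h' : Exec ω A σ t' τ') : t = t' ∧ τ = τ' := by
  induction h generalizing t' τ' with
  | skip | assign | store | flip => cases h'; exact ⟨rfl, rfl⟩
  | seq _ _ ih₁ ih₂ =>
    cases h' with
    | seq g₁ g₂ =>
      obtain ⟨rfl, rfl⟩ := ih₁ g₁
      obtain ⟨rfl, rfl⟩ := ih₂ g₂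
      exact ⟨rfl, rfl⟩
  | ifte_true he _ ih =>
    cases h' with
    | ifte_true _ g => obtain ⟨rfl, rfl⟩ := ih g; exact ⟨rfl, rfl⟩
    | ifte_false h0 _ => exact absurd h0 he
  | ifte_false he _ ih =>
    cases h' with
    | ifte_true h0 _ => exact absurd he h0
    | ifte_false _ g => obtain ⟨rfl, rfl⟩ := ih g; exact ⟨rfl, rfl⟩
  | loop_true he _ _ ih₁ ih₂ =>
    cases h' with
    | loop_true _ g₁ g₂ =>
      obtain ⟨rfl, rfl⟩ := ih₁ g₁
      obtain ⟨rfl, rfl⟩ := ih₂ g₂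
      exact ⟨rfl, rfl⟩
    | loop_false h0 => exact absurd h0 he
  | loop_false he =>
    cases h' with
    | loop_true h0 _ _ => exact absurd he h0
    | loop_false _ => exact ⟨rfl, rfl⟩

/-- The law of an infinite sequence of independent fair coin flips. -/
noncomputable def coinMeasure : MeasureTheory.Measure (ℕ → Bool) :=
  MeasureTheory.Measure.infinitePi fun _ => (PMF.uniformOfFintype Bool).toMeasure

end RAM

/-! ### The coloring problem as a problem for the machine -/

/-- The input word: the numbers of vertices, of colors and of bags, then the adjacency matrix row by
row, then the characteristic vectors of the bags in the order of the path. -/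
def inputWord {n p : ℕ} (k : ℕ) (G : SimpleGraph (Fin n)) [DecidableRel G.Adj]
    (P : PathDecomposition G p) : List ℕ :=
  [n, k, p]
    ++ (List.finRange n).flatMap (fun u => (List.finRange n).map fun v => if G.Adj u v then 1 else 0)
    ++ (List.finRange p).flatMap (fun i =>
        (List.finRange n).map fun v => if v ∈ P.bag i then 1 else 0)

/-- The initial state: the input word stands in the first cells of the memory, everything else is
zero. -/
def initialState {n p : ℕ} (k : ℕ) (G : SimpleGraph (Fin n)) [DecidableRel G.Adj]
    (P : PathDecomposition G p) : RAM.State where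
  reg := fun _ => 0
  mem := fun i => (inputWord k G P).getD i 0
  coins := 0

/-- In the final state, the first `n` cells of the memory hold a proper `k`-coloring of `G` (with
the colors `0, …, k - 1`). -/
def HoldsColoring {n : ℕ} (k : ℕ) (G : SimpleGraph (Fin n)) (τ : RAM.State) : Prop :=
  ∃ c : G.Coloring (Fin k), ∀ v : Fin n, τ.mem v = c v

/-- The outcomes of the coin flips for which the program `A`, given `G`, `k` and `P`, halts at cost
at most `T` with a proper `k`-coloring of `G` as its output. -/
def successEvent {n p : ℕ} (A : RAM.Prog) (k : ℕ) (G : SimpleGraph (Fin n)) [DecidableRel G.Adj]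
    (P : PathDecomposition G p) (T : ℕ) : Set (ℕ → Bool) :=
  {ω | ∃ t ≤ T, ∃ τ, RAM.Exec ω A (initialState k G P) t τ ∧ HoldsColoring k G τ}

/-! ### Cost-bounded execution of programs -/

namespace RAM

/-! Give each vertex `x` a weight `r x` and sum, over all colorings `c`, the product of the powers
`r x ^ c x` and of the differences `c u - c v` over the edges `uv`. Improper colorings contribute
zero and different colorings contribute different monomials, so as a polynomial in the weights this
sum is nonzero as soon as a proper coloring exists (`coeff_colorPoly`, `colorPoly_ne_zero`). By
Schwartz–Zippel, random weights below `B = 4 ^ n` keep it nonzero with probability at least one half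
(`card_colorSum_eq_zero`). Its absolute value is smaller than `M = B ^ (4 * n * n)`
(`abs_colorSum_le`), so it can be computed modulo `M` (`half_le_coinMeasure_colorSum`).

Multiplying out the differences turns the sum over colorings into a signed sum over orientations of
the edges, of the product over the vertices of the moment `∑ a, r x ^ a * a ^ e`, where `e` is the
outdegree of `x` (`colorSum_eq`). This is evaluated edge by edge. Remembering the outdegree so far
would take `deg x + 1` states per vertex. Instead, a vertex counts its outgoing edges only up to
half of its degree. At the next edge it guesses how many of the remaining edges will leave it, pays
the moment of the total, and counts the guess down to zero. Thus its state never exceeds half the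
degree (`cap_le`), and the recursion is exact (`amplitude_insert`, `amplitude_zero`).

The edges are processed in the order of the first bags that contain both of their ends. A vertex
whose state may be nonzero has processed and unprocessed edges, hence lies in the current bag
(`cap_eq_zero`). So at most `(Δ / 2 + 1) ^ (w + 1)` states occur (`card_states_le`); one of these
factors is at most `n` and goes into the polynomial.

A coloring is found by self-reduction with the same weights throughout. The sum splits according to
the color of one vertex, so some color keeps it nonzero (`exists_colorSum_ne_zero`), and once all
lists are singletons a nonzero sum certifies properness (`ne_of_colorSum_ne_zero`). Only the initial
choice of the weights can therefore fail. If `k ≥ n`, all vertices simply get different colors. The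
number of colorings pays for nothing but the binary length of `k`, because `k` is at most that
number (`le_card_coloring`).

The predicate `Runs` carries correctness, a bound for the stored numbers and the cost together;
`runs_main` is the outcome for the whole program. -/

instance : Add Exp := ⟨.op .add⟩
instance : Sub Exp := ⟨.op .sub⟩
instance : Mul Exp := ⟨.op .mul⟩
instance : Div Exp := ⟨.op .div⟩
instance : Mod Exp := ⟨.op .mod⟩
instance (c : ℕ) : OfNat Exp c := ⟨.const c⟩

namespace Exp

variable (σ : State) (a b : Exp)

@[simp] theorem eval_add : (a + b).eval σ = a.eval σ + b.eval σ := rfl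
@[simp] theorem eval_sub : (a - b).eval σ = a.eval σ - b.eval σ := rfl
@[simp] theorem eval_mul : (a * b).eval σ = a.eval σ * b.eval σ := rfl
@[simp] theorem eval_div : (a / b).eval σ = a.eval σ / b.eval σ := rfl
@[simp] theorem eval_mod : (a % b).eval σ = a.eval σ % b.eval σ := rfl
@[simp] theorem eval_ofNat (c : ℕ) : Exp.eval σ (no_index (OfNat.ofNat c)) = OfNat.ofNat c := rfl
@[simp] theorem eval_reg (r : ℕ) : (Exp.reg r).eval σ = σ.reg r := rfl
@[simp] theorem eval_cell : (Exp.cell a).eval σ = σ.mem (a.eval σ) := rfl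

/-- A bound for the binary length of the value of an expression, relative to the length of the
numbers stored by the machine. -/
@[simp] def bits : Exp → ℕ
  | .const c => c
  | .reg _ => 1
  | .cell _ => 1
  | .op _ a b => a.bits + b.bits + 1

/-- A bound for the cost of an expression, relative to the length of the numbers stored by the
machine. -/
@[simp] def weight : Exp → ℕ
  | .const c => 1 + c
  | .reg _ => 1
  | .cell a => a.weight + 1
  | .op _ a b => a.weight + b.weight + (a.bits + b.bits + 1) + 1

@[simp] theorem bits_add : (a + b).bits = a.bits + b.bits + 1 := rfl
@[simp] theorem weight_add :
    (a + b).weight = a.weight + b.weight + (a.bits + b.bits + 1) + 1 := rfl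
@[simp] theorem bits_sub : (a - b).bits = a.bits + b.bits + 1 := rfl
@[simp] theorem weight_sub :
    (a - b).weight = a.weight + b.weight + (a.bits + b.bits + 1) + 1 := rfl
@[simp] theorem bits_mul : (a * b).bits = a.bits + b.bits + 1 := rfl
@[simp] theorem weight_mul :
    (a * b).weight = a.weight + b.weight + (a.bits + b.bits + 1) + 1 := rfl
@[simp] theorem bits_div : (a / b).bits = a.bits + b.bits + 1 := rfl
@[simp] theorem weight_div :
    (a / b).weight = a.weight + b.weight + (a.bits + b.bits + 1) + 1 := rfl
@[simp] theorem bits_mod : (a % b).bits = a.bits + b.bits + 1 := rfl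
@[simp] theorem weight_mod :
    (a % b).weight = a.weight + b.weight + (a.bits + b.bits + 1) + 1 := rfl
@[simp] theorem bits_ofNat (c : ℕ) : Exp.bits (no_index (OfNat.ofNat c)) = OfNat.ofNat c := rfl
@[simp] theorem weight_ofNat (c : ℕ) :
    Exp.weight (no_index (OfNat.ofNat c)) = 1 + OfNat.ofNat c := rfl

end Exp

/-- All numbers stored by the machine have binary length at most `S`. -/
def Bounded (S : ℕ) (σ : State) : Prop :=
  (∀ r, σ.reg r < 2 ^ S) ∧ ∀ a, σ.mem a < 2 ^ S

theorem size_add_le (a b : ℕ) : (a + b).size ≤ a.size + b.size + 1 := by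
  rw [Nat.size_le]
  have ha := Nat.lt_size_self a
  have hb := Nat.lt_size_self b
  have h1 : 2 ^ a.size ≤ 2 ^ (a.size + b.size) := Nat.pow_le_pow_right (by norm_num) (by omega)
  have h2 : 2 ^ b.size ≤ 2 ^ (a.size + b.size) := Nat.pow_le_pow_right (by norm_num) (by omega)
  rw [pow_succ]
  omega

theorem size_mul_le (a b : ℕ) : (a * b).size ≤ a.size + b.size := by
  rw [Nat.size_le, pow_add]
  exact Nat.mul_lt_mul'' (Nat.lt_size_self a) (Nat.lt_size_self b)

theorem BinOp.size_eval_le (o : BinOp) (a b : ℕ) : (o.eval a b).size ≤ a.size + b.size + 1 := by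
  cases o
  · exact size_add_le a b
  · exact (Nat.size_le_size (Nat.sub_le a b)).trans (by omega)
  · exact (size_mul_le a b).trans (by omega)
  · exact (Nat.size_le_size (Nat.div_le_self a b)).trans (by omega)
  · exact (Nat.size_le_size (Nat.mod_le a b)).trans (by omega)

variable {S : ℕ} {σ : State}

theorem Exp.size_eval_le (h : Bounded S σ) (e : Exp) :
    (e.eval σ).size ≤ e.bits * (S + 1) := by
  induction e with
  | const c =>
    have h1 : c.size ≤ c := Nat.size_le.2 Nat.lt_two_pow_self
    simp only [Exp.eval, Exp.bits]
    nlinarith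
  | reg r => simpa [Exp.eval, Exp.bits] using (Nat.size_le.2 (h.1 r)).trans (Nat.le_succ S)
  | cell a => simpa [Exp.eval, Exp.bits] using (Nat.size_le.2 (h.2 _)).trans (Nat.le_succ S)
  | op o a b iha ihb =>
    refine (o.size_eval_le _ _).trans ?_
    simp only [Exp.bits]
    nlinarith

/-- Every value inside `e` is at most a constant factor longer than the stored numbers, and the
constant depends on the text of `e` only. Hence only numbers that are stored need a length bound;
addresses and other intermediate values are covered automatically. -/
theorem Exp.cost_le (h : Bounded S σ) (e : Exp) : e.cost σ ≤ e.weight * (S + 1) := by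
  induction e with
  | const c =>
    have := (Exp.const c).size_eval_le h
    simp only [Exp.cost, Exp.weight, Exp.eval, Exp.bits] at *
    nlinarith
  | reg r =>
    have := (Exp.reg r).size_eval_le h
    simp only [Exp.cost, Exp.weight, Exp.eval] at *
    have := Nat.size_le.2 (h.1 r)
    omega
  | cell a iha =>
    have := Nat.size_le.2 (h.2 (a.eval σ))
    simp only [Exp.cost, Exp.weight]
    nlinarith
  | op o a b iha ihb =>
    have := (Exp.op o a b).size_eval_le h
    simp only [Exp.cost, Exp.weight, Exp.eval, Exp.bits] at *
    nlinarith

/-! Updates of states -/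

/-- Writing to a register. -/
def State.set (σ : State) (r v : ℕ) : State := { σ with reg := Function.update σ.reg r v }

/-- Writing to the memory. -/
def State.put (σ : State) (a v : ℕ) : State := { σ with mem := Function.update σ.mem a v }

/-- Reading a coin into a register. -/
def State.toss (σ : State) (ω : ℕ → Bool) (r : ℕ) : State :=
  { σ with reg := Function.update σ.reg r (ω σ.coins).toNat, coins := σ.coins + 1 }

@[simp] theorem State.set_reg (σ : State) (r v r' : ℕ) :
    (σ.set r v).reg r' = if r' = r then v else σ.reg r' := by
  simp [State.set, Function.update_apply]
@[simp] theorem State.set_mem (σ : State) (r v : ℕ) : (σ.set r v).mem = σ.mem := rfl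
@[simp] theorem State.set_coins (σ : State) (r v : ℕ) : (σ.set r v).coins = σ.coins := rfl
@[simp] theorem State.put_reg (σ : State) (a v : ℕ) : (σ.put a v).reg = σ.reg := rfl
theorem State.put_mem (σ : State) (a v a' : ℕ) :
    (σ.put a v).mem a' = if a' = a then v else σ.mem a' := by
  simp [State.put, Function.update_apply]
@[simp] theorem State.put_coins (σ : State) (a v : ℕ) : (σ.put a v).coins = σ.coins := rfl
@[simp] theorem State.toss_reg (σ : State) (ω : ℕ → Bool) (r r' : ℕ) :
    (σ.toss ω r).reg r' = if r' = r then (ω σ.coins).toNat else σ.reg r' := by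
  simp [State.toss, Function.update_apply]
@[simp] theorem State.toss_mem (σ : State) (ω : ℕ → Bool) (r : ℕ) :
    (σ.toss ω r).mem = σ.mem := rfl
@[simp] theorem State.toss_coins (σ : State) (ω : ℕ → Bool) (r : ℕ) :
    (σ.toss ω r).coins = σ.coins + 1 := rfl

/-! What a program can change -/

namespace Prog

/-- The registers that a program may write. -/
def writes : Prog → List ℕ
  | .skip => []
  | .assign r _ => [r]
  | .store _ _ => []
  | .flip r => [r]
  | .seq A B => A.writes ++ B.writes
  | .ifte _ A B => A.writes ++ B.writes
  | .loop _ A => A.writes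

/-- Whether a program contains an instruction that writes to the memory. -/
def stores : Prog → Bool
  | .skip => false
  | .assign _ _ => false
  | .store _ _ => true
  | .flip _ => false
  | .seq A B => A.stores || B.stores
  | .ifte _ A B => A.stores || B.stores
  | .loop _ A => A.stores

/-- Whether a program contains a coin flip. -/
def flips : Prog → Bool
  | .skip => false
  | .assign _ _ => false
  | .store _ _ => false
  | .flip _ => true
  | .seq A B => A.flips || B.flips
  | .ifte _ A B => A.flips || B.flips
  | .loop _ A => A.flips

end Prog

/-- The states `σ` and `τ` differ at most in what the program `A` can change. -/
structure Frame (A : Prog) (σ τ : State) : Prop where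
  reg : ∀ r, r ∉ A.writes → τ.reg r = σ.reg r
  mem : A.stores = false → τ.mem = σ.mem
  coins : A.flips = false → τ.coins = σ.coins

theorem Frame.rfl {A : Prog} : Frame A σ σ := ⟨fun _ _ => by rfl, fun _ => by rfl, fun _ => by rfl⟩

theorem Frame.trans {A : Prog} {τ ρ : State} (h : Frame A σ τ) (h' : Frame A τ ρ) :
    Frame A σ ρ :=
  ⟨fun r hr => (h'.reg r hr).trans (h.reg r hr), fun hs => (h'.mem hs).trans (h.mem hs),
    fun hs => (h'.coins hs).trans (h.coins hs)⟩

theorem Frame.mono {A B : Prog} {τ : State} (h : Frame A σ τ)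
    (h1 : ∀ r, r ∉ B.writes → r ∉ A.writes) (h2 : B.stores = false → A.stores = false)
    (h3 : B.flips = false → A.flips = false) : Frame B σ τ :=
  ⟨fun r hr => h.reg r (h1 r hr), fun hs => h.mem (h2 hs), fun hs => h.coins (h3 hs)⟩

/-- What a program may change is read off from its text, so that most preservation facts below are
settled by `decide`. -/
theorem Exec.frame {ω : ℕ → Bool} {A : Prog} {σ τ : State} {t : ℕ} (h : Exec ω A σ t τ) :
    Frame A σ τ := by
  induction h with
  | skip => exact Frame.rfl
  | assign r e σ =>
    refine ⟨fun r' hr => ?_, fun _ => rfl, fun _ => rfl⟩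
    simp only [Prog.writes, List.mem_singleton] at hr
    simp [hr]
  | store => exact ⟨fun _ _ => rfl, fun h => by simp [Prog.stores] at h, fun _ => rfl⟩
  | flip r σ =>
    refine ⟨fun r' hr => ?_, fun _ => rfl, fun h => by simp [Prog.flips] at h⟩
    simp only [Prog.writes, List.mem_singleton] at hr
    simp [hr]
  | seq _ _ ih₁ ih₂ =>
    refine (ih₁.mono ?_ ?_ ?_).trans (ih₂.mono ?_ ?_ ?_) <;>
      simp +contextual [Prog.writes, Prog.stores, Prog.flips]
  | ifte_true _ _ ih =>
    refine ih.mono ?_ ?_ ?_ <;> simp +contextual [Prog.writes, Prog.stores, Prog.flips]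
  | ifte_false _ _ ih =>
    refine ih.mono ?_ ?_ ?_ <;> simp +contextual [Prog.writes, Prog.stores, Prog.flips]
  | loop_true _ _ _ ih₁ ih₂ =>
    refine (ih₁.mono ?_ ?_ ?_).trans ih₂ <;>
      simp +contextual [Prog.writes, Prog.stores, Prog.flips]
  | loop_false => exact Frame.rfl

/-- Started in `σ`, the program `A` halts in a state with `Q`, it stores only numbers of binary
length at most `S`, and its cost is at most `N * (S + 1)`, provided that the numbers stored in `σ`
have binary length at most `S`. -/
def Runs (S : ℕ) (ω : ℕ → Bool) (A : Prog) (σ : State) (N : ℕ) (Q : State → Prop) : Prop :=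
  Bounded S σ → ∃ t τ, t ≤ N * (S + 1) ∧ Exec ω A σ t τ ∧ Bounded S τ ∧ Q τ

/-! ### Hoare rules with costs -/

namespace Runs

variable {ω : ℕ → Bool} {A B : Prog} {e : Exp} {N N' N₁ N₂ : ℕ} {Q Q' : State → Prop}

theorem mono (h : Runs S ω A σ N Q) (hN : N ≤ N') (hQ : ∀ τ, Q τ → Q' τ) :
    Runs S ω A σ N' Q' := by
  intro hb
  obtain ⟨t, τ, ht, he, hb', hq⟩ := h hb
  exact ⟨t, τ, ht.trans (Nat.mul_le_mul_right _ hN), he, hb', hQ τ hq⟩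

theorem mono_cost (h : Runs S ω A σ N Q) (hN : N ≤ N') : Runs S ω A σ N' Q :=
  h.mono hN fun _ hq => hq

theorem frame (h : Runs S ω A σ N fun τ => Frame A σ τ → Q τ) : Runs S ω A σ N Q := by
  intro hb
  obtain ⟨t, τ, ht, he, hb', hq⟩ := h hb
  exact ⟨t, τ, ht, he, hb', hq he.frame⟩

theorem skip (h : Q σ) : Runs S ω .skip σ 1 Q :=
  fun hb => ⟨1, σ, by omega, .skip σ, hb, h⟩

theorem assign {r : ℕ} (hv : e.eval σ < 2 ^ S) (h : Q (σ.set r (e.eval σ))) :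
    Runs S ω (.assign r e) σ (1 + e.weight) Q := by
  refine fun hb => ⟨_, _, ?_, .assign r e σ, ⟨fun r' => ?_, hb.2⟩, h⟩
  · have := e.cost_le hb
    nlinarith
  · change (σ.set r (e.eval σ)).reg r' < _
    rw [State.set_reg]
    split_ifs
    exacts [hv, hb.1 _]

theorem store {a : Exp} (hv : e.eval σ < 2 ^ S) (h : Q (σ.put (a.eval σ) (e.eval σ))) :
    Runs S ω (.store a e) σ (1 + a.weight + e.weight) Q := by
  refine fun hb => ⟨_, _, ?_, .store a e σ, ⟨hb.1, fun a' => ?_⟩, h⟩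
  · have := e.cost_le hb
    have := a.cost_le hb
    nlinarith
  · change (σ.put (a.eval σ) (e.eval σ)).mem a' < _
    rw [State.put_mem]
    split_ifs
    exacts [hv, hb.2 _]

theorem flip {r : ℕ} (hS : 1 ≤ S) (h : Q (σ.toss ω r)) : Runs S ω (.flip r) σ 1 Q := by
  refine fun hb => ⟨_, _, ?_, .flip r σ, ⟨fun r' => ?_, hb.2⟩, h⟩
  · omega
  · change (σ.toss ω r).reg r' < _
    rw [State.toss_reg]
    split_ifs
    · calc (ω σ.coins).toNat < 2 ^ 1 := by cases ω σ.coins <;> simp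
        _ ≤ 2 ^ S := Nat.pow_le_pow_right (by norm_num) hS
    · exact hb.1 _

theorem seq (h : Runs S ω A σ N₁ fun τ => Frame A σ τ → Runs S ω B τ N₂ Q) :
    Runs S ω (.seq A B) σ (N₁ + N₂) Q := by
  intro hb
  obtain ⟨t, τ, ht, he, hb', hq⟩ := h hb
  obtain ⟨u, ρ, hu, he', hb'', hq'⟩ := hq he.frame hb'
  exact ⟨t + u, ρ, by rw [add_mul]; omega, .seq he he', hb'', hq'⟩

theorem bind (h : Runs S ω A σ N₁ Q') (h' : ∀ τ, Q' τ → Frame A σ τ → Runs S ω B τ N₂ Q) :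
    Runs S ω (.seq A B) σ (N₁ + N₂) Q :=
  (h.mono le_rfl h').seq

/-- The costs of the two branches are added instead of taking their maximum, which keeps the bounds
polynomial expressions. -/
theorem ifte (h₁ : e.eval σ ≠ 0 → Runs S ω A σ N₁ Q) (h₂ : e.eval σ = 0 → Runs S ω B σ N₂ Q) :
    Runs S ω (.ifte e A B) σ (1 + e.weight + (N₁ + N₂)) Q := by
  intro hb
  have hc := e.cost_le hb
  by_cases h : e.eval σ = 0
  · obtain ⟨t, τ, ht, he, hb', hq⟩ := h₂ h hb
    exact ⟨_, τ, by nlinarith, .ifte_false h he, hb', hq⟩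
  · obtain ⟨t, τ, ht, he, hb', hq⟩ := h₁ h hb
    exact ⟨_, τ, by nlinarith, .ifte_true h he, hb', hq⟩

/-- The rule for a loop with invariant `I` that is run through `N` times. -/
theorem loop (I : ℕ → State → Prop) (N c : ℕ) (h₀ : I 0 σ)
    (hstep : ∀ i < N, ∀ τ, Frame A σ τ → I i τ → e.eval τ ≠ 0 ∧ Runs S ω A τ c (I (i + 1)))
    (hend : ∀ τ, Frame A σ τ → I N τ → e.eval τ = 0 ∧ Q τ) :
    Runs S ω (.loop e A) σ (N * (c + e.weight + 1) + e.weight + 1) Q := by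
  have key : ∀ m i, i + m = N → ∀ τ, Frame A σ τ → I i τ →
      Runs S ω (.loop e A) τ (m * (c + e.weight + 1) + e.weight + 1) Q := by
    intro m
    induction m with
    | zero =>
      intro i hi τ hf hI hb
      obtain rfl : i = N := by omega
      obtain ⟨h0, hq⟩ := hend τ hf hI
      have := e.cost_le hb
      exact ⟨_, τ, by nlinarith, .loop_false h0, hb, hq⟩
    | succ m ih =>
      intro i hi τ hf hI hb
      obtain ⟨h0, hr⟩ := hstep i (by omega) τ hf hI
      have := e.cost_le hb
      obtain ⟨t, ρ, ht, he, hb', hI'⟩ := hr hb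
      obtain ⟨u, κ, hu, he', hb'', hq⟩ := ih (i + 1) (by omega) ρ (hf.trans he.frame) hI' hb'
      exact ⟨_, κ, by nlinarith, .loop_true h0 he he', hb'', hq⟩
  exact key N 0 (by omega) σ Frame.rfl h₀

end Runs

end RAM

/-! ### Summing over orientations with few states

The sum over all colorings of a product over the edges is expanded into a sum over the orientations
of the edges, and the latter is computed edge by edge. A vertex remembers how many of its edges
leave it, until more than half of its edges have been processed; then it guesses how many of the
remaining ones will leave it, and counts them down. -/

namespace Orient

open Finset

variable {n : ℕ} {R : Type*} [CommRing R] (u v : ℕ → Fin n) (E : Finset ℕ)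

/-- The number of edges from `F` at the vertex `x`. -/
def inc (F : Finset ℕ) (x : Fin n) : ℕ := #{z ∈ F | u z = x ∨ v z = x}

/-- The number of edges from `F` that leave the vertex `x`, if those in `T` leave their first end
and the others leave their second end. -/
def out (F T : Finset ℕ) (x : Fin n) : ℕ := #{z ∈ F | (if z ∈ T then u z else v z) = x}

variable (μ : Fin n → ℕ → R)

/-- The contribution of a vertex in state `g` after the edges in `F` have been processed, `o` of
which leave it. -/
def local_ (F : Finset ℕ) (x : Fin n) (o g : ℕ) : R :=
  if inc u v F x ≤ inc u v E x / 2 then (if g = o then 1 else 0)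
  else if g ≤ inc u v E x - inc u v F x then μ x (o + g) else 0

/-- The weight of the states after the edges in `F` have been processed. -/
def amplitude (F : Finset ℕ) (g : Fin n → Fin n) : R :=
  ∑ T ∈ F.powerset, (-1) ^ #(F \ T) * ∏ x, local_ u v E μ F x (out u v F T x) (g x)

/-- The weight of the transition of a vertex from state `c` to state `c'`, when an edge at it is
processed that leaves it (`b = 1`) or enters it (`b = 0`). -/
def weight (F : Finset ℕ) (x : Fin n) (b c c' : ℕ) : R :=
  if inc u v F x < inc u v E x / 2 then (if c' = c + b then 1 else 0)
  else if inc u v F x = inc u v E x / 2 then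
    (if c' < inc u v E x - inc u v F x then μ x (c + b + c') else 0)
  else (if c = c' + b ∧ c' < inc u v E x - inc u v F x then 1 else 0)

/-- The transition of the weights, when an edge at `x` is processed. -/
def transfer (F : Finset ℕ) (x : Fin n) (b : ℕ) (V : (Fin n → Fin n) → R) (h : Fin n → Fin n) : R :=
  ∑ c : Fin n, weight u v E μ F x b c (h x) * V (Function.update h x c)

variable {u v E μ}

theorem inc_mono {F F' : Finset ℕ} (h : F ⊆ F') (x : Fin n) : inc u v F x ≤ inc u v F' x :=
  card_le_card (filter_subset_filter _ h)

theorem inc_insert {F : Finset ℕ} {z : ℕ} (hz : z ∉ F) (x : Fin n) :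
    inc u v (insert z F) x = inc u v F x + if u z = x ∨ v z = x then 1 else 0 := by
  unfold inc
  rw [filter_insert]
  split_ifs
  · rw [card_insert_of_notMem (by simp [hz])]
  · rfl

theorem out_le_inc (F T : Finset ℕ) (x : Fin n) : out u v F T x ≤ inc u v F x := by
  refine card_le_card fun z => ?_
  simp only [mem_filter]
  split_ifs <;> tauto

theorem out_insert_of_subset {F T : Finset ℕ} {z : ℕ} (hz : z ∉ F) (hT : T ⊆ F) (x : Fin n) :
    out u v (insert z F) T x = out u v F T x + if v z = x then 1 else 0 := by
  have hzT : z ∉ T := fun h => hz (hT h)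
  unfold out
  rw [filter_insert]
  simp only [hzT, if_false]
  split_ifs
  · rw [card_insert_of_notMem (by simp [hz])]
  · rfl

theorem out_insert_insert {F T : Finset ℕ} {z : ℕ} (hz : z ∉ F) (x : Fin n) :
    out u v (insert z F) (insert z T) x = out u v F T x + if u z = x then 1 else 0 := by
  unfold out
  have : F.filter (fun y => (if y ∈ insert z T then u y else v y) = x)
      = F.filter (fun y => (if y ∈ T then u y else v y) = x) := by
    refine filter_congr fun y hy => ?_
    have : y ≠ z := fun h => hz (h ▸ hy)
    simp [this]
  rw [filter_insert, this]
  simp only [mem_insert_self, if_true]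
  split_ifs
  · rw [card_insert_of_notMem (by simp [hz])]
  · rfl

theorem sum_ite_val_eq {m : ℕ} (hm : m < n) (f : ℕ → R) :
    ∑ c : Fin n, (if (c : ℕ) = m then f c else 0) = f m := by
  rw [Finset.sum_eq_single (⟨m, hm⟩ : Fin n)]
  · simp
  · intro b _ hb
    rw [if_neg]
    exact fun h => hb (Fin.ext h)
  · simp

/-- The heart of the state compression, at a single vertex. Below the half the state is the number
`o` of outgoing edges and is raised by `b`. At the half a guess `c'` for the rest is made and the
moment of `o + b + c'` enters. Beyond it `o + c` stays the predicted total: `b` moves from the guess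
to the count. The bound `hdeg` makes all states involved elements of `Fin n`. -/
theorem sum_weight_mul_local {F : Finset ℕ} {z : ℕ} (hF : F ⊆ E) (hz : z ∈ E) (hzF : z ∉ F)
    {x : Fin n} (hx : u z = x ∨ v z = x) (hdeg : inc u v E x < n) {o b : ℕ}
    (ho : o ≤ inc u v F x) (hb : b ≤ 1) (c' : Fin n) :
    ∑ c : Fin n, weight u v E μ F x b c c' * local_ u v E μ F x o c
      = local_ u v E μ (insert z F) x (o + b) c' := by
  have h1 : inc u v (insert z F) x = inc u v F x + 1 := by rw [inc_insert hzF, if_pos hx]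
  have h2 : inc u v (insert z F) x ≤ inc u v E x := inc_mono (insert_subset hz hF) x
  unfold weight local_
  rw [h1]
  rw [h1] at h2
  set j := inc u v F x
  set d := inc u v E x
  rcases lt_trichotomy j (d / 2) with h | h | h
  · have e1 : j ≤ d / 2 := h.le
    have e2 : j + 1 ≤ d / 2 := h
    simp only [h, e1, e2, if_true]
    have : ∀ c : Fin n, ((if (c' : ℕ) = c + b then (1 : R) else 0) * if (c : ℕ) = o then 1 else 0)
        = if (c : ℕ) = o then (if (c' : ℕ) = c + b then (1 : R) else 0) else 0 := by
      intro c; split_ifs <;> simp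
    simp only [this]
    rw [sum_ite_val_eq (by omega) fun c => if (c' : ℕ) = c + b then (1 : R) else 0]
  · have e1 : j ≤ d / 2 := h.le
    have e2 : ¬ j + 1 ≤ d / 2 := by omega
    have e3 : ¬ j < d / 2 := by omega
    simp only [e2, e1, e3, if_pos h, if_true, if_false]
    have : ∀ c : Fin n, ((if (c' : ℕ) < d - j then μ x (c + b + c') else 0) *
          if (c : ℕ) = o then 1 else 0)
        = if (c : ℕ) = o then (if (c' : ℕ) < d - j then μ x (c + b + c') else 0) else 0 := by
      intro c; split_ifs <;> simp
    simp only [this]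
    rw [sum_ite_val_eq (by omega) fun c => if (c' : ℕ) < d - j then μ x (c + b + c') else 0]
    exact if_congr (by omega) rfl rfl
  · have e1 : ¬ j ≤ d / 2 := by omega
    have e2 : ¬ j + 1 ≤ d / 2 := by omega
    have e3 : ¬ j < d / 2 := by omega
    have e4 : ¬ j = d / 2 := by omega
    simp only [e2, e1, e3, e4, if_false]
    by_cases hc : (c' : ℕ) < d - j
    · have : ∀ c : Fin n, ((if (c : ℕ) = c' + b ∧ (c' : ℕ) < d - j then (1 : R) else 0) *
            if (c : ℕ) ≤ d - j then μ x (o + c) else 0)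
          = if (c : ℕ) = c' + b then (if (c : ℕ) ≤ d - j then μ x (o + c) else 0) else 0 := by
        intro c; simp only [hc, and_true]; split_ifs <;> simp
      simp only [this]
      rw [sum_ite_val_eq (by omega) fun c => if c ≤ d - j then μ x (o + c) else 0,
        if_pos (by omega), if_pos (by omega)]
      congr 1
      omega
    · simp only [hc, and_false, if_false, zero_mul, sum_const_zero]
      rw [if_neg (by omega)]

/-- On a product over the vertices a transfer at `x` acts on the factor of `x` alone, which reduces
everything to `sum_weight_mul_local`. -/
theorem transfer_prod {F : Finset ℕ} {x : Fin n} {b : ℕ} (f f' : Fin n → Fin n → R)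
    (hne : ∀ y, y ≠ x → f' y = f y)
    (hx : ∀ c' : Fin n, ∑ c : Fin n, weight u v E μ F x b c c' * f x c = f' x c') (h : Fin n → Fin n) :
    transfer u v E μ F x b (fun g => ∏ y, f y (g y)) h = ∏ y, f' y (h y) := by
  unfold transfer
  have h1 : ∀ c, ∏ y, f y (Function.update h x c y) = f x c * ∏ y ∈ univ.erase x, f y (h y) := by
    intro c
    rw [← mul_prod_erase univ _ (mem_univ x), Function.update_self]
    congr 1
    refine prod_congr rfl fun y hy => ?_
    rw [Function.update_of_ne (ne_of_mem_erase hy)]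
  simp only [h1]
  rw [← mul_prod_erase univ (fun y => f' y (h y)) (mem_univ x), ← hx, sum_mul]
  have h2 : ∏ y ∈ univ.erase x, f' y (h y) = ∏ y ∈ univ.erase x, f y (h y) :=
    prod_congr rfl fun y hy => by rw [hne y (ne_of_mem_erase hy)]
  rw [h2]
  exact sum_congr rfl fun c _ => by rw [mul_assoc]

theorem transfer_sum {ι : Type*} {F : Finset ℕ} {x : Fin n} {b : ℕ} (s : Finset ι) (a : ι → R)
    (V : ι → (Fin n → Fin n) → R) (h : Fin n → Fin n) :
    transfer u v E μ F x b (fun g => ∑ i ∈ s, a i * V i g) h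
      = ∑ i ∈ s, a i * transfer u v E μ F x b (V i) h := by
  unfold transfer
  simp only [mul_sum]
  rw [sum_comm]
  exact sum_congr rfl fun i _ => sum_congr rfl fun c _ => by ring

/-- The two ends are different, so their factors are advanced independently. Both transfers may
refer to the same `F`, since each one looks only at the edges at its own vertex; at the other
vertices `inc` does not change. -/
theorem transfer_transfer_prod {F T : Finset ℕ} {z : ℕ} (hF : F ⊆ E) (hz : z ∈ E) (hzF : z ∉ F)
    {x y : Fin n} (hxy : x ≠ y) (hx : (u z = x ∧ v z = y) ∨ (u z = y ∧ v z = x))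
    (hdeg : ∀ x, inc u v E x < n) {b b' : ℕ}
    (hb : b ≤ 1) (hb' : b' ≤ 1) (h : Fin n → Fin n) :
    transfer u v E μ F y b' (transfer u v E μ F x b
        fun g => ∏ w, local_ u v E μ F w (out u v F T w) (g w)) h
      = ∏ w, local_ u v E μ (insert z F) w
          (out u v F T w + if w = x then b else if w = y then b' else 0) (h w) := by
  have e1 : (transfer u v E μ F x b fun g => ∏ w, local_ u v E μ F w (out u v F T w) (g w))
      = fun g => ∏ w, (if w = x then local_ u v E μ (insert z F) w (out u v F T w + b) (g w)
          else local_ u v E μ F w (out u v F T w) (g w)) := by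
    funext g
    refine transfer_prod (fun w c => local_ u v E μ F w (out u v F T w) c)
      (fun w c => if w = x then local_ u v E μ (insert z F) w (out u v F T w + b) c
          else local_ u v E μ F w (out u v F T w) c) ?_ ?_ g
    · intro w hw; simp [hw]
    · intro c'
      simp only [if_true]
      exact sum_weight_mul_local hF hz hzF (by tauto) (hdeg x) (out_le_inc _ _ _) hb c'
  rw [e1]
  refine transfer_prod (fun w c => if w = x then
      local_ u v E μ (insert z F) w (out u v F T w + b) c
          else local_ u v E μ F w (out u v F T w) c)
    (fun w c => local_ u v E μ (insert z F) w
          (out u v F T w + if w = x then b else if w = y then b' else 0) c) ?_ ?_ h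
  · intro w hw
    funext c
    by_cases hwx : w = x
    · simp [hwx]
    · have h1 : ¬ (u z = w ∨ v z = w) := by
        rcases hx with ⟨h1, h2⟩ | ⟨h1, h2⟩ <;> rw [h1, h2] <;> tauto
      have h2 : inc u v (insert z F) w = inc u v F w := by rw [inc_insert hzF, if_neg h1, add_zero]
      simp [hwx, hw, local_, h2]
  · intro c'
    simp only [hxy.symm, if_false, if_true]
    exact sum_weight_mul_local hF hz hzF (by tauto) (hdeg y) (out_le_inc _ _ _) hb' c'

/-- Processing an edge. -/
theorem amplitude_insert {F : Finset ℕ} {z : ℕ} (hF : F ⊆ E) (hz : z ∈ E) (hzF : z ∉ F)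
    (huv : u z ≠ v z) (hdeg : ∀ x, inc u v E x < n) (h : Fin n → Fin n) :
    amplitude u v E μ (insert z F) h
      = transfer u v E μ F (v z) 0 (transfer u v E μ F (u z) 1 (amplitude u v E μ F)) h
        - transfer u v E μ F (v z) 1 (transfer u v E μ F (u z) 0 (amplitude u v E μ F)) h := by
  have key : ∀ b b', b ≤ 1 → b' ≤ 1 →
      transfer u v E μ F (v z) b' (transfer u v E μ F (u z) b (amplitude u v E μ F)) h
        = ∑ T ∈ F.powerset, (-1) ^ #(F \ T) * ∏ w, local_ u v E μ (insert z F) w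
          (out u v F T w + if w = u z then b else if w = v z then b' else 0) (h w) := by
    intro b b' hb hb'
    have e1 : transfer u v E μ F (u z) b (amplitude u v E μ F)
        = fun g => ∑ T ∈ F.powerset, (-1) ^ #(F \ T) * transfer u v E μ F (u z) b
            (fun g => ∏ w, local_ u v E μ F w (out u v F T w) (g w)) g := by
      funext g
      exact transfer_sum F.powerset (fun T => (-1) ^ #(F \ T))
        (fun T g => ∏ w, local_ u v E μ F w (out u v F T w) (g w)) g
    rw [e1, transfer_sum]
    refine sum_congr rfl fun T _ => ?_
    rw [transfer_transfer_prod hF hz hzF huv (.inl ⟨rfl, rfl⟩) hdeg hb hb']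
  -- An orientation of the enlarged set either has `z` in `T`, with unchanged sign and one more edge
  -- leaving `u z`, or has `z` outside `T`, which gives the minus sign and one more edge leaving `v
  -- z`.
  rw [key 1 0 le_rfl (by norm_num), key 0 1 (by norm_num) le_rfl, amplitude,
    sum_powerset_insert hzF, add_comm, sub_eq_add_neg, ← sum_neg_distrib]
  congr 1
  · refine sum_congr rfl fun T hT => ?_
    rw [mem_powerset] at hT
    have e1 : insert z F \ insert z T = F \ T := by
      ext y
      simp only [mem_sdiff, mem_insert]
      constructor
      · rintro ⟨h1, h2⟩; tauto
      · rintro ⟨h1, h2⟩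
        refine ⟨.inr h1, ?_⟩
        rintro (rfl | h3)
        · exact hzF h1
        · exact h2 h3
    rw [e1]
    congr 1
    refine prod_congr rfl fun w _ => ?_
    rw [out_insert_insert hzF]
    congr 2
    by_cases hw : w = u z
    · simp [hw]
    · rw [if_neg (fun h => hw h.symm), if_neg hw]; simp
  · refine sum_congr rfl fun T hT => ?_
    rw [mem_powerset] at hT
    have hzT : z ∉ T := fun h => hzF (hT h)
    have e1 : insert z F \ T = insert z (F \ T) := insert_sdiff_of_notMem _ hzT
    rw [e1, card_insert_of_notMem (by simp [hzF]), pow_succ, mul_neg_one, neg_mul]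
    congr 2
    refine prod_congr rfl fun w _ => ?_
    rw [out_insert_of_subset hzF hT]
    congr 2
    by_cases hw : w = u z
    · rw [if_pos hw, hw, if_neg (Ne.symm huv)]
    · rw [if_neg hw]
      by_cases hv : w = v z
      · simp [hv]
      · rw [if_neg (fun h => hv h.symm), if_neg hv]

theorem amplitude_empty (g : Fin n → Fin n) [NeZero n] :
    amplitude u v E μ ∅ g = if g = 0 then 1 else 0 := by
  simp only [amplitude, powerset_empty, sum_singleton, sdiff_empty, card_empty, pow_zero, one_mul,
    local_, inc, out, filter_empty, zero_le, if_true]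
  split_ifs with h
  · subst h
    exact prod_eq_one fun x _ => by simp
  · obtain ⟨x, hx⟩ : ∃ x, g x ≠ 0 := by
      by_contra! hc
      exact h (funext hc)
    refine prod_eq_zero (mem_univ x) ?_
    rw [if_neg]
    exact fun h0 => hx (Fin.ext h0)

/-- The sum over all colorings with lists `L` of the product of the differences of the colors at the
two ends of the edges, weighted by powers of `r`. -/
def colorSum (u v : ℕ → Fin n) (E : Finset ℕ) (L : Fin n → Finset ℕ) (r : Fin n → R) : R :=
  ∑ c ∈ Fintype.piFinset L, (∏ x, r x ^ c x) * ∏ z ∈ E, ((c (u z) : R) - c (v z))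

/-- The moments of a weighted list. -/
def moment (L : Finset ℕ) (r : R) (e : ℕ) : R := ∑ a ∈ L, r ^ a * (a : R) ^ e

/-- Choosing from each factor the term `c (u z)` or `- c (v z)` means choosing the end that the edge
leaves. -/
theorem prod_sub_eq (c : Fin n → R) :
    ∏ z ∈ E, (c (u z) - c (v z))
      = ∑ T ∈ E.powerset, (-1) ^ #(E \ T) * ∏ x, c x ^ out u v E T x := by
  simp only [sub_eq_add_neg]
  rw [prod_add]
  refine sum_congr rfl fun T hT => ?_
  rw [mem_powerset] at hT
  have e1 : ∏ z ∈ E \ T, -c (v z) = (-1) ^ #(E \ T) * ∏ z ∈ E \ T, c (v z) := by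
    rw [← prod_const, ← prod_mul_distrib]
    exact prod_congr rfl fun _ _ => by ring
  have e2 : ∏ x, c x ^ out u v E T x = ∏ z ∈ E, c (if z ∈ T then u z else v z) := by
    unfold out
    rw [← prod_fiberwise' (s := E) (g := fun z => if z ∈ T then u z else v z) (f := c)]
    exact prod_congr rfl fun x _ => by rw [prod_const]
  rw [e1, e2, ← prod_sdiff hT]
  have e3 : ∏ z ∈ E \ T, c (if z ∈ T then u z else v z) = ∏ z ∈ E \ T, c (v z) :=
    prod_congr rfl fun z hz => by rw [if_neg (mem_sdiff.1 hz).2]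
  have e4 : ∏ z ∈ T, c (if z ∈ T then u z else v z) = ∏ z ∈ T, c (u z) :=
    prod_congr rfl fun z hz => by rw [if_pos hz]
  rw [e3, e4]
  ring

theorem colorSum_eq (L : Fin n → Finset ℕ) (r : Fin n → R) :
    colorSum u v E L r = ∑ T ∈ E.powerset, (-1) ^ #(E \ T) *
      ∏ x, moment (L x) (r x) (out u v E T x) := by
  unfold colorSum moment
  simp only [prod_sub_eq fun x => ((_ : ℕ) : R), mul_sum]
  rw [sum_comm]
  refine sum_congr rfl fun T _ => ?_
  rw [prod_univ_sum, mul_sum]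
  refine sum_congr rfl fun c _ => ?_
  rw [prod_mul_distrib]
  ring

/-- Connects the sum over `ℤ`, where Schwartz–Zippel is applied, with the one over `ZMod M` that the
program computes. -/
theorem colorSum_map {R' : Type*} [CommRing R'] (f : R →+* R') (L : Fin n → Finset ℕ)
    (r : Fin n → R) : f (colorSum u v E L r) = colorSum u v E L fun x => f (r x) := by
  simp [colorSum, map_sum, map_prod]

/-- The lists `L`, with the single color `0` at the isolated vertices. -/
def trimmed (u v : ℕ → Fin n) (E : Finset ℕ) (L : Fin n → Finset ℕ) (x : Fin n) : Finset ℕ :=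
  if inc u v E x = 0 then {0} else L x

/-- After all edges, state `0` means that the guess was right, and the factor is the moment of the
outdegree. A vertex without edges never crosses its half, so its moment is never paid and its factor
is `1`. This is the moment of order `0` of the list `{0}`, whence `trimmed`. -/
theorem amplitude_zero [NeZero n] (L : Fin n → Finset ℕ) (r : Fin n → R) :
    amplitude u v E (fun x => moment (L x) (r x)) E 0 = colorSum u v E (trimmed u v E L) r := by
  rw [colorSum_eq, amplitude]
  refine sum_congr rfl fun T _ => ?_
  congr 1
  refine prod_congr rfl fun x _ => ?_
  unfold local_ trimmed
  by_cases h : inc u v E x = 0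
  · have : out u v E T x = 0 := Nat.le_zero.1 (h ▸ out_le_inc E T x)
    simp [h, this, moment]
  · rw [if_neg (by omega), if_neg h]
    simp

/-- Fixing the color of a vertex. -/
theorem colorSum_eq_sum {L : Fin n → Finset ℕ} {r : Fin n → R} (y : Fin n) :
    colorSum u v E L r = ∑ a ∈ L y, colorSum u v E (Function.update L y {a}) r := by
  have h : ∀ T : Finset ℕ, ∏ x, moment (L x) (r x) (out u v E T x)
      = ∑ a ∈ L y, ∏ x, moment (Function.update L y {a} x) (r x) (out u v E T x) := by
    intro T
    have h1 : ∀ a, ∏ x, moment (Function.update L y {a} x) (r x) (out u v E T x)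
        = (r y ^ a * (a : R) ^ out u v E T y) *
          ∏ x ∈ univ.erase y, moment (L x) (r x) (out u v E T x) := by
      intro a
      rw [← mul_prod_erase univ _ (mem_univ y), Function.update_self]
      congr 1
      · simp [moment]
      · exact prod_congr rfl fun x hx => by rw [Function.update_of_ne (ne_of_mem_erase hx)]
    simp only [h1]
    rw [← sum_mul, ← mul_prod_erase univ _ (mem_univ y)]
    rfl
  simp only [colorSum_eq, h, mul_sum]
  rw [sum_comm]

/-! Bounds for the states -/

/-- The largest state of a vertex after the edges in `F` have been processed. -/
def cap (u v : ℕ → Fin n) (E F : Finset ℕ) (x : Fin n) : ℕ :=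
  if inc u v F x ≤ inc u v E x / 2 then inc u v F x else inc u v E x - inc u v F x

/-- Beyond the half at least `d / 2 + 1` of the `d` edges are processed, so at most `d / 2` remain:
the source of the base `⌊Δ/2⌋ + 1`. -/
theorem cap_le (F : Finset ℕ) (x : Fin n) : cap u v E F x ≤ inc u v E x / 2 := by
  unfold cap
  split_ifs <;> omega

theorem le_cap_of_weight_ne_zero {F : Finset ℕ} {z : ℕ} (hzF : z ∉ F) {x : Fin n}
    (hx : u z = x ∨ v z = x) {b c c' : ℕ} (hb : b ≤ 1) (hc : c ≤ cap u v E F x)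
    (hw : weight u v E μ F x b c c' ≠ 0) : c' ≤ cap u v E (insert z F) x := by
  have h1 : inc u v (insert z F) x = inc u v F x + 1 := by rw [inc_insert hzF, if_pos hx]
  unfold weight at hw
  unfold cap at hc ⊢
  rw [h1]
  split_ifs at hw hc ⊢ <;> first | omega | (exact absurd rfl hw)

/-- A vertex with nothing processed counts zero, and one with nothing left can only have guessed
zero. -/
theorem pos_of_cap_pos {F : Finset ℕ} (hF : F ⊆ E) {x : Fin n} (h : 0 < cap u v E F x) :
    0 < inc u v F x ∧ inc u v F x < inc u v E x := by
  have := inc_mono (u := u) (v := v) hF x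
  unfold cap at h
  split_ifs at h <;> omega

/-- The number of states below a bound that vanishes outside a small set. -/
theorem card_states_le {κ : Fin n → ℕ} {D w : ℕ} (hD : ∀ x, κ x ≤ D) {s : Finset (Fin n)}
    (hs : ∀ x, x ∉ s → κ x = 0) (hw : #s ≤ w) (l : Finset (Fin n → Fin n))
    (hl : ∀ g ∈ l, ∀ x, (g x : ℕ) ≤ κ x) : #l ≤ (D + 1) ^ w := by
  have h1 : #l ≤ #(Fintype.piFinset fun x => range (κ x + 1)) := by
    refine card_le_card_of_injOn (fun g x => (g x : ℕ)) ?_ ?_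
    · intro g hg
      simp only [mem_coe, Fintype.mem_piFinset, mem_range]
      exact fun x => Nat.lt_succ_of_le (hl g hg x)
    · intro g _ g' _ h
      funext x
      exact Fin.ext (congrFun h x)
  rw [Fintype.card_piFinset] at h1
  refine h1.trans ?_
  have h2 : ∏ x, #(range (κ x + 1)) = ∏ x ∈ s, (κ x + 1) := by
    simp only [card_range]
    refine (prod_subset (subset_univ s) fun x _ hx => ?_).symm
    rw [hs x hx, zero_add]
  rw [h2]
  calc ∏ x ∈ s, (κ x + 1) ≤ ∏ _x ∈ s, (D + 1) :=
        prod_le_prod' fun x _ => Nat.succ_le_succ (hD x)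
    _ = (D + 1) ^ #s := by rw [prod_const]
    _ ≤ (D + 1) ^ w := Nat.pow_le_pow_right (by omega) hw

end Orient

/-! ### The program -/

namespace RAM

infixr:50 " ;; " => RAM.Prog.seq
infix:55 " ≔ " => RAM.Prog.assign
notation "R[" r "]" => RAM.Exp.reg r
notation "M[" e "]" => RAM.Exp.cell e

/-! The registers. The first nine of them are not changed after the preparations. -/

notation "r_n" => (0 : ℕ)
notation "r_k" => (1 : ℕ)
notation "r_p" => (2 : ℕ)
notation "r_Z" => (3 : ℕ)
notation "r_base" => (4 : ℕ)
notation "r_B" => (5 : ℕ)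
notation "r_K" => (6 : ℕ)
notation "r_M" => (7 : ℕ)
notation "r_R" => (8 : ℕ)
notation "r_cur" => (9 : ℕ)
notation "r_delta" => (10 : ℕ)
notation "r_res" => (11 : ℕ)
notation "r_z" => (12 : ℕ)
notation "r_src" => (13 : ℕ)
notation "r_dst" => (14 : ℕ)
notation "r_x" => (15 : ℕ)
notation "r_b" => (16 : ℕ)
notation "r_w" => (17 : ℕ)
notation "r_j" => (18 : ℕ)
notation "r_d" => (19 : ℕ)
notation "r_pow" => (20 : ℕ)
notation "r_idx" => (21 : ℕ)
notation "r_key" => (22 : ℕ)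
notation "r_val" => (23 : ℕ)
notation "r_c" => (24 : ℕ)
notation "r_cc" => (25 : ℕ)
notation "r_wt" => (26 : ℕ)
notation "r_key2" => (27 : ℕ)
notation "r_a" => (28 : ℕ)
notation "r_hi" => (29 : ℕ)
notation "r_e" => (30 : ℕ)
notation "r_r" => (31 : ℕ)
notation "r_q1" => (32 : ℕ)
notation "r_q2" => (33 : ℕ)
notation "r_cnt" => (34 : ℕ)
notation "r_i" => (35 : ℕ)

/-- The address of a cell of one of the arrays of the program, which occupy the residue classes
modulo `8` behind the input. -/
def cellAddr (base kind i : ℕ) : ℕ := 8 * (base + i) + kind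

theorem cellAddr_inj {base kind kind' i i' : ℕ} (h : kind < 8) (h' : kind' < 8) :
    cellAddr base kind i = cellAddr base kind' i' ↔ kind = kind' ∧ i = i' := by
  unfold cellAddr
  omega

/-- The expression for an address in one of the arrays. -/
def addr (kind : ℕ) (i : Exp) : Exp := 8 * (R[r_base] + i) + .const kind

@[simp] theorem eval_addr (kind : ℕ) (i : Exp) (σ : State) :
    (addr kind i).eval σ = cellAddr (σ.reg r_base) kind (i.eval σ) := rfl

/-- The expression for `1` if the two values are equal, and `0` otherwise. -/
def eqExp (a b : Exp) : Exp := 1 - ((a - b) + (b - a))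

@[simp] theorem eval_eqExp (a b : Exp) (σ : State) :
    (eqExp a b).eval σ = if a.eval σ = b.eval σ then 1 else 0 := by
  simp only [eqExp, Exp.eval_sub, Exp.eval_add, Exp.eval_ofNat]
  split_ifs <;> omega

/-- Computes a power of the number in the register `β`. -/
def powProg (dst β : ℕ) (e : Exp) : Prog :=
  dst ≔ 1 ;; r_cnt ≔ e ;;
  .loop R[r_cnt] (dst ≔ R[dst] * R[β] ;; r_cnt ≔ R[r_cnt] - 1)

/-- Computes a moment of the weighted list of colors of the vertex `x`. -/
def momentProg : Prog :=
  r_e ≔ R[r_c] + R[r_b] + R[r_cc] ;;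
  r_r ≔ R[r_R] / R[r_pow] % R[r_B] ;;
  .ifte (R[r_cur] + 1 - R[r_x])
    (r_a ≔ M[R[r_x]] ;; r_hi ≔ M[R[r_x]] + 1)
    (r_a ≔ 0 ;; r_hi ≔ R[r_k]) ;;
  r_wt ≔ 0 ;;
  .loop (R[r_hi] - R[r_a])
    (powProg r_q1 r_r R[r_a] ;; powProg r_q2 r_a R[r_e] ;;
      r_wt ≔ (R[r_wt] + R[r_q1] * R[r_q2]) % R[r_M] ;; r_a ≔ R[r_a] + 1)

/-- Computes the weight of a transition at the vertex `x`. -/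
def weightProg : Prog :=
  .ifte (R[r_d] / 2 - R[r_j]) (r_wt ≔ eqExp R[r_cc] (R[r_c] + R[r_b]))
    (.ifte (R[r_j] - R[r_d] / 2)
      (r_wt ≔ eqExp R[r_c] (R[r_cc] + R[r_b]) * (1 - (1 - (R[r_d] - R[r_j] - R[r_cc]))))
      (.ifte (R[r_d] - R[r_j] - R[r_cc]) momentProg (r_wt ≔ 0)))

/-- Counts the edges at `x`, and those that precede the current edge. -/
def incidenceProg : Prog :=
  r_j ≔ 0 ;; r_d ≔ 0 ;; r_i ≔ 0 ;;
  .loop (R[r_Z] - R[r_i])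
    (.ifte (M[addr 4 R[r_i]] *
        (eqExp (R[r_i] / R[r_n] % R[r_n]) R[r_x] + eqExp (R[r_i] % R[r_n]) R[r_x]))
      (r_d ≔ R[r_d] + 1 ;; r_j ≔ R[r_j] + (1 - (1 - (R[r_z] - R[r_i]))))
      .skip ;;
    r_i ≔ R[r_i] + 1)

/-- Adds a key to the dictionary `dst` unless it is already there. -/
def insertProg : Prog :=
  .ifte M[addr 1 (R[r_dst] * R[r_K] + R[r_key2])] .skip
    (.store (addr 1 (R[r_dst] * R[r_K] + R[r_key2])) 1 ;;
    .store (addr 0 (R[r_dst] * R[r_K] + M[addr 3 (R[r_dst] * R[r_K])])) R[r_key2] ;;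
    .store (addr 3 (R[r_dst] * R[r_K])) (M[addr 3 (R[r_dst] * R[r_K])] + 1))

/-- Adds a multiple of the current value to the value of a key in the dictionary `dst`. -/
def pushProg : Prog :=
  r_key2 ≔ R[r_key] - R[r_c] * R[r_pow] + R[r_cc] * R[r_pow] ;;
  insertProg ;;
  .store (addr 2 (R[r_dst] * R[r_K] + R[r_key2]))
    ((M[addr 2 (R[r_dst] * R[r_K] + R[r_key2])] + R[r_w] * R[r_wt] * R[r_val]) % R[r_M])

/-- All transitions at `x` from the current key. -/
def keyProg : Prog :=
  r_key ≔ M[addr 0 (R[r_src] * R[r_K] + R[r_idx])] ;;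
  r_val ≔ M[addr 2 (R[r_src] * R[r_K] + R[r_key])] ;;
  r_c ≔ R[r_key] / R[r_pow] % R[r_B] ;;
  r_cc ≔ 0 ;;
  .loop (R[r_n] - R[r_cc])
    (weightProg ;; .ifte R[r_wt] pushProg .skip ;; r_cc ≔ R[r_cc] + 1)

/-- Adds `w` times the transfer at `x` of the dictionary `src` to the dictionary `dst`. -/
def transferProg : Prog :=
  incidenceProg ;; powProg r_pow r_B R[r_x] ;; r_idx ≔ 0 ;;
  .loop (M[addr 3 (R[r_src] * R[r_K])] - R[r_idx]) (keyProg ;; r_idx ≔ R[r_idx] + 1)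

/-- The transfer with the given arguments. -/
def callProg (src dst x b w : Exp) : Prog :=
  r_src ≔ src ;; r_dst ≔ dst ;; r_x ≔ x ;; r_b ≔ b ;; r_w ≔ w ;; transferProg

/-- Processes the current edge. -/
def edgeProg : Prog :=
  callProg R[r_delta] (R[r_delta] + 1) (R[r_z] / R[r_n] % R[r_n]) 0 1 ;;
  callProg (R[r_delta] + 1) (R[r_delta] + 3) (R[r_z] % R[r_n]) 1 (R[r_M] - 1) ;;
  callProg R[r_delta] (R[r_delta] + 2) (R[r_z] / R[r_n] % R[r_n]) 1 1 ;;
  callProg (R[r_delta] + 2) (R[r_delta] + 3) (R[r_z] % R[r_n]) 0 1 ;;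
  r_delta ≔ R[r_delta] + 3

/-- Computes the color sum for the current lists. -/
def evalProg : Prog :=
  r_delta ≔ R[r_delta] + 1 ;;
  .store (addr 1 (R[r_delta] * R[r_K])) 1 ;;
  .store (addr 2 (R[r_delta] * R[r_K])) 1 ;;
  .store (addr 3 (R[r_delta] * R[r_K])) 1 ;;
  r_z ≔ 0 ;;
  .loop (R[r_Z] - R[r_z])
    (.ifte M[addr 4 R[r_z]] edgeProg .skip ;; r_z ≔ R[r_z] + 1) ;;
  r_res ≔ M[addr 2 (R[r_delta] * R[r_K])]

/-- Finds the color of the current vertex. -/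
def vertexProg : Prog :=
  .store R[r_cur] 0 ;; r_res ≔ 0 ;;
  .loop (1 - R[r_res])
    (evalProg ;; .ifte R[r_res] .skip (.store R[r_cur] (M[R[r_cur]] + 1)))

/-- Finds the colors of all vertices. -/
def colorProg : Prog :=
  r_delta ≔ 0 ;; r_cur ≔ 0 ;;
  .loop (R[r_n] - R[r_cur]) (vertexProg ;; r_cur ≔ R[r_cur] + 1)

/-- Marks the triples of a bag and two vertices that stand for the edges. -/
def markProg : Prog :=
  r_z ≔ 0 ;;
  .loop (R[r_Z] - R[r_z])
    (.ifte ((R[r_z] % R[r_n] - R[r_z] / R[r_n] % R[r_n]) * M[3 + R[r_z] % (R[r_n] * R[r_n])] *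
        (M[3 + R[r_n] * R[r_n] + (R[r_z] / (R[r_n] * R[r_n]) * R[r_n] + R[r_z] / R[r_n] % R[r_n])] *
        M[3 + R[r_n] * R[r_n] + (R[r_z] / (R[r_n] * R[r_n]) * R[r_n] + R[r_z] % R[r_n])]))
      (.store (addr 4 R[r_z]) 1 ;; .store (3 + R[r_z] % (R[r_n] * R[r_n])) 0)
      .skip ;;
    r_z ≔ R[r_z] + 1)

/-- Draws a random number. -/
def randomProg : Prog :=
  r_R ≔ 0 ;; r_i ≔ 0 ;;
  .loop (2 * R[r_n] * R[r_n] - R[r_i])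
    (.flip r_a ;; r_R ≔ 2 * R[r_R] + R[r_a] ;; r_i ≔ R[r_i] + 1)

/-- The case of fewer colors than vertices. -/
def mainProg : Prog :=
  r_Z ≔ R[r_p] * R[r_n] * R[r_n] ;;
  r_base ≔ 3 + R[r_n] * R[r_n] + R[r_p] * R[r_n] ;;
  markProg ;;
  r_a ≔ 4 ;; powProg r_B r_a R[r_n] ;; powProg r_K r_B R[r_n] ;;
  powProg r_M r_B (4 * R[r_n] * R[r_n]) ;;
  randomProg ;;
  colorProg

/-- Colors all vertices differently. -/
def identityProg : Prog :=
  r_i ≔ 0 ;; .loop (R[r_n] - R[r_i]) (.store R[r_i] R[r_i] ;; r_i ≔ R[r_i] + 1)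

/-- The algorithm. -/
def coloringProg : Prog :=
  .ifte M[0]
    (r_n ≔ M[0] ;; r_k ≔ M[1] ;; r_p ≔ M[2] ;;
      .ifte (R[r_n] - R[r_k]) mainProg identityProg)
    .skip

/-! ### The subroutines -/

open Orient

/-- The numbers that the first registers hold after the preparations. -/
structure Params where
  n : ℕ
  k : ℕ
  Z : ℕ
  base : ℕ
  B : ℕ
  K : ℕ
  M : ℕ
  R : ℕ
  [ne : NeZero n]

attribute [instance] Params.ne

namespace Params

variable (π : Params)

/-- The registers hold the parameters. -/
structure Loaded (σ : State) : Prop where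
  n : σ.reg r_n = π.n
  k : σ.reg r_k = π.k
  Z : σ.reg r_Z = π.Z
  base : σ.reg r_base = π.base
  B : σ.reg r_B = π.B
  K : σ.reg r_K = π.K
  M : σ.reg r_M = π.M
  R : σ.reg r_R = π.R

/-- The relations between the parameters, and bounds for the numbers that the program computes. -/
structure Fits (S : ℕ) : Prop where
  k_lt : π.k < π.n
  B_gt : π.n < π.B
  K_eq : π.K = π.B ^ π.n
  M_gt : 1 < π.M
  base_ge : π.n ≤ π.base
  K_lt : π.K < 2 ^ S
  M_lt : π.M < 2 ^ S
  Z_lt : π.Z + 1 < 2 ^ S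
  n_pow_lt : π.n ^ (2 * π.n) < 2 ^ S
  n_lt : 2 * π.n + 1 < 2 ^ S

/-- The first end of the edge with number `z`. -/
def fst (z : ℕ) : Fin π.n := Fin.ofNat π.n (z / π.n)

/-- The second end of the edge with number `z`. -/
def snd (z : ℕ) : Fin π.n := Fin.ofNat π.n z

@[simp] theorem val_fst (z : ℕ) : (π.fst z : ℕ) = z / π.n % π.n := rfl
@[simp] theorem val_snd (z : ℕ) : (π.snd z : ℕ) = z % π.n := rfl

/-- The edges are marked in the memory. -/
structure Edges (E : Finset ℕ) (mem : ℕ → ℕ) : Prop where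
  lt : ∀ z ∈ E, z < π.Z
  ne : ∀ z ∈ E, π.fst z ≠ π.snd z
  mark : ∀ z < π.Z, mem (cellAddr π.base 4 z) = if z ∈ E then 1 else 0
  inc_lt : ∀ x, inc π.fst π.snd E x < π.n

variable {π}

theorem Loaded.congr {σ τ : State} (h : π.Loaded σ) (hf : ∀ r < 9, τ.reg r = σ.reg r) :
    π.Loaded τ :=
  ⟨(hf _ (by decide)).trans h.n, (hf _ (by decide)).trans h.k, (hf _ (by decide)).trans h.Z,
    (hf _ (by decide)).trans h.base, (hf _ (by decide)).trans h.B, (hf _ (by decide)).trans h.K,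
    (hf _ (by decide)).trans h.M, (hf _ (by decide)).trans h.R⟩

end Params

variable {S : ℕ} {ω : ℕ → Bool} {σ : State} {π : Params}

theorem runs_pow {dst β : ℕ} {e : Exp} {m : ℕ} (h1 : β ≠ dst) (h2 : β ≠ r_cnt) (h3 : dst ≠ r_cnt)
    (he : e.eval (σ.set dst 1) = m) (hS : 1 < 2 ^ S) (hm : m < 2 ^ S)
    (hpow : σ.reg β ^ m < 2 ^ S) :
    Runs S ω (powProg dst β e) σ (20 * m + e.weight + 6) fun τ => τ.reg dst = σ.reg β ^ m := by
  have hle : ∀ i ≤ m, σ.reg β ^ i < 2 ^ S := by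
    intro i hi
    -- Powers of `0` are not monotone in the exponent, as `0 ^ 0 = 1`; this is where `hS` is needed.
    rcases Nat.eq_zero_or_pos (σ.reg β) with h0 | h0
    · rw [h0]
      exact (Nat.pow_le_pow_left (zero_le_one) i).trans_lt (by simpa using hS)
    · exact (Nat.pow_le_pow_right h0 hi).trans_lt hpow
  refine Runs.mono_cost (Runs.seq (Runs.assign ?_ fun _ => Runs.seq (Runs.assign ?_ fun _ =>
    Runs.loop (fun i τ => τ.reg dst = σ.reg β ^ i ∧ τ.reg r_cnt = m - i) m 16 ?_ ?_ ?_))) ?_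
  · simpa using hS
  · simpa [he] using hm
  · simp [he, h3]
  · rintro i hi τ hf ⟨hd, hc⟩
    have hb : τ.reg β = σ.reg β := by
      rw [hf.reg _ (by simp [Prog.writes, h1, h2])]; simp [h1, h2]
    refine ⟨by simp [hc]; omega, Runs.mono_cost (Runs.seq (Runs.assign ?_ fun _ =>
      Runs.assign ?_ ?_)) (by simp)⟩
    · simpa [hd, hb, ← pow_succ] using hle (i + 1) hi
    · simp [hc, h3.symm]; omega
    · simp [hd, hb, h3, h3.symm, hc, pow_succ]; omega
  · rintro τ - ⟨hd, hc⟩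
    simp [hc, hd]
  · simp; omega

end RAM

namespace RAM

open Orient Finset

variable {S : ℕ} {ω : ℕ → Bool} {σ τ : State} {π : Params}

/-! ### Parameters, moments and transition weights -/

namespace Params.Loaded

theorem frame {A : Prog} (h : π.Loaded σ) (hf : Frame A σ τ)
    (hA : ∀ r < 9, r ∉ A.writes := by decide) : π.Loaded τ :=
  h.congr fun r hr => hf.reg r (hA r hr)

theorem set (h : π.Loaded σ) {r v : ℕ} (hr : 9 ≤ r := by decide) : π.Loaded (σ.set r v) :=
  h.congr fun r' hr' => by rw [State.set_reg, if_neg (by omega)]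

theorem put (h : π.Loaded σ) {a v : ℕ} : π.Loaded (σ.put a v) :=
  h.congr fun _ _ => rfl

end Params.Loaded

namespace Params.Fits

theorem n_pos (_h : π.Fits S) : 0 < π.n := NeZero.pos π.n

theorem one_lt (h : π.Fits S) : 1 < 2 ^ S := by have := h.n_lt; omega

theorem B_le_K (h : π.Fits S) : π.B ≤ π.K := by
  rw [h.K_eq]
  exact Nat.le_self_pow h.n_pos.ne' _

theorem B_pos (h : π.Fits S) : 0 < π.B := by have := h.B_gt; omega

theorem K_pos (h : π.Fits S) : 0 < π.K := by have := h.B_le_K; have := h.B_pos; omega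

theorem B_pow_lt (h : π.Fits S) {i : ℕ} (hi : i ≤ π.n) : π.B ^ i < 2 ^ S :=
  (Nat.pow_le_pow_right h.B_pos hi).trans_lt (h.K_eq ▸ h.K_lt)

theorem pow_lt (h : π.Fits S) {a i : ℕ} (ha : a ≤ π.n) (hi : i ≤ 2 * π.n) : a ^ i < 2 ^ S :=
  ((Nat.pow_le_pow_left ha i).trans (Nat.pow_le_pow_right h.n_pos hi)).trans_lt h.n_pow_lt

end Params.Fits

/-- The lists of colors of the vertices: the vertices up to `cur` have been colored, the others are
still free. -/
def colorList (k cur : ℕ) (mem : ℕ → ℕ) (x : ℕ) : Finset ℕ :=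
  if x ≤ cur then {mem x} else range k

namespace Params

/-- The digits of the random number. -/
def digit (π : Params) (x : ℕ) : ZMod π.M := ((π.R / π.B ^ x % π.B : ℕ) : ZMod π.M)

/-- The moments of the current lists. -/
def moments (π : Params) (cur : ℕ) (mem : ℕ → ℕ) (x : Fin π.n) (e : ℕ) : ZMod π.M :=
  moment (colorList π.k cur mem x) (π.digit x) e

theorem moments_congr {cur : ℕ} {mem mem' : ℕ → ℕ} (h : ∀ y < π.n, mem' y = mem y) :
    π.moments cur mem' = π.moments cur mem := by
  funext x e
  simp [moments, colorList, h x x.2]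

end Params

/-- Both kinds of lists, a single color and all colors, are intervals, so one loop serves them. The
exponents are at most `n` for the weight and `2 * n` for the color, which keeps the powers within
the bounds of `Fits`. -/
theorem runs_moment (hL : π.Loaded σ) (hS : π.Fits S) {x : Fin π.n} (hx : σ.reg r_x = x)
    (hp : σ.reg r_pow = π.B ^ (x : ℕ)) {cur : ℕ} (hcur : σ.reg r_cur = cur) (hcur' : cur < π.n)
    (hmem : ∀ y ≤ cur, σ.mem y < π.k)
    (he : σ.reg r_c + σ.reg r_b + σ.reg r_cc ≤ 2 * π.n) :
    Runs S ω momentProg σ (π.n * (60 * π.n + 200) + 100) fun τ => τ.reg r_wt < π.M ∧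
      (τ.reg r_wt : ZMod π.M)
        = π.moments cur σ.mem x (σ.reg r_c + σ.reg r_b + σ.reg r_cc) := by
  have h1 := hS.n_lt
  have h2 := hS.k_lt
  have hB := hS.B_pow_lt (i := 1) hS.n_pos
  rw [pow_one] at hB
  have hrlt : σ.reg r_R / σ.reg r_pow % σ.reg r_B < π.B := by
    rw [hL.B]; exact Nat.mod_lt _ hS.B_pos
  set ee := σ.reg r_c + σ.reg r_b + σ.reg r_cc with hee
  set rr := σ.reg r_R / σ.reg r_pow % σ.reg r_B with hrr
  have hdig : π.digit x = (rr : ZMod π.M) := by rw [Params.digit, hrr, hL.R, hL.B, hp]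
  refine Runs.mono_cost (Runs.seq (Runs.assign ?_ fun _ => Runs.seq (Runs.assign ?_ fun _ =>
    Runs.bind (N₁ := 40) (N₂ := π.n * (60 * π.n + 160) + 20) ((Runs.ifte (N₁ := 12) (N₂ := 8)
      (Q := fun τ => ∃ lo len, τ.reg r_a = lo ∧ τ.reg r_hi = lo + len ∧ lo + len ≤ π.k ∧
        colorList π.k cur σ.mem x = Ico lo (lo + len)) (fun hc => ?_) (fun hc => ?_)).mono_cost
        ?_) ?_))) ?_
  · simp; omega
  · simp; omega
  · simp [hx, hcur] at hc
    have hxl : σ.mem x < π.k := hmem x (by omega)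
    refine Runs.mono_cost (Runs.seq (Runs.assign ?_ fun _ => Runs.assign ?_ ?_)) (by simp)
    · simp [hx]; omega
    · simp [hx]; omega
    · refine ⟨σ.mem x, 1, by simp [hx], by simp [hx], by omega, ?_⟩
      rw [colorList, if_pos (by omega)]
      simp
  · simp [hx, hcur] at hc
    refine Runs.mono_cost (Runs.seq (Runs.assign ?_ fun _ => Runs.assign ?_ ?_)) (by simp)
    · simp
    · simp [hL.k]; omega
    · refine ⟨0, π.k, by simp, by simp [hL.k], by omega, ?_⟩
      rw [colorList, if_neg (by omega)]
      simp
  · simp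
  · rintro τ ⟨lo, len, ha, hhi, hlk, hlist⟩ hf
    have hLt : π.Loaded τ := (hL.set.set).frame hf
    have hrt : τ.reg r_r = rr := by rw [hf.reg _ (by decide)]; simp [hrr]
    have het : τ.reg r_e = ee := by rw [hf.reg _ (by decide)]; simp [hee]
    refine Runs.mono_cost (Runs.seq (Runs.assign (by simp) fun _ => Runs.loop
      (fun i ρ => ρ.reg r_a = lo + i ∧ ρ.reg r_wt < π.M ∧
        (ρ.reg r_wt : ZMod π.M) = ∑ a ∈ Ico lo (lo + i), (rr : ZMod π.M) ^ a * (a : ZMod π.M) ^ ee)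
      len (60 * π.n + 150) ?_ ?_ ?_)) ?_
    · have := hS.M_gt
      simp [ha]
      omega
    · rintro i hi ρ hfr ⟨hai, hwM, hw⟩
      have hLr : π.Loaded ρ := (hLt.set).frame hfr
      have hrr' : ρ.reg r_r = rr := by rw [hfr.reg _ (by decide)]; simp [hrt]
      have her' : ρ.reg r_e = ee := by rw [hfr.reg _ (by decide)]; simp [het]
      have hhi' : ρ.reg r_hi = lo + len := by rw [hfr.reg _ (by decide)]; simp [hhi]
      refine ⟨by simp [hai, hhi']; omega, ?_⟩
      have hq1 : rr ^ (lo + i) < 2 ^ S :=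
        (Nat.pow_le_pow_left hrlt.le _).trans_lt (hS.B_pow_lt (by omega))
      refine Runs.mono_cost (Runs.bind (runs_pow (m := lo + i) (by decide) (by decide) (by decide)
        ?_ hS.one_lt ?_ ?_) fun κ hκ hfκ => Runs.bind (N₂ := 60) (runs_pow (m := ee) (by decide)
        (by decide) (by decide) ?_ hS.one_lt ?_ ?_) fun κ' hκ' hfκ' => ?_) ?_
      · simp [hai]
      · omega
      · rwa [hrr']
      · simp [hfκ.reg r_e (by decide), her']
      · omega
      · rw [hfκ.reg r_a (by decide), hai]
        exact hS.pow_lt (by omega) (by omega)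
      · have hL' : π.Loaded κ' := (hLr.frame hfκ).frame hfκ'
        have e1 : κ'.reg r_a = lo + i := by
          rw [hfκ'.reg _ (by decide), hfκ.reg _ (by decide), hai]
        have e2 : κ'.reg r_q1 = rr ^ (lo + i) := by
          rw [hfκ'.reg _ (by decide), hκ, hrr']
        have e3 : κ'.reg r_q2 = (lo + i) ^ ee := by
          rw [hκ', hfκ.reg _ (by decide), hai]
        have e4 : κ'.reg r_wt = ρ.reg r_wt := by
          rw [hfκ'.reg _ (by decide), hfκ.reg _ (by decide)]
        have hM : 0 < π.M := by omega
        refine Runs.mono_cost (Runs.seq (Runs.assign ?_ fun _ => Runs.assign ?_ ?_)) (by simp)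
        · simp only [Exp.eval_mod, Exp.eval_reg, hL'.M]
          exact (Nat.mod_lt _ hM).trans hS.M_lt
        · simp [e1]; omega
        · refine ⟨by simp [e1]; omega, by simp [hL'.M, Nat.mod_lt _ hM], ?_⟩
          simp only [State.set_reg, Exp.eval_mod, Exp.eval_add, Exp.eval_mul, Exp.eval_reg, hL'.M,
            e1, e2, e3, e4]
          simp only [Nat.reduceEqDiff, if_false, if_true, ZMod.natCast_mod]
          rw [← add_assoc lo, Finset.sum_Ico_succ_top (by omega)]
          push_cast
          rw [hw]
      · simp
        omega
    · rintro ρ hfr ⟨ha, hwM, hw⟩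
      refine ⟨?_, hwM, ?_⟩
      · rw [Exp.eval_sub, Exp.eval_reg, Exp.eval_reg, ha, hfr.reg r_hi (by decide)]
        simp [hhi]
      · rw [hw, Params.moments, moment, hlist, hdig]
    · have : len * (60 * π.n + 150 + (R[r_hi] - R[r_a]).weight + 1) ≤ π.n * (60 * π.n + 160) :=
        Nat.mul_le_mul (by omega) (by simp)
      simp at this ⊢
      omega
  · simp
    nlinarith


/-- The edges that precede the edge `z`. -/
def before (E : Finset ℕ) (z : ℕ) : Finset ℕ := {y ∈ E | y < z}

theorem before_succ_of_mem {E : Finset ℕ} {z : ℕ} (hz : z ∈ E) :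
    before E (z + 1) = insert z (before E z) := by
  ext y
  simp only [before, mem_filter, mem_insert]
  constructor
  · rintro ⟨h1, h2⟩
    rcases Nat.lt_succ_iff_lt_or_eq.1 h2 with h | h
    · exact .inr ⟨h1, h⟩
    · exact .inl h
  · rintro (rfl | ⟨h1, h2⟩)
    · exact ⟨hz, by omega⟩
    · exact ⟨h1, by omega⟩

theorem before_succ_of_notMem {E : Finset ℕ} {z : ℕ} (hz : z ∉ E) :
    before E (z + 1) = before E z := by
  refine filter_congr fun y hy => ?_
  have : y ≠ z := fun h => hz (h ▸ hy)
  omega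

theorem before_zero (E : Finset ℕ) : before E 0 = ∅ := by simp [before]

theorem notMem_before (E : Finset ℕ) (z : ℕ) : z ∉ before E z := by simp [before]

theorem before_subset (E : Finset ℕ) (z : ℕ) : before E z ⊆ E := filter_subset _ _

theorem before_eq_self {E : Finset ℕ} {z : ℕ} (h : ∀ y ∈ E, y < z) : before E z = E :=
  filter_true_of_mem h

/-- The additional filter lets one recursion serve both counters of `runs_incidence`: `F = E` gives
the degree, `F = before E z` the number of processed edges. -/
theorem inc_before_succ (π : Params) (E F : Finset ℕ) (i : ℕ) (x : Fin π.n) :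
    inc π.fst π.snd {y ∈ before E (i + 1) | y ∈ F} x = inc π.fst π.snd {y ∈ before E i | y ∈ F} x +
      if i ∈ E ∧ i ∈ F ∧ (π.fst i = x ∨ π.snd i = x) then 1 else 0 := by
  by_cases hi : i ∈ E
  · rw [before_succ_of_mem hi, filter_insert]
    by_cases hF : i ∈ F
    · rw [if_pos hF, inc_insert (by simp [before])]
      simp [hi, hF]
    · simp [hF]
  · simp [before_succ_of_notMem hi, hi]

theorem runs_incidence (hL : π.Loaded σ) (hS : π.Fits S) {E : Finset ℕ} (hE : π.Edges E σ.mem)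
    {x : Fin π.n} (hx : σ.reg r_x = x) {z : ℕ} (hz : σ.reg r_z = z) :
    Runs S ω incidenceProg σ (π.Z * 700 + 30) fun τ =>
      τ.reg r_j = inc π.fst π.snd (before E z) x ∧ τ.reg r_d = inc π.fst π.snd E x := by
  have h1 := hS.n_lt
  have h2 := hS.Z_lt
  have h3 := hS.one_lt
  refine Runs.mono_cost (Runs.seq (Runs.assign (by simp) fun _ => Runs.seq (Runs.assign (by simp)
    fun _ => Runs.seq (Runs.assign (by simp) fun _ => Runs.loop (fun i τ => τ.reg r_i = i ∧
      τ.reg r_j = inc π.fst π.snd ((before E i).filter (· ∈ before E z)) x ∧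
      τ.reg r_d = inc π.fst π.snd {y ∈ before E i | y ∈ E} x) π.Z 600 ?_ ?_ ?_)))) ?_
  · simp [before_zero, inc]
  · rintro i hi τ hf ⟨hi', hj, hd⟩
    have hLt : π.Loaded τ := hL.set.set.set.frame hf
    have hzt : τ.reg r_z = z := by rw [hf.reg _ (by decide)]; simp [hz]
    have hxt : τ.reg r_x = x := by rw [hf.reg _ (by decide)]; simp [hx]
    have hmt : τ.mem = σ.mem := by rw [hf.mem (by decide)]; simp
    refine ⟨by simp [hi', hLt.Z]; omega, ?_⟩
    have hle : ∀ F : Finset ℕ, inc π.fst π.snd {y ∈ before E i | y ∈ F} x ≤ i := by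
      intro F
      refine (card_le_card (t := range i) ?_).trans_eq (card_range i)
      intro y hy
      simp only [before, mem_filter] at hy
      simp [hy.1.1.2]
    have hle1 := hle E
    have hle2 := hle (before E z)
    have hcond : (M[addr 4 R[r_i]] * (eqExp (R[r_i] / R[r_n] % R[r_n]) R[r_x] +
        eqExp (R[r_i] % R[r_n]) R[r_x])).eval τ ≠ 0 ↔
        i ∈ E ∧ (π.fst i = x ∨ π.snd i = x) := by
      simp [hi', hLt.base, hmt, hE.mark i hi, hLt.n, hxt, Fin.ext_iff]
      tauto
    refine Runs.mono_cost (Runs.bind (N₁ := 500) (Q' := fun τ => τ.reg r_i = i ∧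
      τ.reg r_j = inc π.fst π.snd ((before E (i + 1)).filter (· ∈ before E z)) x ∧
      τ.reg r_d = inc π.fst π.snd {y ∈ before E (i + 1) | y ∈ E} x)
      (Runs.mono_cost (Runs.ifte (N₁ := 100) (fun hc => ?_) fun hc => Runs.skip ?_) ?_) fun ρ hρ _ =>
        Runs.assign ?_ ?_) ?_
    · rw [hcond] at hc
      refine Runs.mono_cost (Runs.seq (Runs.assign ?_ fun _ => Runs.assign ?_ ?_)) (by simp)
      · simp [hd]; omega
      · simp [hj]; omega
      · refine ⟨by simp [hi'], ?_, ?_⟩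
        · rw [inc_before_succ]
          simp [hj, hzt, hi', before, hc]
          split_ifs <;> omega
        · rw [inc_before_succ]
          simp [hd, hc]
    · have hc' : ¬ (i ∈ E ∧ (π.fst i = x ∨ π.snd i = x)) := by
        rw [← hcond]; exact not_not.2 hc
      refine ⟨hi', ?_, ?_⟩ <;> rw [inc_before_succ, if_neg (by tauto)] <;> assumption
    · simp [addr, eqExp]
    · simp [hρ.1]; omega
    · simp [hρ]
    · simp
  · rintro τ hf ⟨hi, hj, hd⟩
    have hLt : π.Loaded τ := hL.set.set.set.frame hf
    refine ⟨by simp [hi, hLt.Z], ?_⟩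
    rw [before_eq_self hE.lt] at hj hd
    have h5 : E.filter (fun y => y ∈ before E z) = before E z := by ext; simp [before]
    have h6 : E.filter (fun y => y ∈ E) = E := filter_true_of_mem fun _ h => h
    rw [hj, hd, h5, h6]
    exact ⟨rfl, rfl⟩
  · simp
    omega

/-- The branches of the program are the three phases of a vertex: counting, guessing, counting down.
Only the guessing phase needs a moment; there `hcap` and the bound on the guess keep its exponent
below `2 * n`. -/
theorem runs_weight (hL : π.Loaded σ) (hS : π.Fits S) {E : Finset ℕ} (hE : π.Edges E σ.mem)
    {x : Fin π.n} (hx : σ.reg r_x = x)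
    (hp : σ.reg r_pow = π.B ^ (x : ℕ)) {cur : ℕ} (hcur : σ.reg r_cur = cur) (hcur' : cur < π.n)
    (hmem : ∀ y ≤ cur, σ.mem y < π.k) {F : Finset ℕ}
    (hj : σ.reg r_j = inc π.fst π.snd F x) (hd : σ.reg r_d = inc π.fst π.snd E x)
    {b c c' : ℕ} (hb : σ.reg r_b = b) (hc : σ.reg r_c = c) (hc' : σ.reg r_cc = c')
    (hb1 : b ≤ 1) (hcap : c ≤ cap π.fst π.snd E F x) :
    Runs S ω weightProg σ (π.n * (60 * π.n + 200) + 400) fun τ => τ.reg r_wt < π.M ∧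
      (τ.reg r_wt : ZMod π.M)
        = weight π.fst π.snd E (π.moments cur σ.mem) F x b c c' := by
  have h3 := hS.one_lt
  have h4 := hS.M_gt
  have hdn := hE.inc_lt x
  have hcd := hcap.trans (cap_le F x)
  have hite : ∀ {P : Prop} [Decidable P], (if P then 1 else 0) ≤ 1 := by
    intro P _; split_ifs <;> omega
  unfold weight
  rw [← hj, ← hd]
  rw [← hd] at hdn hcd
  refine Runs.mono_cost (Runs.ifte (fun h0 => Runs.assign ?_ ?_) fun h0 =>
    Runs.ifte (fun h1 => Runs.assign ?_ ?_) fun h1 => Runs.ifte (fun h2 =>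
      (runs_moment hL hS hx hp hcur hcur' hmem ?_).mono le_rfl fun τ hτ => ?_)
      fun h2 => Runs.assign ?_ ?_) ?_
  · rw [eval_eqExp]
    exact hite.trans_lt h3
  · simp at h0
    rw [if_pos (by omega)]
    simp only [State.set_reg, if_true, eval_eqExp, Exp.eval_add, Exp.eval_reg, hc, hb, hc']
    refine ⟨hite.trans_lt h4, ?_⟩
    split_ifs <;> simp
  · rw [Exp.eval_mul, eval_eqExp, Exp.eval_sub, Exp.eval_sub, Exp.eval_ofNat]
    exact (Nat.mul_le_mul hite (Nat.sub_le _ _)).trans_lt h3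
  · simp at h0 h1
    rw [if_neg (by omega), if_neg (by omega)]
    simp only [State.set_reg, if_true, Exp.eval_mul, eval_eqExp, Exp.eval_add, Exp.eval_sub,
      Exp.eval_reg, Exp.eval_ofNat, hc, hb, hc']
    by_cases e1 : c = c' + b
    · by_cases e2 : c' < σ.reg r_d - σ.reg r_j
      · have : 1 - (1 - (σ.reg r_d - σ.reg r_j - c')) = 1 := by omega
        simp [e1, e2, this, h4]
      · have : 1 - (1 - (σ.reg r_d - σ.reg r_j - c')) = 0 := by omega
        simp [e2, this]; omega
    · simp [e1]; omega
  · simp [hc'] at h2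
    omega
  · simp at h0 h1 h2
    rw [if_neg (by omega), if_pos (by omega), if_pos (by omega)]
    rwa [hc, hb, hc'] at hτ
  · simp
  · simp at h0 h1 h2
    rw [if_neg (by omega), if_pos (by omega), if_neg (by omega)]
    simp
    omega
  · simp [eqExp]
    omega

end RAM

namespace RAM

open Orient Finset

variable {S : ℕ} {ω : ℕ → Bool} {σ τ : State} {π : Params}

/-! Keys and dictionaries -/

namespace Params

/-- The number that encodes the states of the vertices. -/
def enc (π : Params) (g : Fin π.n → Fin π.n) : ℕ := ∑ x, (g x : ℕ) * π.B ^ (x : ℕ)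

theorem enc_eq (hS : π.Fits S) (g : Fin π.n → Fin π.n) :
    π.enc g = (finFunctionFinEquiv fun x => (⟨g x, (g x).2.trans hS.B_gt⟩ : Fin π.B) : ℕ) := by
  rw [finFunctionFinEquiv_apply]
  rfl

theorem enc_lt (hS : π.Fits S) (g : Fin π.n → Fin π.n) : π.enc g < π.K := by
  rw [enc_eq hS, hS.K_eq]
  exact Fin.is_lt _

theorem enc_injective (hS : π.Fits S) : Function.Injective π.enc := by
  intro g g' h
  rw [enc_eq hS, enc_eq hS] at h
  have := finFunctionFinEquiv.injective (Fin.ext h)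
  funext x
  have h1 := congrFun this x
  simp only [Fin.mk.injEq] at h1
  exact Fin.ext h1

theorem enc_div_mod (hS : π.Fits S) (g : Fin π.n → Fin π.n) (x : Fin π.n) :
    π.enc g / π.B ^ (x : ℕ) % π.B = g x := by
  rw [enc_eq hS]
  have h := congrFun (finFunctionFinEquiv.symm_apply_apply
    fun x => (⟨g x, (g x).2.trans hS.B_gt⟩ : Fin π.B)) x
  exact congrArg Fin.val h

/-- Replacing one digit of a key, written with the truncated subtraction that the machine performs.
-/
theorem enc_update (g : Fin π.n → Fin π.n) (x c : Fin π.n) :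
    π.enc (Function.update g x c)
      = π.enc g - (g x : ℕ) * π.B ^ (x : ℕ) + (c : ℕ) * π.B ^ (x : ℕ) := by
  have h : ∀ g : Fin π.n → Fin π.n, π.enc g
      = (g x : ℕ) * π.B ^ (x : ℕ) + ∑ y ∈ univ.erase x, (g y : ℕ) * π.B ^ (y : ℕ) := by
    intro g
    rw [enc, ← add_sum_erase univ _ (mem_univ x)]
  rw [h, h g, Function.update_self, add_tsub_cancel_left, add_comm]
  congr 1
  exact sum_congr rfl fun y hy => by rw [Function.update_of_ne (ne_of_mem_erase hy)]

theorem enc_zero : π.enc 0 = 0 := by simp [enc]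

/-- The memory is unchanged outside the dictionary `δ`. -/
def SameOutside (π : Params) (δ : ℕ) (mem mem' : ℕ → ℕ) : Prop :=
  ∀ a, (∀ kind < 4, ∀ i < π.K, a ≠ cellAddr π.base kind (δ * π.K + i)) → mem' a = mem a

namespace SameOutside

variable {δ δ' : ℕ} {mem mem' mem'' : ℕ → ℕ}

theorem refl : π.SameOutside δ mem mem := fun _ _ => rfl

theorem trans (h : π.SameOutside δ mem mem') (h' : π.SameOutside δ mem' mem'') :
    π.SameOutside δ mem mem'' := fun a ha => (h' a ha).trans (h a ha)

theorem cell (h : π.SameOutside δ mem mem') {kind i : ℕ} (hk : kind < 8)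
    (hi : 4 ≤ kind ∨ i < δ * π.K ∨ (δ + 1) * π.K ≤ i) :
    mem' (cellAddr π.base kind i) = mem (cellAddr π.base kind i) := by
  refine h _ fun kind' hk' j hj he => ?_
  rw [cellAddr_inj hk (by omega)] at he
  rw [add_mul] at hi
  omega

theorem low (h : π.SameOutside δ mem mem') {a : ℕ} (ha : a < 8 * π.base) : mem' a = mem a :=
  h _ fun kind' _ j _ he => by unfold cellAddr at he; omega

theorem vertex (h : π.SameOutside δ mem mem') (hS : π.Fits S) {a : ℕ} (ha : a < π.n) :
    mem' a = mem a :=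
  h.low (by have := hS.base_ge; omega)

theorem edges (h : π.SameOutside δ mem mem') {E : Finset ℕ} (hE : π.Edges E mem) :
    π.Edges E mem' :=
  ⟨hE.lt, hE.ne, fun z hz => by rw [h.cell (by norm_num) (.inl le_rfl), hE.mark z hz], hE.inc_lt⟩

end SameOutside

/-- The dictionary `δ` has the keys `l` and the values `V`. -/
structure Dict (π : Params) (mem : ℕ → ℕ) (δ : ℕ) (l : List (Fin π.n → Fin π.n))
    (V : (Fin π.n → Fin π.n) → ZMod π.M) : Prop where
  nodup : l.Nodup
  len : mem (cellAddr π.base 3 (δ * π.K)) = l.length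
  list : ∀ i (h : i < l.length), mem (cellAddr π.base 0 (δ * π.K + i)) = π.enc l[i]
  flag : ∀ g, mem (cellAddr π.base 1 (δ * π.K + π.enc g)) = if g ∈ l then 1 else 0
  val_lt : ∀ g, mem (cellAddr π.base 2 (δ * π.K + π.enc g)) < π.M
  val : ∀ g, (mem (cellAddr π.base 2 (δ * π.K + π.enc g)) : ZMod π.M) = V g
  supp : ∀ g, g ∉ l → V g = 0

namespace Dict

variable {δ δ' : ℕ} {mem mem' : ℕ → ℕ} {l : List (Fin π.n → Fin π.n)}
  {V : (Fin π.n → Fin π.n) → ZMod π.M}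

theorem length_le (h : π.Dict mem δ l V) : l.length ≤ π.n ^ π.n := by
  rw [← List.toFinset_card_of_nodup h.nodup]
  refine (card_le_univ _).trans ?_
  simp

/-- There are at most `n ^ n < B ^ n = K` different keys, so the key list does not run into the next
dictionary. -/
theorem length_lt (h : π.Dict mem δ l V) (hS : π.Fits S) : l.length < π.K := by
  refine h.length_le.trans_lt ?_
  rw [hS.K_eq]
  exact Nat.pow_lt_pow_left hS.B_gt hS.n_pos.ne'

theorem congr (h : π.Dict mem δ l V) (hS : π.Fits S)
    (hm : ∀ kind < 4, ∀ i < π.K, mem' (cellAddr π.base kind (δ * π.K + i))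
      = mem (cellAddr π.base kind (δ * π.K + i))) : π.Dict mem' δ l V where
  nodup := h.nodup
  len := by
    have := hm 3 (by norm_num) 0 hS.K_pos
    rw [add_zero] at this
    rw [this, h.len]
  list i hi := by rw [hm 0 (by norm_num) i (hi.trans (h.length_lt hS)), h.list i hi]
  flag g := by rw [hm 1 (by norm_num) _ (enc_lt hS g), h.flag g]
  val_lt g := by rw [hm 2 (by norm_num) _ (enc_lt hS g)]; exact h.val_lt g
  val g := by rw [hm 2 (by norm_num) _ (enc_lt hS g), h.val g]
  supp := h.supp

/-- Different dictionaries occupy disjoint intervals of `K` indices. -/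
theorem same (h : π.Dict mem δ l V) (hS : π.Fits S) (hm : π.SameOutside δ' mem mem')
    (hne : δ ≠ δ') : π.Dict mem' δ l V := by
  refine h.congr hS fun kind hk i hi => hm.cell (by omega) (.inr ?_)
  rcases lt_or_gt_of_ne hne with h1 | h1
  · have := Nat.mul_le_mul_right π.K (Nat.succ_le_of_lt h1)
    rw [Nat.succ_mul] at this
    omega
  · have := Nat.mul_le_mul_right π.K (Nat.succ_le_of_lt h1)
    exact .inr (by rw [Nat.succ_eq_add_one] at this; omega)

end Dict

end Params

open Params

theorem sameOutside_put {mem : ℕ → ℕ} {dst : ℕ} (h : π.SameOutside dst mem σ.mem) {kind i v : ℕ}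
    (hk : kind < 4) (hi : i < π.K) :
    π.SameOutside dst mem (σ.put (cellAddr π.base kind (dst * π.K + i)) v).mem := by
  intro a ha
  rw [State.put_mem, if_neg (ha kind hk i hi), h a ha]

theorem runs_insert (hL : π.Loaded σ) (hS : π.Fits S) {dst : ℕ} (hdst : σ.reg r_dst = dst)
    {l : List (Fin π.n → Fin π.n)} {V : (Fin π.n → Fin π.n) → ZMod π.M}
    (hD : π.Dict σ.mem dst l V) {g : Fin π.n → Fin π.n} (hkey : σ.reg r_key2 = π.enc g) :
    Runs S ω insertProg σ 1000 fun τ => π.SameOutside dst σ.mem τ.mem ∧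
      ∃ l', g ∈ l' ∧ π.Dict τ.mem dst l' V ∧ ∀ h ∈ l', h ∈ l ∨ h = g := by
  have hlt := enc_lt hS g
  have h1 := hS.one_lt
  have h2 := hS.K_lt
  have hlen := hD.length_lt hS
  refine Runs.mono_cost (Runs.ifte (N₂ := 700) (fun h0 => Runs.skip ?_) fun h0 => ?_) ?_
  · simp [hkey, hL.base, hL.K, hdst, hD.flag] at h0
    exact ⟨SameOutside.refl, l, h0, hD, fun h hh => .inl hh⟩
  · simp [hkey, hL.base, hL.K, hdst, hD.flag] at h0
    set a₁ := cellAddr π.base 1 (dst * π.K + π.enc g) with ha₁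
    set a₃ := cellAddr π.base 3 (dst * π.K) with ha₃
    have hne : a₃ ≠ a₁ := by
      rw [ha₁, ha₃, Ne, cellAddr_inj (by norm_num) (by norm_num)]; omega
    have e1 : (addr 1 (R[r_dst] * R[r_K] + R[r_key2])).eval σ = a₁ := by
      simp [hL.base, hL.K, hdst, hkey, ha₁]
    have e3 : ∀ τ : State, τ.reg = σ.reg → (addr 3 (R[r_dst] * R[r_K])).eval τ = a₃ := by
      intro τ hτ
      simp [hτ, hL.base, hL.K, hdst, ha₃]
    have e0 : ∀ τ : State, τ.reg = σ.reg → τ.mem a₃ = l.length →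
        (addr 0 (R[r_dst] * R[r_K] + M[addr 3 (R[r_dst] * R[r_K])])).eval τ
          = cellAddr π.base 0 (dst * π.K + l.length) := by
      intro τ hτ hm
      rw [eval_addr, Exp.eval_add, Exp.eval_cell, e3 τ hτ, hm]
      simp [hτ, hL.base, hL.K, hdst]
    set a₀ := cellAddr π.base 0 (dst * π.K + l.length) with ha₀
    have hne' : a₃ ≠ a₀ := by
      rw [ha₀, ha₃, Ne, cellAddr_inj (by norm_num) (by norm_num)]; omega
    have hm₁ : (σ.put a₁ 1).mem a₃ = l.length := by
      rw [State.put_mem, if_neg hne, ha₃, hD.len]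
    have hm₀ : ((σ.put a₁ 1).put a₀ (π.enc g)).mem a₃ = l.length := by
      rw [State.put_mem, if_neg hne', hm₁]
    have hmem : ∀ kind < 8, ∀ i, (((σ.put a₁ 1).put a₀ (π.enc g)).put a₃ (l.length + 1)).mem
        (cellAddr π.base kind i) = if kind = 3 ∧ i = dst * π.K then l.length + 1
          else if kind = 0 ∧ i = dst * π.K + l.length then π.enc g
          else if kind = 1 ∧ i = dst * π.K + π.enc g then 1
          else σ.mem (cellAddr π.base kind i) := by
      intro kind hk i
      simp only [State.put_mem, ha₀, ha₁, ha₃, cellAddr_inj hk (show 0 < 8 by norm_num),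
        cellAddr_inj hk (show 1 < 8 by norm_num), cellAddr_inj hk (show 3 < 8 by norm_num)]
    refine Runs.mono_cost (Runs.seq (Runs.store ?_ fun _ => Runs.seq (Runs.store ?_ fun _ =>
      Runs.store ?_ ?_))) ?_
    · simpa using h1
    · simp only [Exp.eval_reg, State.put_reg, hkey]; omega
    · rw [e1, Exp.eval_ofNat, e0 (σ.put a₁ 1) rfl hm₁, Exp.eval_reg, State.put_reg, hkey, Exp.eval_add,
        Exp.eval_cell, e3 ((σ.put a₁ 1).put a₀ (π.enc g)) rfl, hm₀, Exp.eval_ofNat]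
      omega
    · rw [e1, Exp.eval_ofNat, e0 (σ.put a₁ 1) rfl hm₁, Exp.eval_reg, State.put_reg, hkey, Exp.eval_add,
        Exp.eval_cell, e3 ((σ.put a₁ 1).put a₀ (π.enc g)) rfl, hm₀, Exp.eval_ofNat]
      refine ⟨sameOutside_put (i := 0) (sameOutside_put (sameOutside_put SameOutside.refl
        (by norm_num) hlt) (by norm_num) hlen) (by norm_num) hS.K_pos, l ++ [g], by simp, ?_,
        fun h hh => by simpa using hh⟩
      constructor
      · rw [List.nodup_append]
        refine ⟨hD.nodup, by simp, ?_⟩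
        intro a ha b hb
        rw [List.mem_singleton] at hb
        rintro rfl
        exact h0 (hb ▸ ha)
      · rw [hmem 3 (by norm_num)]; simp
      · intro i hi
        rw [hmem 0 (by norm_num)]
        rw [List.length_append, List.length_singleton] at hi
        by_cases hil : i = l.length
        · subst hil; simp
        · simp only [Nat.reduceEqDiff, false_and, if_false, true_and, add_right_inj, hil]
          rw [hD.list i (by omega), List.getElem_append_left]
      · intro h
        rw [hmem 1 (by norm_num)]
        simp only [Nat.reduceEqDiff, false_and, if_false, true_and, add_right_inj,
          (enc_injective hS).eq_iff, hD.flag, List.mem_append, List.mem_singleton]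
        by_cases hh : h = g <;> simp [hh]
      · intro h
        rw [hmem 2 (by norm_num)]
        simpa using hD.val_lt h
      · intro h
        rw [hmem 2 (by norm_num)]
        simpa using hD.val h
      · intro h hh
        exact hD.supp h fun h3 => hh (by simp [h3])
    · simp [addr]
  · simp [addr]

/-- The key is registered before its value is changed, so that values outside the key list stay
zero, as `Dict.supp` demands. -/
theorem runs_push (hL : π.Loaded σ) (hS : π.Fits S) {dst : ℕ} (hdst : σ.reg r_dst = dst)
    {l : List (Fin π.n → Fin π.n)} {V : (Fin π.n → Fin π.n) → ZMod π.M}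
    (hD : π.Dict σ.mem dst l V) {x : Fin π.n} (hp : σ.reg r_pow = π.B ^ (x : ℕ))
    {g : Fin π.n → Fin π.n} {c' : Fin π.n} (hkey : σ.reg r_key = π.enc g)
    (hc : σ.reg r_c = g x) (hcc : σ.reg r_cc = c') :
    Runs S ω pushProg σ 1400 fun τ => π.SameOutside dst σ.mem τ.mem ∧
      ∃ l', π.Dict τ.mem dst l' (fun h => V h + if h = Function.update g x c' then
        (σ.reg r_w : ZMod π.M) * σ.reg r_wt * σ.reg r_val else 0) ∧
      ∀ h ∈ l', h ∈ l ∨ h = Function.update g x c' := by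
  set g' := Function.update g x c' with hg'
  have hkey2 : π.enc g - (g x : ℕ) * π.B ^ (x : ℕ) + (c' : ℕ) * π.B ^ (x : ℕ) = π.enc g' := by
    rw [hg', enc_update]
  have hM0 : 0 < π.M := by have := hS.M_gt; omega
  have hlt := enc_lt hS g'
  have h2 := hS.K_lt
  have hev : (R[r_key] - R[r_c] * R[r_pow] + R[r_cc] * R[r_pow]).eval σ = π.enc g' := by
    simp only [Exp.eval_add, Exp.eval_sub, Exp.eval_mul, Exp.eval_reg, hkey, hc, hp, hcc, hkey2]
  refine Runs.mono_cost (Runs.seq (Runs.assign ?_ fun _ => ?_)) (N := _ + (1000 + 300)) ?_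
  · rw [hev]; omega
  · rw [hev]
    refine Runs.mono_cost (Runs.bind (runs_insert (g := g') hL.set hS (dst := dst) (by simpa) hD
      (by simp)) fun ρ hρ hfρ => Runs.store ?_ ?_) ?_
    · have hLρ : π.Loaded ρ := hL.set.frame hfρ
      rw [Exp.eval_mod, Exp.eval_reg, hLρ.M]
      exact (Nat.mod_lt _ hM0).trans hS.M_lt
    · obtain ⟨hs, l', hl', hD', hsub⟩ := hρ
      have hLρ : π.Loaded ρ := hL.set.frame hfρ
      have hk : ρ.reg r_key2 = π.enc g' := by rw [hfρ.reg _ (by decide)]; simp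
      have e1 : ρ.reg r_dst = dst := by rw [hfρ.reg _ (by decide)]; simp [hdst]
      have e2 : ρ.reg r_w = σ.reg r_w := by rw [hfρ.reg _ (by decide)]; simp
      have e3 : ρ.reg r_wt = σ.reg r_wt := by rw [hfρ.reg _ (by decide)]; simp
      have e4 : ρ.reg r_val = σ.reg r_val := by rw [hfρ.reg _ (by decide)]; simp
      simp only [eval_addr, Exp.eval_add, Exp.eval_mul, Exp.eval_mod, Exp.eval_reg, Exp.eval_cell,
        hLρ.K, hLρ.M, hLρ.base, e1, e2, e3, e4, hk]
      refine ⟨sameOutside_put hs (by norm_num) hlt, l', ?_, hsub⟩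
      have hother : ∀ kind i v, kind < 8 → kind ≠ 2 →
          (ρ.put (cellAddr π.base 2 (dst * π.K + π.enc g')) v).mem (cellAddr π.base kind i)
            = ρ.mem (cellAddr π.base kind i) := by
        intro kind i v hk hk2
        rw [State.put_mem, if_neg]
        rw [cellAddr_inj hk (by norm_num)]
        exact fun h => hk2 h.1
      constructor
      · exact hD'.nodup
      · rw [hother _ _ _ (by norm_num) (by norm_num), hD'.len]
      · intro i hi
        rw [hother _ _ _ (by norm_num) (by norm_num), hD'.list i hi]
      · intro h
        rw [hother _ _ _ (by norm_num) (by norm_num), hD'.flag h]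
      · intro h
        rw [State.put_mem]
        split_ifs
        · exact Nat.mod_lt _ hM0
        · exact hD'.val_lt h
      · intro h
        simp only [State.put_mem, cellAddr_inj (show 2 < 8 by norm_num) (show 2 < 8 by norm_num),
          true_and, add_right_inj, (enc_injective hS).eq_iff]
        split_ifs with hh
        · subst hh
          rw [ZMod.natCast_mod]
          push_cast
          rw [hD'.val]
        · rw [hD'.val, add_zero]
      · intro h hh
        rw [hD'.supp h hh, if_neg (by rintro rfl; exact hh hl'), add_zero]
    · simp [addr]
  · simp

end RAM

namespace RAM

open Orient Finset Params

variable {S : ℕ} {ω : ℕ → Bool} {σ τ : State} {π : Params}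

/-! Transfers between dictionaries -/

/-- What holds while the transfer at the vertex `x` is computed: `E` are the edges, `F` those
already processed, `cur` is the vertex whose color is sought, and the transfer goes from the
dictionary `src` to the dictionary `dst`. -/
structure Env (π : Params) (E F : Finset ℕ) (cur : ℕ) (x : Fin π.n) (b w src dst : ℕ)
    (mem₀ : ℕ → ℕ) (σ : State) : Prop where
  loaded : π.Loaded σ
  edges : π.Edges E σ.mem
  cur_eq : σ.reg r_cur = cur
  cur_lt : cur < π.n
  colors : ∀ y ≤ cur, σ.mem y < π.k
  src_eq : σ.reg r_src = src
  dst_eq : σ.reg r_dst = dst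
  x_eq : σ.reg r_x = x
  b_eq : σ.reg r_b = b
  w_eq : σ.reg r_w = w
  j_eq : σ.reg r_j = inc π.fst π.snd F x
  d_eq : σ.reg r_d = inc π.fst π.snd E x
  pow_eq : σ.reg r_pow = π.B ^ (x : ℕ)
  b_le : b ≤ 1
  same : π.SameOutside dst mem₀ σ.mem

/-- The registers that are not changed during a transfer. -/
def envRegs : List ℕ :=
  [r_n, r_k, r_Z, r_base, r_B, r_K, r_M, r_R, r_cur, r_src, r_dst, r_x, r_b, r_w, r_j, r_d, r_pow]

variable {E F : Finset ℕ} {cur : ℕ} {x : Fin π.n} {b w src dst : ℕ} {mem₀ : ℕ → ℕ}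

theorem Env.congr (h : Env π E F cur x b w src dst mem₀ σ) (hS : π.Fits S)
    (hr : ∀ r ∈ envRegs, τ.reg r = σ.reg r) (hm : π.SameOutside dst σ.mem τ.mem) :
    Env π E F cur x b w src dst mem₀ τ where
  loaded := ⟨(hr _ (by decide)).trans h.loaded.n, (hr _ (by decide)).trans h.loaded.k,
    (hr _ (by decide)).trans h.loaded.Z, (hr _ (by decide)).trans h.loaded.base,
    (hr _ (by decide)).trans h.loaded.B, (hr _ (by decide)).trans h.loaded.K,
    (hr _ (by decide)).trans h.loaded.M, (hr _ (by decide)).trans h.loaded.R⟩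
  edges := hm.edges h.edges
  cur_eq := (hr _ (by decide)).trans h.cur_eq
  cur_lt := h.cur_lt
  colors y hy := by rw [hm.vertex hS (hy.trans_lt h.cur_lt)]; exact h.colors y hy
  src_eq := (hr _ (by decide)).trans h.src_eq
  dst_eq := (hr _ (by decide)).trans h.dst_eq
  x_eq := (hr _ (by decide)).trans h.x_eq
  b_eq := (hr _ (by decide)).trans h.b_eq
  w_eq := (hr _ (by decide)).trans h.w_eq
  j_eq := (hr _ (by decide)).trans h.j_eq
  d_eq := (hr _ (by decide)).trans h.d_eq
  pow_eq := (hr _ (by decide)).trans h.pow_eq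
  b_le := h.b_le
  same := h.same.trans hm

theorem Env.frame {A : Prog} (h : Env π E F cur x b w src dst mem₀ σ) (hS : π.Fits S)
    (hf : Frame A σ τ) (hm : π.SameOutside dst σ.mem τ.mem)
    (hA : ∀ r ∈ envRegs, r ∉ A.writes := by decide) :
    Env π E F cur x b w src dst mem₀ τ :=
  h.congr hS (fun r hr => hf.reg r (hA r hr)) hm

theorem Env.set (h : Env π E F cur x b w src dst mem₀ σ) (hS : π.Fits S) {r v : ℕ}
    (hr : r ∉ envRegs := by decide) : Env π E F cur x b w src dst mem₀ (σ.set r v) := by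
  refine h.congr hS (fun r' hr' => ?_) SameOutside.refl
  rw [State.set_reg, if_neg]
  rintro rfl
  exact hr hr'

theorem Env.moments_eq (h : Env π E F cur x b w src dst mem₀ σ) (hS : π.Fits S) :
    π.moments cur σ.mem = π.moments cur mem₀ :=
  moments_congr fun _ hy => h.same.vertex hS hy

theorem sum_lt_succ {R : Type*} [AddCommMonoid R] {n m : ℕ} (hm : m < n) (f : Fin n → R) :
    ∑ c : Fin n, (if (c : ℕ) < m + 1 then f c else 0)
      = ∑ c : Fin n, (if (c : ℕ) < m then f c else 0) + f ⟨m, hm⟩ := by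
  have h : ∀ c : Fin n, (if (c : ℕ) < m + 1 then f c else 0)
      = (if (c : ℕ) < m then f c else 0) + if c = ⟨m, hm⟩ then f c else 0 := by
    intro c
    simp only [Fin.ext_iff]
    rcases lt_trichotomy (c : ℕ) m with h | h | h
    · rw [if_pos (by omega), if_pos h, if_neg (by omega), add_zero]
    · rw [if_pos (by omega), if_neg (by omega), if_pos h, zero_add]
    · rw [if_neg (by omega), if_neg (by omega), if_neg (by omega), add_zero]
  rw [sum_congr rfl fun c _ => h c, sum_add_distrib, sum_ite_eq' univ]
  simp

/-- The contribution of one key to a transfer. -/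
def spread {R : Type*} [CommRing R] {n : ℕ} (u v : ℕ → Fin n) (E F : Finset ℕ) (μ : Fin n → ℕ → R)
    (x : Fin n) (b : ℕ) (V : (Fin n → Fin n) → R) (g h : Fin n → Fin n) : R :=
  ∑ c : Fin n, if h = Function.update g x c then weight u v E μ F x b (g x) c * V g else 0

/-- `transfer` collects at each target what comes from its sources, whereas the program distributes
from each source. The two agree by exchanging sums: `h` arises from `g` by a change at `x` exactly
if `g` arises from `h` by a change at `x`, the new state being `h x`. Keys outside `l` carry the
value zero. -/
theorem sum_spread {R : Type*} [CommRing R] {n : ℕ} (u v : ℕ → Fin n) (E F : Finset ℕ)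
    (μ : Fin n → ℕ → R) (x : Fin n) (b : ℕ) (V : (Fin n → Fin n) → R)
    (l : List (Fin n → Fin n)) (hl : l.Nodup) (hV : ∀ g, g ∉ l → V g = 0) (h : Fin n → Fin n) :
    (l.map fun g => spread u v E F μ x b V g h).sum = transfer u v E μ F x b V h := by
  rw [← List.sum_toFinset _ hl]
  have h1 : ∑ g ∈ l.toFinset, spread u v E F μ x b V g h = ∑ g, spread u v E F μ x b V g h := by
    refine sum_subset (subset_univ _) fun g _ hg => ?_
    rw [List.mem_toFinset] at hg
    simp [spread, hV g hg]
  rw [h1]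
  unfold spread transfer
  rw [sum_comm]
  have h2 : ∀ c : Fin n, ∑ g : Fin n → Fin n, (if h = Function.update g x c then
      weight u v E μ F x b (g x) c * V g else 0)
      = if h x = c then ∑ c₀ : Fin n, weight u v E μ F x b c₀ c * V (Function.update h x c₀)
        else 0 := by
    intro c
    split_ifs with hc
    · have h3 : ∀ g : Fin n → Fin n, h = Function.update g x c ↔
          g ∈ univ.image fun c₀ => Function.update h x c₀ := by
        intro g
        simp only [mem_image, mem_univ, true_and]
        constructor
        · intro hg
          refine ⟨g x, ?_⟩
          rw [hg]
          simp
        · rintro ⟨c₀, rfl⟩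
          simp [← hc]
      simp only [h3]
      rw [← sum_filter, filter_mem_eq_inter, univ_inter, sum_image]
      · simp
      · intro c₀ _ c₁ _ he
        have := congrFun he x
        simpa using this
    · refine sum_eq_zero fun g _ => if_neg ?_
      rintro rfl
      simp at hc
  rw [sum_congr rfl fun c _ => h2 c, sum_ite_eq]
  simp

/-- Transitions of weight zero create no key. Hence every new key inherits whatever property `Good`
is guaranteed by nonzero weights; later `Good` bounds the states, and this is what keeps the
dictionaries small. -/
theorem runs_key (hE : Env π E F cur x b w src dst mem₀ σ) (hS : π.Fits S) (hne : src ≠ dst)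
    {l l' : List (Fin π.n → Fin π.n)} {V V' : (Fin π.n → Fin π.n) → ZMod π.M}
    (hD : π.Dict mem₀ src l V) (hD' : π.Dict σ.mem dst l' V')
    (hcap : ∀ g ∈ l, (g x : ℕ) ≤ cap π.fst π.snd E F x)
    {Good : (Fin π.n → Fin π.n) → Prop}
    (hgood : ∀ g ∈ l, ∀ c' : Fin π.n,
      weight π.fst π.snd E (π.moments cur mem₀) F x b (g x) c' ≠ 0 →
        Good (Function.update g x c'))
    {i : ℕ} (hi : i < l.length) (hidx : σ.reg r_idx = i) :
    Runs S ω keyProg σ (π.n * (π.n * (60 * π.n + 200) + 2000) + 600) fun τ =>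
      Env π E F cur x b w src dst mem₀ τ ∧ τ.reg r_idx = i ∧
      ∃ l'', π.Dict τ.mem dst l'' (fun h => V' h +
        w * spread π.fst π.snd E F (π.moments cur mem₀) x b V l[i] h) ∧
      ∀ h ∈ l'', h ∈ l' ∨ Good h := by
  set g := l[i] with hg
  have hgl : g ∈ l := List.getElem_mem hi
  have hL := hE.loaded
  have hDs := hD.same hS hE.same hne
  have hM := hS.M_lt
  have hn := hS.n_lt
  have e1 : (M[addr 0 (R[r_src] * R[r_K] + R[r_idx])]).eval σ = π.enc g := by
    simp [hL.base, hL.K, hE.src_eq, hidx, hDs.list i hi, hg]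
  refine Runs.mono_cost (Runs.seq (Runs.assign ?_ fun _ => Runs.seq (Runs.assign ?_ fun _ =>
    Runs.seq (Runs.assign ?_ fun _ => Runs.seq (Runs.assign (by simp) fun _ => Runs.loop
    (fun m τ => Env π E F cur x b w src dst mem₀ τ ∧ τ.reg r_cc = m ∧
      ∃ l'', π.Dict τ.mem dst l'' (fun h => V' h + w * ∑ c : Fin π.n, if (c : ℕ) < m then
        (if h = Function.update g x c then
          weight π.fst π.snd E (π.moments cur mem₀) F x b (g x) c * V g else 0) else 0) ∧
      ∀ h ∈ l'', h ∈ l' ∨ Good h) π.n (π.n * (60 * π.n + 200) + 1990) ?_ ?_ ?_))))) ?_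
  · rw [e1]
    exact (enc_lt hS g).trans hS.K_lt
  · rw [e1]
    have := hDs.val_lt g
    simp [hL.base, hL.K, hE.src_eq]
    omega
  · rw [e1]
    simp only [Exp.eval_mod, Exp.eval_div, Exp.eval_reg, State.set_reg]
    simp [hE.pow_eq, hL.B, enc_div_mod hS]
    omega
  · refine ⟨(((hE.set hS).set hS).set hS).set hS, by simp, l', ?_, fun h hh => .inl hh⟩
    simpa using hD'
  · rintro m hm τ hf ⟨hEt, hcc, l'', hD'', hsub⟩
    have hLt := hEt.loaded
    have hc : τ.reg r_c = g x := by
      rw [hf.reg _ (by decide)]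
      simp only [Exp.eval_mod, Exp.eval_div, Exp.eval_reg, State.set_reg, e1]
      simp [hE.pow_eq, hL.B, enc_div_mod hS]
    have hkey : τ.reg r_key = π.enc g := by
      rw [hf.reg _ (by decide)]
      simp only [State.set_reg, e1]
      simp
    have hval : (τ.reg r_val : ZMod π.M) = V g := by
      rw [hf.reg _ (by decide)]
      simp only [State.set_reg, e1]
      simp [hL.base, hL.K, hE.src_eq, hDs.val]
    set c' : Fin π.n := ⟨m, hm⟩ with hc'
    refine ⟨by simp [hcc, hLt.n]; omega, ?_⟩
    have hw := runs_weight (ω := ω) hLt hS hEt.edges hEt.x_eq hEt.pow_eq hEt.cur_eq hEt.cur_lt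
      hEt.colors hEt.j_eq hEt.d_eq (c' := m) hEt.b_eq hc hcc hEt.b_le (hcap g hgl)
    refine Runs.mono_cost (Runs.bind hw fun ρ hρ hfρ => Runs.bind (N₁ := 1500)
      (Q' := fun κ => Env π E F cur x b w src dst mem₀ κ ∧ κ.reg r_cc = m ∧
      ∃ l'', π.Dict κ.mem dst l'' (fun h => V' h + w * ∑ c : Fin π.n, if (c : ℕ) < m + 1 then
        (if h = Function.update g x c then
          weight π.fst π.snd E (π.moments cur mem₀) F x b (g x) c * V g else 0) else 0) ∧
      ∀ h ∈ l'', h ∈ l' ∨ Good h) (Runs.mono_cost (Runs.ifte (N₁ := 1400) (fun h0 => ?_)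
      fun h0 => Runs.skip ?_) ?_) fun κ hκ hfκ => Runs.assign ?_ ?_) ?_
    · have hmemρ : ρ.mem = τ.mem := hfρ.mem (by decide)
      have hEρ := hEt.frame hS hfρ (hmemρ ▸ SameOutside.refl)
      rw [hEt.moments_eq hS] at hρ
      have hD3 := hD''
      rw [← hmemρ] at hD3
      refine Runs.frame ((runs_push (x := x) (g := g) (c' := c') hEρ.loaded hS hEρ.dst_eq hD3
        hEρ.pow_eq ?_ ?_ ?_).mono le_rfl ?_)
      · rw [hfρ.reg _ (by decide), hkey]
      · rw [hfρ.reg _ (by decide), hc]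
      · rw [hfρ.reg _ (by decide), hcc]
      · rintro κ ⟨hs, l3, hD3', hsub'⟩ hfκ
        refine ⟨hEρ.frame hS hfκ hs, ?_, l3, ?_, ?_⟩
        · rw [hfκ.reg _ (by decide), hfρ.reg _ (by decide), hcc]
        · convert hD3' using 1
          funext h
          rw [sum_lt_succ hm, hρ.2, hEρ.w_eq, hfρ.reg r_val (by decide), hval]
          split_ifs <;> ring
        · intro h hh
          rcases hsub' h hh with h1 | rfl
          · exact hsub h h1
          · refine .inr (hgood g hgl c' ?_)
            rw [← hρ.2]
            -- The register holds a residue below `M`, so it vanishes if its class does.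
            intro h2
            rw [ZMod.natCast_eq_zero_iff] at h2
            exact h0 (Nat.eq_zero_of_dvd_of_lt h2 hρ.1)
    · have hmemρ : ρ.mem = τ.mem := hfρ.mem (by decide)
      have hEρ := hEt.frame hS hfρ (hmemρ ▸ SameOutside.refl)
      rw [hEt.moments_eq hS] at hρ
      refine ⟨hEρ, by rw [hfρ.reg _ (by decide), hcc], l'', ?_, hsub⟩
      rw [hmemρ]
      convert hD'' using 1
      funext h
      rw [sum_lt_succ hm]
      have : weight π.fst π.snd E (π.moments cur mem₀) F x b (g x) m = 0 := by
        rw [← hρ.2]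
        simp at h0
        simp [h0]
      simp [this]
    · simp
    · simp [hκ.2.1]; omega
    · obtain ⟨h1, h2, h3⟩ := hκ
      exact ⟨h1.set hS, by simp [h2], h3⟩
    · simp
  · rintro τ hf ⟨hEt, hcc, l'', hD'', hsub⟩
    refine ⟨by simp [hcc, hEt.loaded.n], hEt, ?_, l'', ?_, hsub⟩
    · rw [hf.reg _ (by decide)]
      simp [hidx]
    · simpa [spread] using hD''
  · simp [addr]
    have : π.n * (π.n * (60 * π.n + 200) + 1990 + 6 + 1) ≤ π.n * (π.n * (60 * π.n + 200) + 2000) :=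
      Nat.mul_le_mul_left _ (by omega)
    omega


/-- The cost of a transfer from a dictionary with `m` keys. -/
def Params.transferCost (π : Params) (m : ℕ) : ℕ :=
  700 * π.Z + 20 * π.n + m * (π.n * (π.n * (60 * π.n + 200) + 2000) + 700) + 200

theorem runs_transfer (hL : π.Loaded σ) (hS : π.Fits S) (hEd : π.Edges E σ.mem)
    (hcur : σ.reg r_cur = cur) (hcur' : cur < π.n) (hcol : ∀ y ≤ cur, σ.mem y < π.k)
    (hsrc : σ.reg r_src = src) (hdst : σ.reg r_dst = dst) (hx : σ.reg r_x = x)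
    (hb : σ.reg r_b = b) (hb' : b ≤ 1) (hw : σ.reg r_w = w) {z : ℕ} (hz : σ.reg r_z = z)
    (hne : src ≠ dst)
    {l l' : List (Fin π.n → Fin π.n)} {V V' : (Fin π.n → Fin π.n) → ZMod π.M}
    (hD : π.Dict σ.mem src l V) (hD' : π.Dict σ.mem dst l' V')
    (hcap : ∀ g ∈ l, (g x : ℕ) ≤ cap π.fst π.snd E (before E z) x)
    {Good : (Fin π.n → Fin π.n) → Prop}
    (hgood : ∀ g ∈ l, ∀ c' : Fin π.n,
      weight π.fst π.snd E (π.moments cur σ.mem) (before E z) x b (g x) c' ≠ 0 →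
        Good (Function.update g x c')) :
    Runs S ω transferProg σ (π.transferCost l.length) fun τ =>
      π.SameOutside dst σ.mem τ.mem ∧ ∃ l'', π.Dict τ.mem dst l'' (fun h => V' h +
        w * transfer π.fst π.snd E (π.moments cur σ.mem) (before E z) x b V h) ∧
      ∀ h ∈ l'', h ∈ l' ∨ Good h := by
  have hn := hS.n_lt
  refine Runs.mono_cost (Runs.bind (runs_incidence hL hS hEd hx hz) fun τ hτ hfτ =>
    Runs.bind (runs_pow (m := x) (by decide) (by decide) (by decide) ?_ hS.one_lt ?_ ?_)
      fun ρ hρ hfρ => Runs.seq (Runs.assign (by simp) fun _ => Runs.loop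
    (fun i κ => Env π E (before E z) cur x b w src dst σ.mem κ ∧ κ.reg r_idx = i ∧
      ∃ l'', π.Dict κ.mem dst l'' (fun h => V' h + w * ((l.take i).map fun g =>
        spread π.fst π.snd E (before E z) (π.moments cur σ.mem) x b V g h).sum) ∧
      ∀ h ∈ l'', h ∈ l' ∨ Good h) l.length
      (π.n * (π.n * (60 * π.n + 200) + 2000) + 620) ?_ ?_ ?_)) ?_
  · simp [hfτ.reg r_x (by decide), hx]
  · have := x.2; omega
  · rw [hfτ.reg _ (by decide), hL.B]
    exact hS.B_pow_lt x.2.le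
  · have hmem : ρ.mem = σ.mem := (hfρ.mem (by decide)).trans (hfτ.mem (by decide))
    have hreg : ∀ r, r ∉ incidenceProg.writes → r ∉ (powProg r_pow r_B R[r_x]).writes →
        ρ.reg r = σ.reg r := fun r h1 h2 => (hfρ.reg r h2).trans (hfτ.reg r h1)
    have hEnv : Env π E (before E z) cur x b w src dst σ.mem ρ :=
      { loaded := (hL.frame hfτ).frame hfρ
        edges := hmem ▸ hEd
        cur_eq := (hreg _ (by decide) (by decide)).trans hcur
        cur_lt := hcur'
        colors := hmem ▸ hcol
        src_eq := (hreg _ (by decide) (by decide)).trans hsrc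
        dst_eq := (hreg _ (by decide) (by decide)).trans hdst
        x_eq := (hreg _ (by decide) (by decide)).trans hx
        b_eq := (hreg _ (by decide) (by decide)).trans hb
        w_eq := (hreg _ (by decide) (by decide)).trans hw
        j_eq := (hfρ.reg _ (by decide)).trans hτ.1
        d_eq := (hfρ.reg _ (by decide)).trans hτ.2
        pow_eq := by rw [hρ, hfτ.reg _ (by decide), hL.B]
        b_le := hb'
        same := hmem ▸ SameOutside.refl }
    refine ⟨hEnv.set hS, by simp, l', ?_, fun h hh => .inl hh⟩
    simpa [hmem] using hD'
  · rintro i hi κ hfκ ⟨hEκ, hidx, l'', hD'', hsub⟩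
    refine ⟨?_, ?_⟩
    · simp [hEκ.loaded.base, hEκ.loaded.K, hEκ.src_eq, (hD.same hS hEκ.same hne).len, hidx]
      omega
    · refine Runs.mono_cost (Runs.bind (runs_key hEκ hS hne hD hD'' hcap hgood hi hidx)
        fun η hη hfη => Runs.assign ?_ ?_) ?_
      · have := hD.length_lt hS
        have := hS.K_lt
        simp [hη.2.1]; omega
      · obtain ⟨h1, h2, l3, h3, h4⟩ := hη
        refine ⟨h1.set hS, by simp [h2], l3, ?_, fun h hh => ?_⟩
        · simp only [State.set_mem]
          convert h3 using 1
          funext h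
          rw [List.map_take, List.map_take, List.sum_take_succ _ _ (by simpa using hi)]
          simp only [List.getElem_map]
          ring
        · rcases h4 h hh with h5 | h5
          · exact hsub h h5
          · exact .inr h5
      · simp
  · rintro κ hfκ ⟨hEκ, hidx, l'', hD'', hsub⟩
    refine ⟨?_, hEκ.same, l'', ?_, hsub⟩
    · simp [hEκ.loaded.base, hEκ.loaded.K, hEκ.src_eq, (hD.same hS hEκ.same hne).len, hidx]
    · convert hD'' using 1
      funext h
      rw [List.take_length, sum_spread _ _ _ _ _ _ _ _ _ hD.nodup hD.supp]
  · simp [addr, Params.transferCost]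
    have h1 : l.length * (π.n * (π.n * (60 * π.n + 200) + 2000) + 620 + 66 + 1) ≤
      l.length * (π.n * (π.n * (60 * π.n + 200) + 2000) + 700) := Nat.mul_le_mul_left _ (by omega)
    have h2 := x.2
    linarith

end RAM

namespace RAM

open Orient Finset Params

variable {S : ℕ} {ω : ℕ → Bool} {σ τ : State} {π : Params}

/-! Evaluating the color sum -/

namespace Params

/-- The dictionaries behind `δ` have not been used. -/
def Fresh (π : Params) (δ : ℕ) (mem : ℕ → ℕ) : Prop :=
  ∀ kind < 4, ∀ i, (δ + 1) * π.K ≤ i → mem (cellAddr π.base kind i) = 0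

/-- The memory is unchanged outside the dictionaries behind `δ`. -/
def SameUpTo (π : Params) (δ : ℕ) (mem mem' : ℕ → ℕ) : Prop :=
  ∀ a, (∀ kind < 4, ∀ i, (δ + 1) * π.K ≤ i → a ≠ cellAddr π.base kind i) → mem' a = mem a

variable {δ δ' δ'' : ℕ} {mem mem' mem'' : ℕ → ℕ}

theorem SameOutside.sameUpTo (h : π.SameOutside δ' mem mem') (hδ : δ < δ') :
    π.SameUpTo δ mem mem' := by
  intro a ha
  refine h a fun kind hk i _ => ha kind hk _ ?_
  have := Nat.mul_le_mul_right π.K (Nat.succ_le_of_lt hδ)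
  rw [Nat.succ_eq_add_one] at this
  omega

namespace SameUpTo

theorem trans (h : π.SameUpTo δ mem mem') (h' : π.SameUpTo δ mem' mem'') :
    π.SameUpTo δ mem mem'' := fun a ha => (h' a ha).trans (h a ha)

theorem mono (h : π.SameUpTo δ' mem mem') (hδ : δ ≤ δ') : π.SameUpTo δ mem mem' := by
  intro a ha
  refine h a fun kind hk i hi => ha kind hk _ ?_
  have := Nat.mul_le_mul_right π.K (Nat.succ_le_succ hδ)
  simp only [Nat.succ_eq_add_one] at this
  omega

theorem vertex (h : π.SameUpTo δ mem mem') (hS : π.Fits S) {a : ℕ} (ha : a < π.n) :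
    mem' a = mem a :=
  h _ fun kind' _ j _ he => by have := hS.base_ge; unfold cellAddr at he; omega

theorem edges (h : π.SameUpTo δ mem mem') {E : Finset ℕ} (hE : π.Edges E mem) :
    π.Edges E mem' := by
  refine ⟨hE.lt, hE.ne, fun z hz => ?_, hE.inc_lt⟩
  rw [h _ fun kind hk i _ he => ?_, hE.mark z hz]
  rw [cellAddr_inj (by norm_num) (by omega)] at he
  omega

end SameUpTo

theorem Fresh.same (h : π.Fresh δ mem) (hm : π.SameOutside δ' mem mem') (h1 : δ ≤ δ'')
    (h2 : δ' ≤ δ'') : π.Fresh δ'' mem' := by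
  intro kind hk i hi
  have e1 := Nat.mul_le_mul_right π.K (Nat.succ_le_succ h1)
  have e2 := Nat.mul_le_mul_right π.K (Nat.succ_le_succ h2)
  simp only [Nat.succ_eq_add_one] at e1 e2
  rw [hm.cell (by omega) (.inr (.inr (by omega))), h kind hk i (by omega)]

/-- Memory that was never written is zero, and zeros are a valid empty dictionary. Dictionaries are
never reused, so none has to be cleared. -/
theorem Fresh.dict (h : π.Fresh δ mem) (hS : π.Fits S) (hδ : δ < δ') :
    π.Dict mem δ' [] fun _ => 0 := by
  have e1 := Nat.mul_le_mul_right π.K (Nat.succ_le_of_lt hδ)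
  simp only [Nat.succ_eq_add_one] at e1
  have hM := hS.M_gt
  constructor
  · simp
  · rw [h 3 (by norm_num) _ e1]; rfl
  · intro i hi; simp at hi
  · intro g; rw [h 1 (by norm_num) _ (by omega)]; simp
  · intro g; rw [h 2 (by norm_num) _ (by omega)]; omega
  · intro g; rw [h 2 (by norm_num) _ (by omega)]; simp
  · intro g _; rfl

/-- The numbers of states that occur are small: `D` bounds half the degrees, `W` the number of
vertices with nonzero state. -/
structure Narrow (π : Params) (E : Finset ℕ) (D W : ℕ) : Prop where
  half_le : ∀ x, inc π.fst π.snd E x / 2 ≤ D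
  small : ∀ z ∈ E, ∃ s : Finset (Fin π.n), #s ≤ W ∧ ∀ x, x ∉ s →
    cap π.fst π.snd E (before E z) x = 0 ∧ cap π.fst π.snd E (before E (z + 1)) x = 0

theorem transferCost_mono (π : Params) {m m' : ℕ} (h : m ≤ m') :
    π.transferCost m ≤ π.transferCost m' := by
  have := Nat.mul_le_mul_right (π.n * (π.n * (60 * π.n + 200) + 2000) + 700) h
  unfold transferCost
  omega

end Params

variable {E : Finset ℕ} {cur : ℕ}

/-- The arguments are evaluated one after another while the argument registers are being
overwritten; therefore `hev` asks for their values in all states that agree with `σ` on the other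
registers. -/
theorem runs_call (hL : π.Loaded σ) (hS : π.Fits S) (hEd : π.Edges E σ.mem)
    (hcur : σ.reg r_cur = cur) (hcur' : cur < π.n) (hcol : ∀ y ≤ cur, σ.mem y < π.k)
    {z : ℕ} (hz : σ.reg r_z = z) {esrc edst ex eb ew : Exp} {x : Fin π.n} {b w src dst : ℕ}
    (hev : ∀ ρ : State, (∀ r, r ∉ [r_src, r_dst, r_x, r_b, r_w] → ρ.reg r = σ.reg r) →
      esrc.eval ρ = src ∧ edst.eval ρ = dst ∧ ex.eval ρ = x ∧ eb.eval ρ = b ∧ ew.eval ρ = w)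
    (hb' : b ≤ 1) (hne : src ≠ dst) (hsrc : src < 2 ^ S) (hdst : dst < 2 ^ S) (hw : w < 2 ^ S)
    {l l' : List (Fin π.n → Fin π.n)} {V V' : (Fin π.n → Fin π.n) → ZMod π.M}
    (hD : π.Dict σ.mem src l V) (hD' : π.Dict σ.mem dst l' V')
    (hcap : ∀ g ∈ l, (g x : ℕ) ≤ cap π.fst π.snd E (before E z) x)
    {Good : (Fin π.n → Fin π.n) → Prop}
    (hgood : ∀ g ∈ l, ∀ c' : Fin π.n,
      weight π.fst π.snd E (π.moments cur σ.mem) (before E z) x b (g x) c' ≠ 0 →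
        Good (Function.update g x c'))
    {Λ : ℕ} (hΛ : l.length ≤ Λ) :
    Runs S ω (callProg esrc edst ex eb ew) σ (π.transferCost Λ +
        (esrc.weight + edst.weight + ex.weight + eb.weight + ew.weight + 5)) fun τ =>
      π.SameOutside dst σ.mem τ.mem ∧ ∃ l'', π.Dict τ.mem dst l'' (fun h => V' h +
        w * transfer π.fst π.snd E (π.moments cur σ.mem) (before E z) x b V h) ∧
      ∀ h ∈ l'', h ∈ l' ∨ Good h := by
  have hn := hS.n_lt
  have hxn := x.2
  have hset : ∀ {ρ : State} {r v : ℕ}, (∀ r, r ∉ [r_src, r_dst, r_x, r_b, r_w] →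
      ρ.reg r = σ.reg r) → r ∈ [r_src, r_dst, r_x, r_b, r_w] →
      ∀ r', r' ∉ [r_src, r_dst, r_x, r_b, r_w] → (ρ.set r v).reg r' = σ.reg r' := by
    intro ρ r v hρ hr r' hr'
    rw [State.set_reg, if_neg (by rintro rfl; exact hr' hr), hρ r' hr']
  have h0 : ∀ r, r ∉ [r_src, r_dst, r_x, r_b, r_w] → σ.reg r = σ.reg r := fun _ _ => rfl
  have h1 := hset (v := src) h0 (show r_src ∈ [r_src, r_dst, r_x, r_b, r_w] by decide)
  have h2 := hset (v := dst) h1 (show r_dst ∈ [r_src, r_dst, r_x, r_b, r_w] by decide)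
  have h3 := hset (v := x) h2 (show r_x ∈ [r_src, r_dst, r_x, r_b, r_w] by decide)
  have h4 := hset (v := b) h3 (show r_b ∈ [r_src, r_dst, r_x, r_b, r_w] by decide)
  refine Runs.mono_cost (Runs.seq (Runs.assign ?_ fun _ => ?_))
    (N := _ + (1 + edst.weight + (1 + ex.weight + (1 + eb.weight + (1 + ew.weight +
      π.transferCost l.length))))) ?_
  · rwa [(hev _ h0).1]
  rw [(hev _ h0).1]
  refine Runs.seq (Runs.assign ?_ fun _ => ?_)
  · rwa [(hev _ h1).2.1]
  rw [(hev _ h1).2.1]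
  refine Runs.seq (Runs.assign ?_ fun _ => ?_)
  · rw [(hev _ h2).2.2.1]; omega
  rw [(hev _ h2).2.2.1]
  refine Runs.seq (Runs.assign ?_ fun _ => ?_)
  · rw [(hev _ h3).2.2.2.1]; omega
  rw [(hev _ h3).2.2.2.1]
  refine Runs.seq (Runs.assign ?_ fun _ => ?_)
  · rwa [(hev _ h4).2.2.2.2]
  rw [(hev _ h4).2.2.2.2]
  · exact runs_transfer (hL.set.set.set.set.set) hS hEd (by simp [hcur]) hcur' hcol (by simp)
      (by simp) (by simp) (by simp) hb' (by simp) (by simp [hz]) hne hD hD' hcap hgood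
  · have := π.transferCost_mono hΛ
    omega

theorem cap_before_succ {z : ℕ} (hz : z ∈ E) {y : Fin π.n} (h1 : y ≠ π.fst z) (h2 : y ≠ π.snd z) :
    cap π.fst π.snd E (before E (z + 1)) y = cap π.fst π.snd E (before E z) y := by
  have : inc π.fst π.snd (before E (z + 1)) y = inc π.fst π.snd (before E z) y := by
    rw [before_succ_of_mem hz, inc_insert (notMem_before E z), if_neg, add_zero]
    rintro (h | h)
    exacts [h1 h.symm, h2 h.symm]
  unfold cap
  rw [this]

/-- The two terms of `amplitude_insert` go through the intermediate dictionaries `δ + 1` and `δ + 2`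
and are added up in `δ + 3`, the one in which the edge leaves its second end with the factor `M -
1`, that is, `-1`. -/
theorem runs_edge (hL : π.Loaded σ) (hS : π.Fits S) (hEd : π.Edges E σ.mem)
    (hcur : σ.reg r_cur = cur) (hcur' : cur < π.n) (hcol : ∀ y ≤ cur, σ.mem y < π.k)
    {z δ D W : ℕ} (hz : σ.reg r_z = z) (hzE : z ∈ E) (hδ : σ.reg r_delta = δ) (hδ' : δ + 3 < 2 ^ S)
    (hfresh : π.Fresh δ σ.mem) (hN : π.Narrow E D W) {l : List (Fin π.n → Fin π.n)}
    (hD : π.Dict σ.mem δ l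
      (amplitude π.fst π.snd E (π.moments cur σ.mem) (before E z)))
    (hl : ∀ g ∈ l, ∀ y, (g y : ℕ) ≤ cap π.fst π.snd E (before E z) y) :
    Runs S ω edgeProg σ (4 * π.transferCost ((D + 1) ^ W) + 300) fun τ =>
      τ.reg r_delta = δ + 3 ∧ π.Fresh (δ + 3) τ.mem ∧ π.SameUpTo δ σ.mem τ.mem ∧
      ∃ l', π.Dict τ.mem (δ + 3) l'
        (amplitude π.fst π.snd E (π.moments cur σ.mem) (before E (z + 1))) ∧
      ∀ g ∈ l', ∀ y, (g y : ℕ) ≤ cap π.fst π.snd E (before E (z + 1)) y := by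
  set u := π.fst z with hu
  set v := π.snd z with hv
  set F := before E z with hF
  set μ := π.moments cur σ.mem with hμ
  have huv : u ≠ v := hEd.ne z hzE
  have hsucc : before E (z + 1) = insert z F := before_succ_of_mem hzE
  obtain ⟨s, hsW, hs⟩ := hN.small z hzE
  -- The bound on the states in the intermediate dictionaries: the first end has already been
  -- advanced, the second has not. It vanishes outside `s` because `Narrow.small` covers the times
  -- before and after the edge.
  set κ := Function.update (cap π.fst π.snd E F) u (cap π.fst π.snd E (insert z F) u) with hκ
  have hM := hS.M_lt
  have hM1 := hS.M_gt
  have hlen : ∀ {l : List (Fin π.n → Fin π.n)} {κ : Fin π.n → ℕ}, l.Nodup → (∀ x, κ x ≤ D) →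
      (∀ x, x ∉ s → κ x = 0) → (∀ g ∈ l, ∀ y, (g y : ℕ) ≤ κ y) → l.length ≤ (D + 1) ^ W := by
    intro l κ hnd hκ hs hl
    rw [← List.toFinset_card_of_nodup hnd]
    exact card_states_le hκ hs hsW _ fun g hg => hl g (List.mem_toFinset.1 hg)
  have hcapD : ∀ F' x, cap π.fst π.snd E F' x ≤ D := fun F' x => (cap_le F' x).trans (hN.half_le x)
  have hκD : ∀ x, κ x ≤ D := by
    intro x
    rw [hκ, Function.update_apply]
    split_ifs <;> apply hcapD
  have hκs : ∀ x, x ∉ s → κ x = 0 := by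
    intro x hx
    rw [hκ, Function.update_apply]
    split_ifs with h
    · rw [← h, ← hsucc]; exact (hs x hx).2
    · exact (hs x hx).1
  have hκv : κ v = cap π.fst π.snd E F v := by rw [hκ, Function.update_of_ne huv.symm]
  have hfirst : ∀ b ≤ 1, ∀ g ∈ l, ∀ c' : Fin π.n,
      weight π.fst π.snd E μ F u b (g u) c' ≠ 0 →
        ∀ y, (Function.update g u c' y : ℕ) ≤ κ y := by
    intro b hb g hg c' hw y
    rw [hκ]
    by_cases hy : y = u
    · subst hy
      rw [Function.update_self, Function.update_self]
      exact le_cap_of_weight_ne_zero (notMem_before E z) (.inl rfl) hb (hl g hg _) hw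
    · rw [Function.update_of_ne hy, Function.update_of_ne hy]
      exact hl g hg y
  have hsecond : ∀ b ≤ 1, ∀ g : Fin π.n → Fin π.n, (∀ y, (g y : ℕ) ≤ κ y) → ∀ c' : Fin π.n,
      weight π.fst π.snd E μ F v b (g v) c' ≠ 0 →
        ∀ y, (Function.update g v c' y : ℕ) ≤ cap π.fst π.snd E (before E (z + 1)) y := by
    intro b hb g hg c' hw y
    by_cases hy : y = v
    · subst hy
      rw [Function.update_self, hsucc]
      exact le_cap_of_weight_ne_zero (notMem_before E z) (.inr rfl) hb ((hg _).trans hκv.le) hw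
    · rw [Function.update_of_ne hy]
      refine (hg y).trans_eq ?_
      rw [hκ, Function.update_apply]
      split_ifs with h
      · rw [h, hsucc]
      · rw [cap_before_succ hzE h hy]
  have hfrag : ∀ {A : Prog} {ρ ρ' : State}, Frame A ρ ρ' → (∀ r ∈ [r_cur, r_z, r_delta],
      r ∉ A.writes) → ρ.reg r_cur = cur → ρ.reg r_z = z → ρ.reg r_delta = δ →
      ρ'.reg r_cur = cur ∧ ρ'.reg r_z = z ∧ ρ'.reg r_delta = δ := by
    intro A ρ ρ' hf hA h1 h2 h3
    exact ⟨(hf.reg _ (hA _ (by decide))).trans h1, (hf.reg _ (hA _ (by decide))).trans h2,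
      (hf.reg _ (hA _ (by decide))).trans h3⟩
  refine Runs.mono_cost (Runs.bind (runs_call (x := u) (src := δ) (dst := δ + 1) (b := 0) (w := 1)
    (Good := fun g => ∀ y, (g y : ℕ) ≤ κ y) hL hS hEd hcur hcur' hcol hz ?_ (by omega) (by omega)
    (by omega) (by omega) (by omega) hD (hfresh.dict hS (by omega)) (fun g hg => hl g hg _)
    (hfirst 0 (by omega)) (hlen hD.nodup (hcapD _) (fun x hx => (hs x hx).1) hl)) ?_)
    (N := _ + (3 * π.transferCost ((D + 1) ^ W) + 200)) ?_
  · intro ρ hρ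
    simp [hρ r_delta (by decide), hρ r_z (by decide), hρ r_n (by decide), hδ, hz, hL.n, hu]
  · rintro σ₁ ⟨hs₁, l₁, hD₁, hl₁⟩ hf₁
    obtain ⟨hcur₁, hz₁, hδ₁⟩ := hfrag hf₁ (by decide) hcur hz hδ
    have hL₁ := hL.frame hf₁
    have hl₁' : ∀ g ∈ l₁, ∀ y, (g y : ℕ) ≤ κ y := fun g hg => (hl₁ g hg).resolve_left (by simp)
    have hμ₁ : π.moments cur σ₁.mem = μ := moments_congr fun _ hy => hs₁.vertex hS hy
    have hcol₁ : ∀ y ≤ cur, σ₁.mem y < π.k := fun y hy => by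
      rw [hs₁.vertex hS (by omega)]; exact hcol y hy
    refine Runs.mono_cost (Runs.bind (runs_call (x := v) (src := δ + 1) (dst := δ + 3) (b := 1)
      (w := π.M - 1) (Good := fun g => ∀ y, (g y : ℕ) ≤ cap π.fst π.snd E (before E (z + 1)) y)
      hL₁ hS (hs₁.edges hEd) hcur₁ hcur' hcol₁ hz₁ ?_ (by omega) (by omega)
      (by omega) (by omega) (by omega) hD₁
      ((hfresh.dict hS (δ' := δ + 3) (by omega)).same hS hs₁ (by omega))
      (fun g hg => (hl₁' g hg _).trans hκv.le)
      ?_ (hlen hD₁.nodup hκD hκs hl₁')) ?_)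
      (N := _ + (2 * π.transferCost ((D + 1) ^ W) + 120)) ?_
    · intro ρ hρ
      simp [hρ r_delta (by decide), hρ r_z (by decide), hρ r_n (by decide), hρ r_M (by decide), hδ₁,
        hz₁, hL₁.n, hL₁.M, hv]
    · rw [hμ₁]
      exact fun g hg => hsecond 1 le_rfl g (hl₁' g hg)
    · rintro σ₂ ⟨hs₂, l₂, hD₂, hl₂⟩ hf₂
      obtain ⟨hcur₂, hz₂, hδ₂⟩ := hfrag hf₂ (by decide) hcur₁ hz₁ hδ₁
      have hL₂ := hL₁.frame hf₂
      have hl₂' := fun g hg => (hl₂ g hg).resolve_left (by simp)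
      have hμ₂ : π.moments cur σ₂.mem = μ := by
        rw [← hμ₁]; exact moments_congr fun _ hy => hs₂.vertex hS hy
      have hcol₂ : ∀ y ≤ cur, σ₂.mem y < π.k := fun y hy => by
        rw [hs₂.vertex hS (by omega)]; exact hcol₁ y hy
      refine Runs.mono_cost (Runs.bind (runs_call (x := u) (src := δ) (dst := δ + 2) (b := 1)
        (w := 1) (Good := fun g => ∀ y, (g y : ℕ) ≤ κ y) hL₂ hS (hs₂.edges (hs₁.edges hEd)) hcur₂
        hcur' hcol₂ hz₂ ?_ (by omega) (by omega)
        (by omega) (by omega) (by omega) ((hD.same hS hs₁ (by omega)).same hS hs₂ (by omega))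
        (((hfresh.dict hS (δ' := δ + 2) (by omega)).same hS hs₁ (by omega)).same hS hs₂ (by omega))
        (fun g hg => hl g hg _)
        ?_ (hlen hD.nodup (hcapD _) (fun x hx => (hs x hx).1) hl)) ?_)
        (N := _ + (π.transferCost ((D + 1) ^ W) + 60)) ?_
      · intro ρ hρ
        simp [hρ r_delta (by decide), hρ r_z (by decide), hρ r_n (by decide), hδ₂, hz₂, hL₂.n, hu]
      · rw [hμ₂]
        exact hfirst 1 le_rfl
      · rintro σ₃ ⟨hs₃, l₃, hD₃, hl₃⟩ hf₃
        obtain ⟨hcur₃, hz₃, hδ₃⟩ := hfrag hf₃ (by decide) hcur₂ hz₂ hδ₂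
        have hL₃ := hL₂.frame hf₃
        have hl₃' : ∀ g ∈ l₃, ∀ y, (g y : ℕ) ≤ κ y :=
          fun g hg => (hl₃ g hg).resolve_left (by simp)
        have hμ₃ : π.moments cur σ₃.mem = μ := by
          rw [← hμ₂]; exact moments_congr fun _ hy => hs₃.vertex hS hy
        have hcol₃ : ∀ y ≤ cur, σ₃.mem y < π.k := fun y hy => by
          rw [hs₃.vertex hS (by omega)]; exact hcol₂ y hy
        refine Runs.mono_cost (Runs.bind (runs_call (x := v) (src := δ + 2) (dst := δ + 3) (b := 0)
          (w := 1) (Good := fun g => ∀ y, (g y : ℕ) ≤ cap π.fst π.snd E (before E (z + 1)) y)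
          hL₃ hS (hs₃.edges (hs₂.edges (hs₁.edges hEd))) hcur₃ hcur' hcol₃ hz₃ ?_ (by omega)
          (by omega) (by omega) (by omega) (by omega) hD₃ (hD₂.same hS hs₃ (by omega))
          (fun g hg => (hl₃' g hg _).trans hκv.le)
          ?_ (hlen hD₃.nodup hκD hκs hl₃')) ?_)
          (N := _ + 20) ?_
        · intro ρ hρ
          simp [hρ r_delta (by decide), hρ r_z (by decide), hρ r_n (by decide), hδ₃, hz₃, hL₃.n,
            hv]
        · rw [hμ₃]
          exact fun g hg => hsecond 0 (by omega) g (hl₃' g hg)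
        · rintro σ₄ ⟨hs₄, l₄, hD₄, hl₄⟩ hf₄
          obtain ⟨hcur₄, hz₄, hδ₄⟩ := hfrag hf₄ (by decide) hcur₃ hz₃ hδ₃
          refine Runs.mono_cost (Runs.assign ?_ ⟨by simp [hδ₄], ?_, ?_, l₄, ?_, ?_⟩) ?_
          · simp [hδ₄]; omega
          · have f1 := hfresh.same hs₁ (δ'' := δ + 3) (by omega) (by omega)
            have f2 := f1.same hs₂ (δ'' := δ + 3) (by omega) (by omega)
            have f3 := f2.same hs₃ (δ'' := δ + 3) (by omega) (by omega)
            exact f3.same hs₄ (δ'' := δ + 3) (by omega) (by omega)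
          · exact (((hs₁.sameUpTo (by omega)).trans (hs₂.sameUpTo (by omega))).trans
              (hs₃.sameUpTo (by omega))).trans (hs₄.sameUpTo (by omega))
          · simp only [State.set_mem]
            convert hD₄ using 1
            funext h
            rw [hsucc, amplitude_insert (before_subset E z) hzE (notMem_before E z) huv hEd.inc_lt,
              hμ₁, hμ₂, hμ₃, Nat.cast_sub hM1.le]
            simp only [Nat.cast_one, zero_add, one_mul, ZMod.natCast_self, zero_sub, neg_one_mul]
            rw [neg_add_eq_sub]
          · intro g hg
            rcases hl₄ g hg with h | h
            · exact hl₂' g h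
            · exact h
          · simp
        · simp
      · simp
        omega
    · simp
      omega
  · simp
    omega


/-- The cost of computing a color sum. -/
def Params.evalCost (π : Params) (m : ℕ) : ℕ :=
  π.Z * (4 * π.transferCost m + 600) + 1000

/-- The result is the value of the zero state after all edges, by `amplitude_zero`. One evaluation
uses up at most `3 * Z + 1` dictionaries: the initial one and three for each edge. -/
theorem runs_eval (hL : π.Loaded σ) (hS : π.Fits S) (hEd : π.Edges E σ.mem)
    (hcur : σ.reg r_cur = cur) (hcur' : cur < π.n) (hcol : ∀ y ≤ cur, σ.mem y < π.k)
    {δ D W : ℕ} (hδ : σ.reg r_delta = δ) (hδ' : δ + 3 * π.Z + 5 < 2 ^ S)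
    (hfresh : π.Fresh δ σ.mem) (hN : π.Narrow E D W) :
    Runs S ω evalProg σ (π.evalCost ((D + 1) ^ W)) fun τ =>
      (∃ δ', τ.reg r_delta = δ' ∧ δ' ≤ δ + 3 * π.Z + 1 ∧ π.Fresh δ' τ.mem) ∧
      π.SameUpTo δ σ.mem τ.mem ∧ τ.reg r_res < π.M ∧
      (τ.reg r_res : ZMod π.M) = colorSum π.fst π.snd E
        (trimmed π.fst π.snd E fun x => colorList π.k cur σ.mem x) (fun x => π.digit x) := by
  have h1 := hS.one_lt
  have hM1 := hS.M_gt
  have hM := hS.M_lt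
  have hZ := hS.Z_lt
  have hK := hS.K_pos
  set μ := π.moments cur σ.mem with hμ
  refine Runs.mono_cost (Runs.seq (Runs.assign ?_ fun _ => ?_))
    (N := _ + (π.Z * (4 * π.transferCost ((D + 1) ^ W) + 600) + 800)) ?_
  · simp [hδ]; omega
  have e0 : (R[r_delta] + 1).eval σ = δ + 1 := by simp [hδ]
  rw [e0]
  set σ₁ := σ.set r_delta (δ + 1) with hσ₁
  have hL₁ : π.Loaded σ₁ := hL.set
  have ha : ∀ kind, ∀ τ : State, τ.reg = σ₁.reg → (addr kind (R[r_delta] * R[r_K])).eval τ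
      = cellAddr π.base kind ((δ + 1) * π.K) := by
    intro kind τ hτ
    simp only [eval_addr, Exp.eval_mul, Exp.eval_reg, hτ, hL₁.base, hL₁.K]
    simp [hσ₁]
  set τ₀ := ((σ₁.put (cellAddr π.base 1 ((δ + 1) * π.K)) 1).put
    (cellAddr π.base 2 ((δ + 1) * π.K)) 1).put (cellAddr π.base 3 ((δ + 1) * π.K)) 1 with hτ₀
  have hmem : ∀ kind < 8, ∀ i, τ₀.mem (cellAddr π.base kind i) =
      if (kind = 1 ∨ kind = 2 ∨ kind = 3) ∧ i = (δ + 1) * π.K then 1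
      else σ.mem (cellAddr π.base kind i) := by
    intro kind hk i
    simp only [hτ₀, State.put_mem, cellAddr_inj hk (show 2 < 8 by norm_num),
      cellAddr_inj hk (show 1 < 8 by norm_num), cellAddr_inj hk (show 3 < 8 by norm_num)]
    by_cases hi : i = (δ + 1) * π.K
    · by_cases h1 : kind = 1
      · simp [h1, hi]
      · by_cases h2 : kind = 2
        · simp [h2, hi]
        · by_cases h3 : kind = 3
          · simp [h3, hi]
          · simp [h1, h2, h3, hσ₁]
    · simp [hi, hσ₁]
  have hs₀ : π.SameOutside (δ + 1) σ.mem τ₀.mem :=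
    sameOutside_put (i := 0) (sameOutside_put (i := 0) (sameOutside_put (i := 0)
      (σ := σ₁) SameOutside.refl (by norm_num) hK) (by norm_num) hK) (by norm_num) hK
  -- The zero state is encoded by `0`, which a fresh key list already contains; so only flag, value
  -- and length had to be written.
  have hD₀ : π.Dict τ₀.mem (δ + 1) [0] (amplitude π.fst π.snd E μ (before E 0)) := by
    have henc : ∀ g : Fin π.n → Fin π.n, (δ + 1) * π.K + π.enc g = (δ + 1) * π.K ↔ g = 0 := by
      intro g
      rw [Nat.add_eq_left, ← (enc_injective hS).eq_iff, enc_zero]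
    have hV : ∀ g, amplitude π.fst π.snd E μ (before E 0) g = if g = 0 then 1 else 0 := by
      intro g; rw [before_zero, amplitude_empty]
    constructor
    · simp
    · rw [hmem 3 (by norm_num)]; simp
    · intro i hi
      have : i = 0 := by simpa using hi
      subst this
      rw [hmem 0 (by norm_num)]
      simp [enc_zero, hfresh 0 (by norm_num)]
    · intro g
      rw [hmem 1 (by norm_num)]
      simp only [henc]
      by_cases hg : g = 0 <;> simp [hg, hfresh 1 (by norm_num)]
    · intro g
      rw [hmem 2 (by norm_num)]
      simp only [henc]
      by_cases hg : g = 0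
      · simpa [hg] using hM1
      · simp [hg, hfresh 2 (by norm_num)]; omega
    · intro g
      rw [hmem 2 (by norm_num), hV]
      simp only [henc]
      by_cases hg : g = 0 <;> simp [hg, hfresh 2 (by norm_num)]
    · intro g hg
      rw [hV, if_neg (by simpa using hg)]
  refine Runs.mono_cost (Runs.seq (Runs.store ?_ fun _ => Runs.seq (Runs.store ?_ fun _ =>
    Runs.seq (Runs.store ?_ fun _ => ?_)))) (N := _ + (_ + (_ +
      (π.Z * (4 * π.transferCost ((D + 1) ^ W) + 600) + 500)))) ?_
  · simpa using h1
  · simpa using h1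
  · simpa using h1
  · rw [ha 1 σ₁ rfl, Exp.eval_ofNat, ha 2 (σ₁.put _ _) rfl, Exp.eval_ofNat,
      ha 3 ((σ₁.put _ _).put _ _) rfl, Exp.eval_ofNat]
    have hLτ : π.Loaded τ₀ := hL₁.put.put.put
    refine Runs.mono_cost (Runs.seq (Runs.assign (by simp) fun _ => Runs.bind (Runs.loop
      (fun z ρ => ρ.reg r_z = z ∧ ∃ δ', ρ.reg r_delta = δ' ∧ δ + 1 ≤ δ' ∧ δ' ≤ δ + 3 * z + 1 ∧
        π.Fresh δ' ρ.mem ∧ π.SameUpTo δ σ.mem ρ.mem ∧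
        ∃ l, π.Dict ρ.mem δ' l (amplitude π.fst π.snd E μ (before E z)) ∧
        ∀ g ∈ l, ∀ y, (g y : ℕ) ≤ cap π.fst π.snd E (before E z) y) π.Z
        (4 * π.transferCost ((D + 1) ^ W) + 480)
        (Q := fun ρ => π.Loaded ρ ∧ ∃ δ', ρ.reg r_delta = δ' ∧ δ' ≤ δ + 3 * π.Z + 1 ∧
        π.Fresh δ' ρ.mem ∧ π.SameUpTo δ σ.mem ρ.mem ∧
        ∃ l, π.Dict ρ.mem δ' l (amplitude π.fst π.snd E μ (before E π.Z))) ?_ ?_ ?_) ?_))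
        (N := 2 + (_ + 100)) ?_
    · refine ⟨by simp, δ + 1, ?_, le_rfl, by omega, ?_, hs₀.sameUpTo (by omega), [0], hD₀, ?_⟩
      · simp [hσ₁]
      · exact hfresh.same hs₀ (by omega) (by omega)
      · intro g hg y
        simp only [List.mem_singleton] at hg
        simp [hg]
    · rintro z hz ρ hfρ ⟨hzρ, δ', hδ'ρ, hδ1, hδ2, hfr, hsame, l, hD, hl⟩
      have hLρ : π.Loaded ρ := hLτ.set.frame hfρ
      have hcurρ : ρ.reg r_cur = cur := by
        rw [hfρ.reg _ (by decide)]
        simp [hσ₁, hcur]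
      have hEdρ := hsame.edges hEd
      have hμρ : π.moments cur ρ.mem = μ := moments_congr fun _ hy => hsame.vertex hS hy
      have hcolρ : ∀ y ≤ cur, ρ.mem y < π.k := fun y hy => by
        rw [hsame.vertex hS (by omega)]; exact hcol y hy
      have hmark : M[addr 4 R[r_z]].eval ρ = if z ∈ E then 1 else 0 := by
        simp [hzρ, hLρ.base, hEdρ.mark z hz]
      refine ⟨by simp [hLρ.Z, hzρ]; omega, ?_⟩
      refine Runs.mono_cost (Runs.bind (N₁ := 4 * π.transferCost ((D + 1) ^ W) + 450)
        (Q' := fun ρ => ρ.reg r_z = z ∧ ∃ δ', ρ.reg r_delta = δ' ∧ δ + 1 ≤ δ' ∧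
          δ' ≤ δ + 3 * (z + 1) + 1 ∧ π.Fresh δ' ρ.mem ∧ π.SameUpTo δ σ.mem ρ.mem ∧
        ∃ l, π.Dict ρ.mem δ' l (amplitude π.fst π.snd E μ (before E (z + 1))) ∧
        ∀ g ∈ l, ∀ y, (g y : ℕ) ≤ cap π.fst π.snd E (before E (z + 1)) y)
        (Runs.mono_cost (Runs.ifte (fun h0 => Runs.frame ((runs_edge (z := z) hLρ hS hEdρ hcurρ
          hcur' hcolρ hzρ ?_ hδ'ρ (by omega) hfr hN (by rwa [hμρ]) hl).mono le_rfl ?_))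
          fun h0 => Runs.skip ?_) ?_)
        fun κ hκ _ => Runs.assign ?_ ?_) ?_
      · by_contra hzE
        rw [hmark, if_neg hzE] at h0
        exact h0 rfl
      · rintro κ ⟨hδκ, hfκ, hsκ, l', hD', hl'⟩ hfrκ
        rw [hμρ] at hD'
        exact ⟨by rw [hfrκ.reg _ (by decide), hzρ], δ' + 3, hδκ, by omega, by omega, hfκ,
          hsame.trans (hsκ.mono (by omega)), l', hD', hl'⟩
      · have hzE : z ∉ E := by
          intro hzE
          rw [hmark, if_pos hzE] at h0
          exact one_ne_zero h0
        rw [before_succ_of_notMem hzE]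
        exact ⟨hzρ, δ', hδ'ρ, hδ1, by omega, hfr, hsame, l, hD, hl⟩
      · simp [addr]
        omega
      · simp [hκ.1]; omega
      · obtain ⟨hz, δ'', h⟩ := hκ
        exact ⟨by simp [hz], δ'', by simpa using h⟩
      · simp
    · rintro ρ hfρ ⟨hzρ, δ', hδ'ρ, hδ1, hδ2, hfr, hsame, l, hD, hl⟩
      have hLρ : π.Loaded ρ := hLτ.set.frame hfρ
      exact ⟨by simp [hzρ, hLρ.Z], hLρ, δ', hδ'ρ, hδ2, hfr, hsame, l, hD⟩
    · rintro ρ ⟨hLρ, δ', hδρ, hδ2, hfr, hsame, l, hD⟩ _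
      have e2 : M[addr 2 (R[r_delta] * R[r_K])].eval ρ
          = ρ.mem (cellAddr π.base 2 (δ' * π.K + π.enc 0)) := by
        simp [hLρ.base, hLρ.K, hδρ, enc_zero]
      have hlt := hD.val_lt 0
      refine Runs.mono_cost (Runs.assign ?_ ⟨⟨δ', by simp [hδρ], hδ2, hfr⟩, hsame, ?_, ?_⟩) ?_
      · rw [e2]; omega
      · rw [State.set_reg, if_pos rfl, e2]; exact hlt
      · rw [State.set_reg, if_pos rfl, e2, hD.val, before_eq_self hEd.lt]
        exact amplitude_zero (fun x : Fin π.n => colorList π.k cur σ.mem x) fun x => π.digit x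
      · simp [addr]
    · have h2 : π.Z * (4 * π.transferCost ((D + 1) ^ W) + 480 + 6 + 1) ≤
        π.Z * (4 * π.transferCost ((D + 1) ^ W) + 600) := Nat.mul_le_mul_left _ (by omega)
      simp
      omega
  · simp [addr]
    omega
  · simp [Params.evalCost]
    omega

end RAM

/-! ### Self-reduction: fixing the color of one vertex -/

namespace Orient

open Finset

variable {n : ℕ} {R : Type*} [CommRing R] {u v : ℕ → Fin n} {E : Finset ℕ}

/-- A nonzero sum has a nonzero term, so some color of `y` survives without new random weights. At a
vertex without edges the list is hidden by `trimmed`, and color `0` changes nothing. -/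
theorem exists_colorSum_ne_zero {L : Fin n → Finset ℕ} {r : Fin n → R} {k : ℕ} (hk : 0 < k)
    (y : Fin n) (hy : L y = range k) (h : colorSum u v E (trimmed u v E L) r ≠ 0) :
    ∃ a < k, colorSum u v E (trimmed u v E (Function.update L y {a})) r ≠ 0 := by
  by_cases hinc : inc u v E y = 0
  · refine ⟨0, hk, ?_⟩
    have : trimmed u v E (Function.update L y {0}) = trimmed u v E L := by
      funext x
      unfold trimmed
      by_cases hx : x = y
      · subst hx; simp [hinc]
      · rw [Function.update_of_ne hx]
    rwa [this]
  · rw [colorSum_eq_sum y] at h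
    obtain ⟨a, ha, hne⟩ := exists_ne_zero_of_sum_ne_zero h
    rw [trimmed, if_neg hinc, hy, mem_range] at ha
    refine ⟨a, ha, ?_⟩
    have : trimmed u v E (Function.update L y {a}) = Function.update (trimmed u v E L) y {a} := by
      funext x
      unfold trimmed
      by_cases hx : x = y
      · subst hx; simp [hinc]
      · rw [Function.update_of_ne hx, Function.update_of_ne hx]
    rwa [this]

/-- With singleton lists every coloring in the sum agrees with `c` at the ends of edges, so an edge
of one color would put a zero factor into each term. -/
theorem ne_of_colorSum_ne_zero {c : Fin n → ℕ} {r : Fin n → R}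
    (h : colorSum u v E (trimmed u v E fun x => {c x}) r ≠ 0) {z : ℕ} (hz : z ∈ E) :
    c (u z) ≠ c (v z) := by
  intro he
  refine h (sum_eq_zero fun c' hc' => ?_)
  rw [Fintype.mem_piFinset] at hc'
  have hpos : ∀ x, (u z = x ∨ v z = x) → c' x = c x := by
    intro x hx
    have h1 := hc' x
    have h2 : inc u v E x ≠ 0 := by
      unfold inc
      rw [card_ne_zero]
      exact ⟨z, mem_filter.2 ⟨hz, hx⟩⟩
    rw [trimmed, if_neg h2, mem_singleton] at h1
    exact h1
  rw [prod_eq_zero hz, mul_zero]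
  rw [hpos _ (.inl rfl), hpos _ (.inr rfl), he, sub_self]

end Orient

namespace RAM

open Orient Finset Params

variable {S : ℕ} {ω : ℕ → Bool} {σ τ : State} {π : Params}

/-! Finding the colors -/

theorem colorList_eq (k cur : ℕ) (mem : ℕ → ℕ) :
    colorList k cur mem = fun x => if x < cur + 1 then {mem x} else range k := by
  funext x
  simp only [colorList, Nat.lt_succ_iff]

namespace Params

/-- The color sum, when the vertices below `j` have been colored. -/
def partialSum (π : Params) (E : Finset ℕ) (j : ℕ) (mem : ℕ → ℕ) : ZMod π.M :=
  colorSum π.fst π.snd E (trimmed π.fst π.snd E fun x : Fin π.n =>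
    if (x : ℕ) < j then {mem x} else range π.k) fun x => π.digit x

theorem partialSum_congr {E : Finset ℕ} {j : ℕ} {mem mem' : ℕ → ℕ}
    (h : ∀ y < j, mem' y = mem y) : π.partialSum E j mem' = π.partialSum E j mem := by
  unfold partialSum
  congr 2
  funext x
  split_ifs with hx
  · rw [h x hx]
  · rfl

theorem partialSum_succ {E : Finset ℕ} {j : ℕ} (hj : j < π.n) {mem : ℕ → ℕ} (hk : 0 < π.k)
    (h : π.partialSum E j mem ≠ 0) :
    ∃ a < π.k, π.partialSum E (j + 1) (Function.update mem j a) ≠ 0 := by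
  obtain ⟨a, ha, h1⟩ := exists_colorSum_ne_zero hk ⟨j, hj⟩ (by simp) h
  refine ⟨a, ha, ?_⟩
  unfold partialSum
  convert h1 using 3
  funext x
  by_cases hx : x = ⟨j, hj⟩
  · subst hx; simp
  · have hx' : (x : ℕ) ≠ j := fun h => hx (Fin.ext h)
    rw [Function.update_of_ne hx, Function.update_of_ne hx']
    exact if_congr (by omega) rfl rfl

theorem Edges.put {E : Finset ℕ} (h : π.Edges E σ.mem) (hS : π.Fits S) {a v : ℕ} (ha : a < π.n) :
    π.Edges E (σ.put a v).mem := by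
  refine ⟨h.lt, h.ne, fun z hz => ?_, h.inc_lt⟩
  rw [State.put_mem, if_neg, h.mark z hz]
  have := hS.base_ge
  unfold cellAddr
  omega

theorem Fresh.put {δ : ℕ} (h : π.Fresh δ σ.mem) (hS : π.Fits S) {a v : ℕ} (ha : a < π.n) :
    π.Fresh δ (σ.put a v).mem := by
  intro kind hk i hi
  rw [State.put_mem, if_neg, h kind hk i hi]
  have := hS.base_ge
  unfold cellAddr
  omega

end Params

/-- What holds between the evaluations of color sums. -/
structure Ready (π : Params) (E : Finset ℕ) (δ : ℕ) (σ : State) : Prop where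
  loaded : π.Loaded σ
  edges : π.Edges E σ.mem
  fresh : ∃ δ' ≤ δ, σ.reg r_delta = δ' ∧ π.Fresh δ' σ.mem

theorem Ready.put {E : Finset ℕ} {δ : ℕ} (h : Ready π E δ σ) (hS : π.Fits S) {a v : ℕ}
    (ha : a < π.n) : Ready π E δ (σ.put a v) := by
  obtain ⟨h1, h2, δ', h3, h4, h5⟩ := h
  exact ⟨h1.put, h2.put hS ha, δ', h3, h4, h5.put hS ha⟩

theorem Ready.set {E : Finset ℕ} {δ : ℕ} (h : Ready π E δ σ) {r v : ℕ} (hr : 9 ≤ r := by decide)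
    (hr' : r_delta ≠ r := by decide) : Ready π E δ (σ.set r v) := by
  obtain ⟨h1, h2, δ', h3, h4, h5⟩ := h
  exact ⟨h1.set hr, h2, δ', h3, by rw [State.set_reg, if_neg hr', h4], h5⟩

theorem Ready.mono {E : Finset ℕ} {δ δ' : ℕ} (h : Ready π E δ σ) (hδ : δ ≤ δ') :
    Ready π E δ' σ := by
  obtain ⟨h1, h2, δ', h3, h4, h5⟩ := h
  exact ⟨h1, h2, δ', h3.trans hδ, h4, h5⟩

variable {E : Finset ℕ} {δ D W : ℕ}

/-- The colors are tried in increasing order. The search stops at the least color `a` that keeps the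
sum nonzero, hence after exactly `a + 1 ≤ k` evaluations. -/
theorem runs_vertex (hR : Ready π E δ σ) (hS : π.Fits S) (hk : 0 < π.k) {j : ℕ}
    (hcur : σ.reg r_cur = j) (hj : j < π.n) (hcol : ∀ y < j, σ.mem y < π.k)
    (hδ : δ + π.k * (3 * π.Z + 1) + 5 < 2 ^ S) (hN : π.Narrow E D W)
    (hne : π.partialSum E j σ.mem ≠ 0) :
    Runs S ω vertexProg σ (π.k * (π.evalCost ((D + 1) ^ W) + 100) + 50) fun τ =>
      Ready π E (δ + π.k * (3 * π.Z + 1)) τ ∧ (∀ y < j + 1, τ.mem y < π.k) ∧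
      π.partialSum E (j + 1) τ.mem ≠ 0 := by
  classical
  have h1 := hS.one_lt
  have hkn := hS.k_lt
  have hnS := hS.n_lt
  have hex := partialSum_succ hj hk hne
  set a := Nat.find hex with ha
  obtain ⟨hak, hane⟩ := Nat.find_spec hex
  have hmin : ∀ i < a, π.partialSum E (j + 1) (Function.update σ.mem j i) = 0 := by
    intro i hi
    by_contra h
    exact Nat.find_min hex hi ⟨hi.trans hak, h⟩
  rw [← ha] at hak hane
  refine Runs.mono_cost (Runs.seq (Runs.store (by simp) fun _ =>
    -- The last of the `a + 1` rounds finds a nonzero sum and leaves the color alone; hence `min i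
    -- a`.
    Runs.seq (Runs.assign (by simp) fun _ => Runs.loop (fun i τ =>
      Ready π E (δ + i * (3 * π.Z + 1)) τ ∧ τ.mem j = min i a ∧ (τ.reg r_res = 0 ↔ i ≤ a) ∧
      ∀ y < j, τ.mem y = σ.mem y) (a + 1) (π.evalCost ((D + 1) ^ W) + 50) ?_ ?_ ?_))) ?_
  · refine ⟨?_, ?_, by simp, ?_⟩
    · have := (hR.put hS hj (v := 0)).set (r := r_res) (v := 0)
      simpa [hcur] using this
    · simp [State.put_mem, hcur]
    · intro y hy
      simp [State.put_mem, hcur]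
      omega
  · rintro i hi τ hf ⟨hRτ, hmj, hres, hmem⟩
    have hia : i ≤ a := by omega
    have hcurτ : τ.reg r_cur = j := by rw [hf.reg _ (by decide)]; simp [hcur]
    have hr0 := hres.2 hia
    refine ⟨by simp [hr0], ?_⟩
    have hle : (i + 1) * (3 * π.Z + 1) ≤ π.k * (3 * π.Z + 1) := Nat.mul_le_mul_right _ (by omega)
    have hmji : τ.mem j = i := by rw [hmj]; omega
    have hcolτ : ∀ y ≤ j, τ.mem y < π.k := by
      intro y hy
      rcases hy.lt_or_eq with h | h
      · rw [hmem y h]; exact hcol y h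
      · rw [h, hmji]; omega
    obtain ⟨hLτ, hEτ, δ₁, hδ₁, hδ₁τ, hfr⟩ := hRτ
    rw [add_mul, one_mul] at hle
    refine Runs.mono_cost (Runs.bind (runs_eval hLτ hS hEτ hcurτ hj hcolτ hδ₁τ (by omega) hfr hN)
      fun ρ hρ hfρ => Runs.ifte (N₁ := 1) (N₂ := 20) (fun h0 => Runs.skip ?_) fun h0 => ?_) ?_
    all_goals try (
      obtain ⟨⟨δ₂, hδ₂ρ, hδ₂, hfr₂⟩, hsame, hlt, hval⟩ := hρ
      have hcurρ : ρ.reg r_cur = j := by rw [hfρ.reg _ (by decide)]; exact hcurτ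
      have hRρ : Ready π E (δ + (i + 1) * (3 * π.Z + 1)) ρ :=
        ⟨hLτ.frame hfρ, hsame.edges hEτ, δ₂, by rw [add_mul, one_mul]; omega, hδ₂ρ, hfr₂⟩
      have hv : (ρ.reg r_res : ZMod π.M)
          = π.partialSum E (j + 1) (Function.update σ.mem j i) := by
        rw [hval, colorList_eq]
        refine partialSum_congr (mem' := τ.mem) fun y hy => ?_
        by_cases hyj : y = j
        · rw [hyj, hmji, Function.update_self]
        · rw [Function.update_of_ne hyj, hmem y (by omega)]
      have hmemρ : ∀ y < j, ρ.mem y = σ.mem y := fun y hy => by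
        rw [hsame.vertex hS (by omega), hmem y hy]
      have hmjρ : ρ.mem j = i := by rw [hsame.vertex hS hj, hmji]
      simp only [Exp.eval_reg] at h0)
    · have hia' : i = a := by
        rcases hia.lt_or_eq with h | h
        · rw [hmin i h, ZMod.natCast_eq_zero_iff] at hv
          exact absurd (Nat.eq_zero_of_dvd_of_lt hv hlt) h0
        · exact h
      refine ⟨hRρ, by rw [hmjρ]; omega, ?_, hmemρ⟩
      constructor
      · intro h; exact absurd h h0
      · intro h; omega
    · have hia' : i < a := by
        rcases hia.lt_or_eq with h | h
        · exact h
        · rw [h0, Nat.cast_zero, h] at hv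
          exact absurd hv.symm hane
      refine Runs.mono_cost (Runs.store ?_ ⟨?_, ?_, ?_, ?_⟩) ?_
      · simp [hcurρ, hmjρ]; omega
      · simp only [Exp.eval_reg, hcurρ]
        exact hRρ.put hS hj
      · simp [hcurρ, State.put_mem, hmjρ]; omega
      · simp [h0]; omega
      · intro y hy
        simp [hcurρ, State.put_mem]
        rw [if_neg (by omega), hmemρ y hy]
      · simp
    · simp
  · rintro τ hf ⟨hRτ, hmj, hres, hmem⟩
    have hr0 : τ.reg r_res ≠ 0 := fun h => by have := hres.1 h; omega
    refine ⟨by simp; omega, hRτ.mono ?_, ?_, ?_⟩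
    · have := Nat.mul_le_mul_right (3 * π.Z + 1) (Nat.succ_le_of_lt hak)
      simp only [Nat.succ_eq_add_one] at this
      omega
    · intro y hy
      rcases (Nat.lt_succ_iff.1 hy).lt_or_eq with h | h
      · rw [hmem y h]; exact hcol y h
      · rw [h, hmj]; omega
    · rw [partialSum_congr (mem := Function.update σ.mem j a)]
      · exact hane
      · intro y hy
        by_cases hyj : y = j
        · rw [hyj, Function.update_self, hmj]; omega
        · rw [Function.update_of_ne hyj, hmem y (by omega)]
  · have := Nat.mul_le_mul_right (π.evalCost ((D + 1) ^ W) + 50 + 20) (Nat.succ_le_of_lt hak)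
    simp
    linarith

theorem runs_color (hL : π.Loaded σ) (hE : π.Edges E σ.mem) (hfr : π.Fresh 0 σ.mem)
    (hS : π.Fits S) (hk : 0 < π.k)
    (hδ : π.n * (π.k * (3 * π.Z + 1)) + 5 < 2 ^ S) (hN : π.Narrow E D W)
    (hne : colorSum π.fst π.snd E (trimmed π.fst π.snd E fun _ => range π.k)
      (fun x => π.digit x) ≠ 0) :
    Runs S ω colorProg σ (π.n * (π.k * (π.evalCost ((D + 1) ^ W) + 100) + 100) + 50) fun τ =>
      (∀ y < π.n, τ.mem y < π.k) ∧
      ∀ z ∈ E, τ.mem (z / π.n % π.n) ≠ τ.mem (z % π.n) := by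
  have hnS := hS.n_lt
  have h1 := hS.one_lt
  refine Runs.mono_cost (Runs.seq (Runs.assign (by simp) fun _ =>
    Runs.seq (Runs.assign (by simp) fun _ => Runs.loop (fun j τ =>
      Ready π E (j * (π.k * (3 * π.Z + 1))) τ ∧ τ.reg r_cur = j ∧
      (∀ y < j, τ.mem y < π.k) ∧ π.partialSum E j τ.mem ≠ 0) π.n
      (π.k * (π.evalCost ((D + 1) ^ W) + 100) + 60) ?_ ?_ ?_))) ?_
  · refine ⟨⟨hL.set.set, hE, 0, by omega, by simp, hfr⟩, by simp, fun y hy => by omega, ?_⟩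
    simpa [partialSum] using hne
  · rintro j hj τ hf ⟨hR, hcur, hcol, hsum⟩
    refine ⟨by simp [hR.loaded.n, hcur]; omega, ?_⟩
    have hle := Nat.mul_le_mul_right (π.k * (3 * π.Z + 1)) (Nat.succ_le_of_lt hj)
    rw [Nat.succ_mul] at hle
    refine Runs.mono_cost (Runs.bind (runs_vertex hR hS hk hcur hj hcol (by omega) hN hsum)
      fun ρ hρ hfρ => Runs.assign ?_ ⟨?_, ?_, hρ.2⟩) ?_
    · rw [Exp.eval_add, Exp.eval_reg, hfρ.reg _ (by decide), hcur]
      simp; omega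
    · rw [add_mul, one_mul]
      exact hρ.1.set
    · rw [State.set_reg, if_pos rfl, Exp.eval_add, Exp.eval_reg, hfρ.reg _ (by decide), hcur]
      simp
    · simp
  · rintro τ hf ⟨hR, hcur, hcol, hsum⟩
    refine ⟨by simp [hR.loaded.n, hcur], hcol, fun z hz => ?_⟩
    have hsum' : colorSum π.fst π.snd E (trimmed π.fst π.snd E fun x => {τ.mem x})
        (fun x => π.digit x) ≠ 0 := by
      unfold partialSum at hsum
      simpa only [Fin.is_lt, if_true] using hsum
    exact ne_of_colorSum_ne_zero (c := fun x => τ.mem x) hsum' hz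
  · have := Nat.mul_le_mul_left π.n
      (show π.k * (π.evalCost ((D + 1) ^ W) + 100) + 60 + 20 ≤
        π.k * (π.evalCost ((D + 1) ^ W) + 100) + 100 by omega)
    simp
    linarith

end RAM

/-! ### The edges, in the order of the bags -/

/-- The entries of a matrix that is written down row by row. -/
theorem getD_flatMap_finRange {a b : ℕ} (f : Fin a → Fin b → ℕ) (i : Fin a) (j : Fin b)
    (l : List ℕ) :
    ((List.finRange a).flatMap (fun i => (List.finRange b).map (f i)) ++ l).getD (i * b + j) 0
      = f i j := by
  have h1 : (List.finRange a).flatMap (fun i => (List.finRange b).map (f i))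
      = List.ofFn (fun q : Fin (a * b) => f q.divNat q.modNat) := by
    rw [List.ofFn_mul, List.flatMap, ← List.ofFn_eq_map]
    congr 2
    funext i
    rw [← List.ofFn_eq_map]
    congr 1
    funext j
    have hb : 0 < b := j.pos
    congr 1
    · ext
      simp [Fin.divNat, Nat.add_comm, Nat.add_mul_div_right _ _ hb]
    · ext
      simp [Fin.modNat, Nat.mod_eq_of_lt j.2]
  have hb : 0 < b := j.pos
  have hlt : (i * b + j : ℕ) < a * b := by
    have := Nat.mul_le_mul_right b (Nat.succ_le_of_lt i.2)
    rw [Nat.succ_mul] at this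
    omega
  rw [h1, List.getD_append _ _ _ _ (by simpa using hlt),
    List.getD_eq_getElem _ _ (by simpa using hlt), List.getElem_ofFn]
  congr 1
  · ext
    simp [Fin.divNat, Nat.add_comm, Nat.add_mul_div_right _ _ hb]
  · ext
    simp [Fin.modNat, Nat.mod_eq_of_lt j.2]

theorem length_flatMap_finRange {a b : ℕ} (f : Fin a → Fin b → ℕ) :
    ((List.finRange a).flatMap (fun i => (List.finRange b).map (f i))).length = a * b := by
  simp [List.length_flatMap]

namespace RAM

open Orient Finset

theorem mul_add_lt {n : ℕ} (x y : Fin n) : (x * n + y : ℕ) < n * n := by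
  have := Nat.mul_le_mul_right n (Nat.succ_le_of_lt x.2)
  rw [Nat.succ_mul] at this
  omega

theorem div_mul_self_lt {n p z : ℕ} (hz : z < p * n * n) : z / (n * n) < p :=
  Nat.div_lt_of_lt_mul (by rwa [mul_comm, ← mul_assoc])

variable {n p : ℕ}

/-- What is read from the input behind its first three cells. -/
structure IsInput (G : SimpleGraph (Fin n)) [DecidableRel G.Adj] (P : PathDecomposition G p)
    (mem : ℕ → ℕ) : Prop where
  adj : ∀ u v : Fin n, mem (3 + (u * n + v)) = if G.Adj u v then 1 else 0
  bag : ∀ (i : Fin p) (v : Fin n), mem (3 + n * n + (i * n + v)) = if v ∈ P.bag i then 1 else 0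
  zero : ∀ a, 3 + n * n + p * n ≤ a → mem a = 0

theorem isInput_initialState (k : ℕ) (G : SimpleGraph (Fin n)) [DecidableRel G.Adj]
    (P : PathDecomposition G p) : IsInput G P (initialState k G P).mem := by
  refine ⟨fun u v => ?_, fun i v => ?_, fun a ha => ?_⟩
  · simp only [initialState, inputWord, List.append_assoc]
    rw [List.getD_append_right _ _ _ _ (by simp)]
    simpa using getD_flatMap_finRange (fun u v => if G.Adj u v then 1 else 0) u v _
  · have hlen := length_flatMap_finRange (fun u v => if G.Adj u v then 1 else 0)
    simp only [initialState, inputWord]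
    rw [List.getD_append_right _ _ _ _ (by simp [hlen]; omega)]
    have := getD_flatMap_finRange (fun i v => if v ∈ P.bag i then 1 else 0) i v []
    rw [List.append_nil] at this
    rw [← this]
    congr 1
    simp only [List.length_append, hlen, List.length_cons, List.length_nil]
    omega
  · have hlen := length_flatMap_finRange (fun u v => if G.Adj u v then 1 else 0)
    have hlen' := length_flatMap_finRange (fun i v => if v ∈ P.bag i then 1 else 0)
    simp only [initialState, inputWord]
    rw [List.getD_eq_default]
    simp only [List.length_append, hlen, hlen']
    simpa using ha

variable [NeZero n]

section Edges

variable (n) in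
/-- The first end of the edge with number `z`. -/
def fstEnd (z : ℕ) : Fin n := Fin.ofNat n (z / n)

variable (n) in
/-- The second end of the edge with number `z`. -/
def sndEnd (z : ℕ) : Fin n := Fin.ofNat n z

theorem mod_mul_self (z : ℕ) : z % (n * n) = fstEnd n z * n + sndEnd n z := by
  have h := Nat.div_add_mod (z % (n * n)) n
  rw [Nat.mod_mul_left_mod, Nat.mod_mul_right_div_self, mul_comm] at h
  exact h.symm

theorem mod_mul_self_eq {z z' : ℕ} : z % (n * n) = z' % (n * n) ↔
    fstEnd n z = fstEnd n z' ∧ sndEnd n z = sndEnd n z' := by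
  constructor
  · intro h
    have h1 := congrArg (· % n) h
    have h2 := congrArg (· / n) h
    simp only [Nat.mod_mul_left_mod, Nat.mod_mul_right_div_self] at h1 h2
    exact ⟨Fin.ext h2, Fin.ext h1⟩
  · rintro ⟨h1, h2⟩
    rw [mod_mul_self, mod_mul_self, h1, h2]

variable (G : SimpleGraph (Fin n)) (P : PathDecomposition G p)

/-- The numbers that stand for a bag and the two ends of an edge in it, the smaller one first. -/
def IsTriple (z : ℕ) : Prop :=
  fstEnd n z < sndEnd n z ∧ G.Adj (fstEnd n z) (sndEnd n z) ∧
    ∃ i : Fin p, (i : ℕ) = z / (n * n) ∧ fstEnd n z ∈ P.bag i ∧ sndEnd n z ∈ P.bag i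

open Classical in
/-- The least numbers that stand for the edges. -/
noncomputable def edges : Finset ℕ :=
  {z ∈ range (p * n * n) | IsTriple G P z ∧
    ∀ z' < z, z' % (n * n) = z % (n * n) → ¬ IsTriple G P z'}

variable {G P}

theorem IsTriple.lt {z : ℕ} (h : IsTriple G P z) : z < p * n * n := by
  obtain ⟨-, -, i, hi, -⟩ := h
  have h1 : z / (n * n) < p := hi ▸ i.2
  have h2 := (Nat.div_lt_iff_lt_mul (Nat.mul_pos (NeZero.pos n) (NeZero.pos n))).1 h1
  rwa [← mul_assoc] at h2

theorem mem_edges {z : ℕ} : z ∈ edges G P ↔ IsTriple G P z ∧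
    ∀ z' < z, z' % (n * n) = z % (n * n) → ¬ IsTriple G P z' := by
  simp only [edges, mem_filter, mem_range]
  exact ⟨fun h => h.2, fun h => ⟨h.1.lt, h⟩⟩

/-- The residue modulo `n * n` encodes the ordered pair of ends, the quotient the bag; minimality
selects one bag for each pair. -/
theorem edges_injOn : Set.InjOn (· % (n * n)) (edges G P : Set ℕ) := by
  intro z hz z' hz' h
  have h1 := mem_edges.1 hz
  have h2 := mem_edges.1 hz'
  rcases lt_trichotomy z z' with hlt | heq | hlt
  · exact absurd h1.1 (h2.2 z hlt h)
  · exact heq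
  · exact absurd h2.1 (h1.2 z' hlt h.symm)

theorem card_edges_le : #(edges G P) ≤ n * n := by
  have := card_le_card_of_injOn (t := range (n * n)) (· % (n * n))
    (fun z _ => mem_coe.2 (mem_range.2 (Nat.mod_lt z (Nat.mul_pos (NeZero.pos n) (NeZero.pos n))))) (edges_injOn (G := G) (P := P))
  simpa using this

theorem exists_edge_of_lt {x y : Fin n} (hxy : x < y) (h : G.Adj x y) :
    ∃ z ∈ edges G P, fstEnd n z = x ∧ sndEnd n z = y := by
  classical
  obtain ⟨i, hx, hy⟩ := P.exists_bag_of_adj x y h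
  have hlt := mul_add_lt x y
  -- The number of the edge in the bag `i`; the number sought is the least triple with the same
  -- residue.
  set z₀ := (x * n + y : ℕ) + n * n * i with hz₀
  have h1 : fstEnd n z₀ = x := by
    ext
    have : z₀ = y + n * (x + n * i) := by rw [hz₀]; ring
    change z₀ / n % n = x
    rw [this, Nat.add_mul_div_left _ _ (NeZero.pos n), Nat.div_eq_of_lt y.2, zero_add,
      Nat.add_mul_mod_self_left, Nat.mod_eq_of_lt x.2]
  have h2 : sndEnd n z₀ = y := by
    ext
    have : z₀ = y + n * (x + n * i) := by rw [hz₀]; ring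
    change z₀ % n = y
    rw [this, Nat.add_mul_mod_self_left, Nat.mod_eq_of_lt y.2]
  have h3 : z₀ / (n * n) = i := by
    rw [hz₀, Nat.add_mul_div_left _ _ (Nat.mul_pos (NeZero.pos n) (NeZero.pos n)),
      Nat.div_eq_of_lt hlt, zero_add]
  have hex : ∃ z, IsTriple G P z ∧ z % (n * n) = z₀ % (n * n) :=
    ⟨z₀, ⟨by rwa [h1, h2], by rwa [h1, h2], i, h3.symm, by rwa [h1], by rwa [h2]⟩, rfl⟩
  have hfind := Nat.find_spec hex
  refine ⟨Nat.find hex, mem_edges.2 ⟨hfind.1, fun z' hz' he ht => ?_⟩, ?_⟩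
  · exact Nat.find_min hex hz' ⟨ht, he.trans hfind.2⟩
  · have := mod_mul_self_eq.1 hfind.2
    rwa [h1, h2] at this

/-- Sending an edge at `x` to its other end is injective into the neighbors: the smaller end always
comes first, so the same edge cannot appear in both directions. -/
theorem inc_edges_le [DecidableRel G.Adj] (x : Fin n) :
    inc (fstEnd n) (sndEnd n) (edges G P) x ≤ G.degree x := by
  unfold inc
  rw [← G.card_neighborFinset_eq_degree]
  refine card_le_card_of_injOn
    (fun z => if fstEnd n z = x then sndEnd n z else fstEnd n z) ?_ ?_
  · intro z hz
    simp only [coe_filter, Set.mem_ofPred_eq] at hz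
    obtain ⟨⟨hlt, hadj, -⟩, -⟩ := mem_edges.1 hz.1
    simp only [mem_coe, SimpleGraph.mem_neighborFinset]
    split_ifs with h
    · rwa [h] at hadj
    · rw [hz.2.resolve_left h] at hadj
      exact hadj.symm
  · intro z hz z' hz' h
    simp only [coe_filter, Set.mem_ofPred_eq] at hz hz' h
    obtain ⟨⟨hlt, -⟩, -⟩ := mem_edges.1 hz.1
    obtain ⟨⟨hlt', -⟩, -⟩ := mem_edges.1 hz'.1
    refine edges_injOn (G := G) (P := P) hz.1 hz'.1 (mod_mul_self_eq.2 ?_)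
    have hz2 := hz.2
    have hz2' := hz'.2
    split_ifs at h with h1 h2 h2
    · exact ⟨h1.trans h2.symm, h⟩
    · have := hz2'.resolve_left h2
      rw [h1, h] at hlt
      rw [this] at hlt'
      exact absurd hlt (not_lt.2 hlt'.le)
    · have := hz2.resolve_left h1
      rw [this, h] at hlt
      rw [h2] at hlt'
      exact absurd hlt (not_lt.2 hlt'.le)
    · exact ⟨h, (hz2.resolve_left h1).trans (hz2'.resolve_left h2).symm⟩

/-- A vertex that may have a nonzero state has an edge processed by now and one still to come. The
bags of these two edges lie on either side of the current bag, so the interval property puts the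
vertex into the current bag. The edge `z` itself may count as processed or not. -/
theorem cap_eq_zero {F : Finset ℕ} {z : ℕ}
    (hF : F = before (edges G P) z ∨ F = before (edges G P) (z + 1)) :
    ∀ i : Fin p, (i : ℕ) = z / (n * n) → ∀ x ∉ P.bag i,
      cap (fstEnd n) (sndEnd n) (edges G P) F x = 0 := by
  intro i hi x hx
  by_contra hne
  have hFE : F ⊆ edges G P := by
    rcases hF with rfl | rfl <;> exact filter_subset _ _
  obtain ⟨h1, h2⟩ := pos_of_cap_pos hFE (Nat.pos_of_ne_zero hne)
  have hmem : ∀ z ∈ edges G P, fstEnd n z = x ∨ sndEnd n z = x →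
      ∃ i : Fin p, (i : ℕ) = z / (n * n) ∧ x ∈ P.bag i := by
    intro z hz hx
    obtain ⟨⟨-, -, i, hi, hb1, hb2⟩, -⟩ := mem_edges.1 hz
    rcases hx with rfl | rfl
    exacts [⟨i, hi, hb1⟩, ⟨i, hi, hb2⟩]
  have hle : ∀ z' ∈ F, z' ≤ z := by
    intro z' hz'
    rcases hF with rfl | rfl <;> have := (mem_filter.1 hz').2 <;> omega
  have hge : ∀ z' ∈ edges G P, z' ∉ F → z ≤ z' := by
    intro z' hz' hn
    by_contra hlt
    rcases hF with rfl | rfl <;> exact hn (mem_filter.2 ⟨hz', by omega⟩)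
  obtain ⟨z₁, hz₁⟩ := card_pos.1 h1
  rw [mem_filter] at hz₁
  obtain ⟨z₂, hz₂, hz₂'⟩ := exists_mem_notMem_of_card_lt_card h2
  rw [mem_filter] at hz₂
  obtain ⟨i₁, hi₁, hx₁⟩ := hmem z₁ (hFE hz₁.1) hz₁.2
  obtain ⟨i₂, hi₂, hx₂⟩ := hmem z₂ hz₂.1 hz₂.2
  refine hx (P.mem_bag_of_le x i₁ i i₂ ?_ ?_ hx₁ hx₂)
  · rw [Fin.le_def, hi₁, hi]
    exact Nat.div_le_div_right (hle z₁ hz₁.1)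
  · rw [Fin.le_def, hi₂, hi]
    refine Nat.div_le_div_right (hge z₂ hz₂.1 fun h => hz₂' (mem_filter.2 ⟨h, hz₂.2⟩))

end Edges

/-! ### Marking the edges in the memory -/

section Mark

open Classical

variable {S : ℕ} {ω : ℕ → Bool} {σ : State} {G : SimpleGraph (Fin n)} [DecidableRel G.Adj]
  {P : PathDecomposition G p}

/-- Once a triple is marked, the entry of its pair in the adjacency matrix is cleared; so the
surviving ones of the matrix record which pairs have had no triple yet, and only the least triple of
each edge is marked. -/
theorem runs_mark {base : ℕ} (hin : IsInput G P σ.mem) (hn : σ.reg r_n = n)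
    (hZ : σ.reg r_Z = p * n * n) (hb : σ.reg r_base = base) (hbase : base = 3 + n * n + p * n)
    (hS : p * n * n + 1 < 2 ^ S) :
    Runs S ω markProg σ (p * n * n * 500 + 100) fun τ =>
      (∀ z < p * n * n, τ.mem (cellAddr base 4 z) = if z ∈ edges G P then 1 else 0) ∧
      ∀ a, base ≤ a → (∀ z, a ≠ cellAddr base 4 z) → τ.mem a = 0 := by
  refine Runs.mono_cost (Runs.seq (Runs.assign (by simp) fun _ => Runs.loop (fun i τ =>
    τ.reg r_z = i ∧
    (∀ u v : Fin n, τ.mem (3 + (u * n + v)) =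
      if G.Adj u v ∧ ∀ z < i, z % (n * n) = u * n + v → ¬ IsTriple G P z then 1 else 0) ∧
    (∀ z < p * n * n, τ.mem (cellAddr base 4 z) = if z ∈ edges G P ∧ z < i then 1 else 0) ∧
    ∀ a, 3 + n * n ≤ a → (∀ z, a ≠ cellAddr base 4 z) → τ.mem a = σ.mem a)
    (p * n * n) 420 ?_ ?_ ?_)) ?_
  · refine ⟨by simp, fun u v => ?_, fun z hz => ?_, fun a _ _ => by simp⟩
    · simp [hin.adj]
    · simp only [State.set_mem, Nat.not_lt_zero, and_false, if_false]
      exact hin.zero _ (by unfold cellAddr; omega)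
  · rintro i hi τ hf ⟨hz, hadj, hmark, hrest⟩
    have hnτ : τ.reg r_n = n := by rw [hf.reg _ (by decide)]; simp [hn]
    have hbτ : τ.reg r_base = base := by rw [hf.reg _ (by decide)]; simp [hb]
    have hZτ : τ.reg r_Z = p * n * n := by rw [hf.reg _ (by decide)]; simp [hZ]
    refine ⟨by simp [hZτ, hz]; omega, ?_⟩
    set u := fstEnd n i with hu
    set v := sndEnd n i with hv
    have hmod := mod_mul_self (n := n) i
    rw [← hu, ← hv] at hmod
    set j : Fin p := ⟨i / (n * n), div_mul_self_lt hi⟩ with hj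
    have hbag : ∀ w : Fin n, τ.mem (3 + n * n + (i / (n * n) * n + w))
        = if w ∈ P.bag j then 1 else 0 := by
      intro w
      rw [hrest _ (by omega), ← hin.bag j w]
      intro z
      have h1 : (i / (n * n) + 1) * n ≤ p * n := Nat.mul_le_mul_right _ j.2
      have h2 := w.2
      rw [add_mul] at h1
      unfold cellAddr
      omega
    have htriple : IsTriple G P i ↔ u < v ∧ G.Adj u v ∧ u ∈ P.bag j ∧ v ∈ P.bag j := by
      unfold IsTriple
      rw [← hu, ← hv]
      constructor
      · rintro ⟨h1, h2, i', hi', h3, h4⟩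
        have : i' = j := Fin.ext hi'
        rw [← this]
        exact ⟨h1, h2, h3, h4⟩
      · rintro ⟨h1, h2, h3, h4⟩
        exact ⟨h1, h2, j, rfl, h3, h4⟩
    -- The truncated difference is nonzero exactly if `u < v`, so the product is the conjunction of
    -- all conditions.
    have htest : ((v - u : ℕ) * τ.mem (3 + (u * n + v)) * (τ.mem (3 + n * n + (i / (n * n) * n + u))
        * τ.mem (3 + n * n + (i / (n * n) * n + v))) ≠ 0) ↔ i ∈ edges G P := by
      rw [mem_edges, htriple, hbag, hbag, hadj, hmod]
      have : (v - u : ℕ) ≠ 0 ↔ u < v := by rw [Fin.lt_def]; omega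
      simp only [mul_ne_zero_iff, this, ne_eq, ite_eq_right_iff, one_ne_zero, imp_false, not_not]
      tauto
    have huv : (u : ℕ) = i / n % n := rfl
    have hvv : (v : ℕ) = i % n := rfl
    have hnext : ∀ u' v' : Fin n,
        (∀ z < i + 1, z % (n * n) = u' * n + v' → ¬ IsTriple G P z) ↔
        (∀ z < i, z % (n * n) = u' * n + v' → ¬ IsTriple G P z) ∧
          (i % (n * n) = u' * n + v' → ¬ IsTriple G P i) := by
      intro u' v'
      simp only [Nat.lt_succ_iff_lt_or_eq]
      constructor
      · exact fun h => ⟨fun z hz => h z (.inl hz), h i (.inr rfl)⟩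
      · rintro ⟨h1, h2⟩ z (hz | rfl)
        exacts [h1 z hz, h2]
    have hlt := mul_add_lt u v
    refine Runs.mono_cost (Runs.bind (Q' := fun ρ =>
      (∀ u v : Fin n, ρ.mem (3 + (u * n + v)) =
        if G.Adj u v ∧ ∀ z < i + 1, z % (n * n) = u * n + v → ¬ IsTriple G P z then 1 else 0) ∧
      (∀ z < p * n * n, ρ.mem (cellAddr base 4 z)
        = if z ∈ edges G P ∧ z < i + 1 then 1 else 0) ∧
      ∀ a, 3 + n * n ≤ a → (∀ z, a ≠ cellAddr base 4 z) → ρ.mem a = σ.mem a)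
      (Runs.ifte (N₁ := 120) (N₂ := 1) (fun h => ?_) fun h => Runs.skip ?_)
      fun ρ hρ hfρ => Runs.assign ?_ ⟨?_, hρ⟩) ?_
    · simp only [Exp.eval_mul, Exp.eval_sub, Exp.eval_mod, Exp.eval_div, Exp.eval_reg,
        Exp.eval_cell, Exp.eval_add, Exp.eval_ofNat, hz, hnτ, ← huv, ← hvv, hmod] at h
      have hmem := htest.1 h
      refine Runs.mono_cost (Runs.seq (Runs.store (lt_of_le_of_lt (by simp) hS) fun _ =>
        Runs.store (by simp) ⟨?_, ?_, ?_⟩)) (by simp [addr])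
      all_goals simp only [Exp.eval_add, Exp.eval_ofNat, Exp.eval_mod, Exp.eval_mul, Exp.eval_reg,
        State.put_reg, hz, hnτ, eval_addr, hbτ, hmod, State.put_mem]
      · intro u' v'
        have hlt' := mul_add_lt u' v'
        rw [if_neg (show ¬ 3 + (u' * n + v' : ℕ) = cellAddr base 4 i by unfold cellAddr; omega),
          hadj]
        simp only [hnext]
        by_cases he : (u' * n + v' : ℕ) = u * n + v
        · rw [if_pos (by omega), if_neg]
          exact fun h => h.2.2 (hmod.trans he.symm) (mem_edges.1 hmem).1
        · rw [if_neg (by omega)]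
          refine if_congr ?_ rfl rfl
          have : i % (n * n) = u' * n + v' → ¬ IsTriple G P i := fun h => absurd h (by omega)
          tauto
      · intro z hz'
        rw [if_neg (by unfold cellAddr; omega), hmark z hz']
        by_cases he : z = i
        · simp [he, hmem]
        · rw [if_neg (by rw [cellAddr_inj (by decide) (by decide)]; tauto)]
          exact if_congr (and_congr_right fun _ => by omega) rfl rfl
      · intro a ha h'
        rw [if_neg (by omega), if_neg (h' i), hrest a ha h']
    · simp only [Exp.eval_mul, Exp.eval_sub, Exp.eval_mod, Exp.eval_div, Exp.eval_reg,
        Exp.eval_cell, Exp.eval_add, Exp.eval_ofNat, hz, hnτ, ← huv, ← hvv, hmod] at h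
      have hmem : i ∉ edges G P := fun h' => htest.2 h' h
      refine ⟨fun u' v' => ?_, fun z hz' => ?_, hrest⟩
      · rw [hadj]
        simp only [hnext]
        refine if_congr (and_congr_right fun _ => ⟨fun h1 => ⟨h1, fun he ht => ?_⟩, And.left⟩)
          rfl rfl
        exact hmem (mem_edges.2 ⟨ht, fun z' hz' he' => h1 z' hz' (he'.trans he)⟩)
      · rw [hmark z hz']
        refine if_congr (and_congr_right fun h' => ?_) rfl rfl
        have : z ≠ i := fun h2 => hmem (h2 ▸ h')
        omega
    · rw [Exp.eval_add, Exp.eval_reg, hfρ.reg _ (by decide), hz]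
      simp; omega
    · rw [State.set_reg, if_pos rfl, Exp.eval_add, Exp.eval_reg, hfρ.reg _ (by decide), hz]
      simp
    · simp
  · rintro τ hf ⟨hz, -, hmark, hrest⟩
    have hZτ : τ.reg r_Z = p * n * n := by rw [hf.reg _ (by decide)]; simp [hZ]
    refine ⟨by simp [hZτ, hz], fun z hz => ?_, fun a ha h => ?_⟩
    · rw [hmark z hz]
      simp [hz]
    · rw [hrest a (by omega) h, hin.zero a (by omega)]
  · simp
    omega

end Mark

end RAM

/-! ### The random number and the preparations -/

namespace RAM

open Orient Finset

/-- The number with the given binary digits, the highest one first. -/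
def bitsNum (ω : ℕ → Bool) : ℕ → ℕ
  | 0 => 0
  | i + 1 => 2 * bitsNum ω i + (ω i).toNat

theorem bitsNum_lt (ω : ℕ → Bool) (i : ℕ) : bitsNum ω i < 2 ^ i := by
  induction i with
  | zero => simp [bitsNum]
  | succ i ih =>
    have := Bool.toNat_le (ω i)
    rw [bitsNum, pow_succ]
    omega

variable {S : ℕ} {ω : ℕ → Bool} {σ : State}

theorem runs_random {n : ℕ} (hn : σ.reg r_n = n) (hc : σ.coins = 0) (hS : 2 ^ (2 * n * n) < 2 ^ S) :
    Runs S ω randomProg σ (2 * n * n * 60 + 50) fun τ => τ.reg r_R = bitsNum ω (2 * n * n) := by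
  have h1 : 1 < 2 ^ S := lt_of_le_of_lt (Nat.one_le_two_pow) hS
  have h0 : 1 ≤ S := by
    by_contra h
    obtain rfl : S = 0 := by omega
    simp at h1
  refine Runs.mono_cost (Runs.seq (Runs.assign (by simp) fun _ => Runs.seq (Runs.assign (by simp)
    fun _ => Runs.loop (fun i τ => τ.reg r_R = bitsNum ω i ∧ τ.reg r_i = i ∧ τ.coins = i)
    (2 * n * n) 30 ?_ ?_ ?_))) ?_
  · simp [bitsNum, hc]
  · rintro i hi τ hf ⟨hR, hir, hco⟩
    have hnτ : τ.reg r_n = n := by rw [hf.reg _ (by decide)]; simp [hn]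
    refine ⟨by simp [hnτ, hir]; omega, Runs.mono_cost (Runs.seq (Runs.flip h0 fun _ =>
      Runs.seq (Runs.assign ?_ fun _ => Runs.assign ?_ ⟨?_, ?_, ?_⟩))) (by simp)⟩
    · simp only [Exp.eval_add, Exp.eval_mul, Exp.eval_ofNat, Exp.eval_reg, State.toss_reg]
      simp only [if_true, hR, hco]
      refine lt_of_lt_of_le (bitsNum_lt ω (i + 1)) ((Nat.pow_le_pow_right two_pos hi).trans hS.le)
    · have : 2 * n * n < 2 ^ (2 * n * n) := Nat.lt_two_pow_self
      simp [hir]; omega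
    · simp [hR, hco, bitsNum]
    · simp [hir]
    · simp [hco]
  · rintro τ hf ⟨hR, hir, hco⟩
    have hnτ : τ.reg r_n = n := by rw [hf.reg _ (by decide)]; simp [hn]
    exact ⟨by simp [hnτ, hir], hR⟩
  · simp
    omega

theorem runs_identity {n : ℕ} (hn : σ.reg r_n = n) (hS : n + 1 < 2 ^ S) :
    Runs S ω identityProg σ (n * 30 + 30) fun τ => ∀ y < n, τ.mem y = y := by
  refine Runs.mono_cost (Runs.seq (Runs.assign (by simp) fun _ => Runs.loop (fun i τ =>
    τ.reg r_i = i ∧ ∀ y < i, τ.mem y = y) n 15 ?_ ?_ ?_)) ?_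
  · simp
  · rintro i hi τ hf ⟨hir, hy⟩
    have hnτ : τ.reg r_n = n := by rw [hf.reg _ (by decide)]; simp [hn]
    refine ⟨by simp [hnτ, hir]; omega, Runs.mono_cost (Runs.seq (Runs.store ?_ fun _ =>
      Runs.assign ?_ ⟨?_, fun y hy' => ?_⟩)) (by simp)⟩
    · simp [hir]; omega
    · simp [hir]; omega
    · simp [hir]
    · simp only [State.set_mem, State.put_mem, Exp.eval_reg, hir]
      split_ifs with h
      · exact h.symm
      · exact hy y (by omega)
  · rintro τ hf ⟨hir, hy⟩
    have hnτ : τ.reg r_n = n := by rw [hf.reg _ (by decide)]; simp [hn]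
    exact ⟨by simp [hnτ, hir], hy⟩
  · simp; omega

/-- The parameters of the program for a graph with `n` vertices, `k` colors and `p` bags. -/
def params (n k p : ℕ) [NeZero n] (ω : ℕ → Bool) : Params where
  n := n
  k := k
  Z := p * n * n
  base := 3 + n * n + p * n
  B := 4 ^ n
  K := (4 ^ n) ^ n
  M := (4 ^ n) ^ (4 * n * n)
  R := bitsNum ω (2 * n * n)

/-- A bound for the binary lengths of the numbers that occur. -/
def lengthBound (n k p : ℕ) : ℕ := 50 * (n + p + 1) ^ 3 + Nat.size k

theorem size_facts (n p : ℕ) : n * n ≤ (n + p + 1) ^ 3 ∧ n * n * n ≤ (n + p + 1) ^ 3 ∧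
    p * n * n ≤ (n + p + 1) ^ 3 ∧ n + p + 1 ≤ (n + p + 1) ^ 3 := by
  have h1 : n ≤ n + p + 1 := by omega
  have h2 : p ≤ n + p + 1 := by omega
  have h3 : 1 ≤ n + p + 1 := by omega
  refine ⟨?_, ?_, ?_, Nat.le_self_pow (by decide) _⟩
  · calc n * n = 1 * n * n := by ring
      _ ≤ (n + p + 1) * (n + p + 1) * (n + p + 1) := by gcongr
      _ = _ := by ring
  · calc n * n * n ≤ (n + p + 1) * (n + p + 1) * (n + p + 1) := by gcongr
      _ = _ := by ring
  · calc p * n * n ≤ (n + p + 1) * (n + p + 1) * (n + p + 1) := by gcongr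
      _ = _ := by ring

theorem two_pow_lt_length {n k p e : ℕ} (h : e < 50 * (n + p + 1) ^ 3) :
    2 ^ e < 2 ^ lengthBound n k p :=
  Nat.pow_lt_pow_right one_lt_two (by unfold lengthBound; omega)

theorem lt_length {n k p e : ℕ} (h : e < 50 * (n + p + 1) ^ 3) : e < 2 ^ lengthBound n k p :=
  Nat.lt_two_pow_self.trans (two_pow_lt_length h)

/-- The modulus `M = 2 ^ (8 * n ^ 3)` is what makes a cubic number of bits necessary here. -/
theorem fits_params {n k p : ℕ} [NeZero n] (hk : k < n) (ω : ℕ → Bool) :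
    (params n k p ω).Fits (lengthBound n k p) := by
  obtain ⟨h2, h3, h4, h5⟩ := size_facts n p
  have hn : 0 < n := by omega
  have h4n : 4 ^ n = 2 ^ (2 * n) := by rw [pow_mul]; norm_num
  refine ⟨hk, ?_, rfl, ?_, ?_, ?_, ?_, ?_, ?_, ?_⟩
  · exact Nat.lt_pow_self (by norm_num)
  · refine Nat.one_lt_pow (by positivity) (Nat.one_lt_pow hn.ne' (by norm_num))
  · change n ≤ 3 + n * n + p * n
    have := Nat.le_mul_self n
    omega
  · change (4 ^ n) ^ n < _
    rw [h4n, ← pow_mul]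
    refine two_pow_lt_length ?_
    rw [mul_assoc]
    omega
  · change (4 ^ n) ^ (4 * n * n) < _
    rw [h4n, ← pow_mul]
    refine two_pow_lt_length ?_
    rw [show 2 * n * (4 * n * n) = 8 * (n * n * n) by ring]
    omega
  · refine lt_length ?_
    change p * n * n + 1 < _
    omega
  · change n ^ (2 * n) < _
    refine lt_of_le_of_lt (Nat.pow_le_pow_left (Nat.lt_two_pow_self (n := n)).le _) ?_
    rw [← pow_mul]
    refine two_pow_lt_length ?_
    rw [show n * (2 * n) = 2 * (n * n) by ring]
    omega
  · refine lt_length ?_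
    change 2 * n + 1 < _
    omega

/-- The left side bounds the numbers of all dictionaries ever used: at most `k` evaluations for each
of the `n` vertices. -/
theorem dictionaries_lt {n k p : ℕ} (hk : k < n) :
    n * (k * (3 * (p * n * n) + 1)) + 5 < 2 ^ lengthBound n k p := by
  obtain ⟨-, -, h4, h5⟩ := size_facts n p
  set q := n + p + 1 with hq
  have h1 : q ≤ 2 ^ q := Nat.lt_two_pow_self.le
  have h0 : 1 ≤ q := by omega
  have h6 : 1 ≤ q ^ 3 := Nat.one_le_pow _ _ h0
  have h7 : 1 ≤ q ^ 5 := Nat.one_le_pow _ _ h0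
  calc n * (k * (3 * (p * n * n) + 1)) + 5
      ≤ q * (q * (3 * q ^ 3 + 1 * q ^ 3)) + 5 * q ^ 5 := by gcongr <;> omega
    _ = 9 * q ^ 5 := by ring
    _ ≤ 2 ^ 4 * (2 ^ q) ^ 5 := by gcongr; norm_num
    _ = 2 ^ (4 + q * 5) := by rw [pow_add 2 4, pow_mul 2 q]
    _ < _ := two_pow_lt_length (by rw [← hq]; omega)

theorem bounded_initialState {n k p : ℕ} {G : SimpleGraph (Fin n)} [DecidableRel G.Adj]
    {P : PathDecomposition G p} : Bounded (lengthBound n k p) (initialState k G P) := by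
  obtain ⟨-, -, -, h5⟩ := size_facts n p
  have h1 : ∀ e < 50 * (n + p + 1) ^ 3, e < 2 ^ lengthBound n k p := fun e he => lt_length he
  have hk : k < 2 ^ lengthBound n k p :=
    (Nat.lt_size_self k).trans_le (Nat.pow_le_pow_right two_pos (Nat.le_add_left _ _))
  have hall : ∀ x ∈ inputWord k G P, x < 2 ^ lengthBound n k p := by
    intro x hx
    simp only [inputWord, List.mem_append, List.mem_cons, List.mem_flatMap, List.mem_map,
      List.not_mem_nil, or_false] at hx
    have h01 : ∀ q : Prop, ∀ _ : Decidable q, (if q then 1 else 0) < 2 ^ lengthBound n k p := by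
      intro q _
      split_ifs
      exacts [h1 1 (by omega), h1 0 (by omega)]
    rcases hx with ((rfl | rfl | rfl) | ⟨u, -, v, -, rfl⟩) | ⟨i, -, v, -, rfl⟩
    exacts [h1 _ (by omega), hk, h1 _ (by omega), h01 _ _, h01 _ _]
  refine ⟨fun r => h1 0 (by omega), fun i => ?_⟩
  change (inputWord k G P).getD i 0 < _
  by_cases hi : i < (inputWord k G P).length
  · rw [List.getD_eq_getElem _ _ hi]
    exact hall _ (List.getElem_mem hi)
  · rw [List.getD_eq_default _ _ (not_lt.1 hi)]
    exact h1 0 (by omega)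

variable {n k p : ℕ} [NeZero n] {G : SimpleGraph (Fin n)} {P : PathDecomposition G p}

theorem holdsColoring_of_edges {τ : State} (h : ∀ y < n, τ.mem y < k)
    (hE : ∀ z ∈ edges G P, τ.mem (fstEnd n z) ≠ τ.mem (sndEnd n z)) : HoldsColoring k G τ := by
  have key : ∀ u v : Fin n, u < v → G.Adj u v → τ.mem u ≠ τ.mem v := by
    intro u v huv hadj
    obtain ⟨z, hz, rfl, rfl⟩ := exists_edge_of_lt (P := P) huv hadj
    exact hE z hz
  refine ⟨SimpleGraph.Coloring.mk (fun v => ⟨τ.mem v, h v v.2⟩) ?_, fun v => rfl⟩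
  intro u v hadj he
  have he' : τ.mem u = τ.mem v := congrArg Fin.val he
  rcases lt_or_gt_of_ne hadj.ne with hlt | hlt
  exacts [key u v hlt hadj he', key v u hlt hadj.symm he'.symm]

variable [DecidableRel G.Adj]

/-- The small set is the bag in which the edge is processed. Adding one to the width undoes its
truncated subtraction also if all bags are empty. -/
theorem narrow_edges : (params n k p ω).Narrow (edges G P) (G.maxDegree / 2) (P.width + 1) := by
  refine ⟨fun x => Nat.div_le_div_right ((inc_edges_le (G := G) x).trans (G.degree_le_maxDegree x)),
    fun z hz => ?_⟩
  obtain ⟨-, -, i, hi, -⟩ := (mem_edges.1 hz).1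
  refine ⟨P.bag i, ?_, fun x hx => ⟨cap_eq_zero (.inl rfl) i hi x hx,
    cap_eq_zero (.inr rfl) i hi x hx⟩⟩
  have : #(P.bag i) ≤ univ.sup fun i => #(P.bag i) :=
    Finset.le_sup (f := fun i => #(P.bag i)) (mem_univ i)
  refine this.trans ?_
  unfold PathDecomposition.width
  omega

/-- The cost of the algorithm, up to the binary lengths of the numbers that occur. -/
def costBound (n k p m : ℕ) : ℕ :=
  n * (k * ((p * n * n) * (4 * (700 * (p * n * n) + 20 * n
    + m * (n * (n * (60 * n + 200) + 2000) + 700) + 200) + 600) + 1100) + 100)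
    + p * n * n * 500 + 300 * n * n + 1000

/-- The colors overwrite the beginning of the input, which is harmless: by then the numbers are in
registers and the edges are marked behind the input. -/
theorem runs_main (hin : IsInput G P σ.mem) (hn : σ.reg r_n = n) (hk : σ.reg r_k = k)
    (hp : σ.reg r_p = p) (hc : σ.coins = 0) (hk0 : 0 < k) (hkn : k < n)
    (hne : colorSum (fstEnd n) (sndEnd n) (edges G P)
      (trimmed (fstEnd n) (sndEnd n) (edges G P) fun _ => range k)
      (fun x => (params n k p ω).digit x) ≠ 0) :
    Runs (lengthBound n k p) ω mainProg σ
      (costBound n k p ((G.maxDegree / 2 + 1) ^ (P.width + 1))) fun τ =>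
      (∀ y < n, τ.mem y < k) ∧
      ∀ z ∈ edges G P, τ.mem (fstEnd n z) ≠ τ.mem (sndEnd n z) := by
  have hS := fits_params (p := p) hkn ω
  have h1 := hS.one_lt
  obtain ⟨hs2, hs3, hs4, hs5⟩ := size_facts n p
  have h4n : 4 * n * n = 4 * (n * n) := mul_assoc _ _ _
  have h2n : 2 * n * n = 2 * (n * n) := mul_assoc _ _ _
  have hpn : p * n ≤ p * n * n := Nat.le_mul_of_pos_right _ (NeZero.pos n)
  refine Runs.mono_cost (Runs.seq (Runs.assign ?_ fun _ => Runs.seq (Runs.assign ?_ fun _ =>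
    Runs.bind (runs_mark (base := 3 + n * n + p * n) (G := G) (P := P) ?_ ?_ ?_ ?_ rfl ?_) fun σ₁ h₁ hf₁ =>
    Runs.seq (Runs.assign ?_ fun _ =>
    Runs.bind (runs_pow (m := n) (by decide) (by decide) (by decide) ?_ h1 ?_ ?_) fun σ₂ h₂ hf₂ =>
    Runs.bind (runs_pow (m := n) (by decide) (by decide) (by decide) ?_ h1 ?_ ?_) fun σ₃ h₃ hf₃ =>
    Runs.bind (runs_pow (m := 4 * n * n) (by decide) (by decide) (by decide) ?_ h1 ?_ ?_)
      fun σ₄ h₄ hf₄ =>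
    Runs.bind (runs_random (n := n) ?_ ?_ ?_) fun σ₅ h₅ hf₅ =>
    (runs_color (π := params n k p ω) (E := edges G P) ?_ ?_ ?_ hS hk0 ?_ narrow_edges hne).mono
      le_rfl fun τ hτ => hτ)))) ?_
  · simp only [Exp.eval_mul, Exp.eval_reg, hn, hp]
    exact lt_length (by omega)
  · simp only [Exp.eval_mul, Exp.eval_add, Exp.eval_ofNat, Exp.eval_reg, State.set_reg]
    simp only [hn, hp, OfNat.zero_ne_ofNat, Nat.reduceEqDiff, if_false]
    exact lt_length (by omega)
  · exact hin
  · simp [hn]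
  · simp [hn, hp]
  · simp [hn, hp]
  · exact hS.Z_lt
  · exact lt_length (by simp; omega)
  · simp [hf₁.reg r_n (by decide), hn]
  · exact lt_length (by omega)
  · have : (4 ^ n) ^ 1 < _ := hS.B_pow_lt (i := 1) (NeZero.pos n)
    simpa using this
  · simp [hf₂.reg r_n (by decide), hf₁.reg r_n (by decide), hn]
  · exact lt_length (by omega)
  · rw [h₂]
    have : (4 ^ n) ^ n < _ := hS.K_lt
    simpa using this
  · simp [hf₃.reg r_n (by decide), hf₂.reg r_n (by decide), hf₁.reg r_n (by decide), hn]
  · exact lt_length (by omega)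
  · rw [hf₃.reg r_B (by decide), h₂]
    have : (4 ^ n) ^ (4 * n * n) < _ := hS.M_lt
    simpa using this
  · simp [hf₄.reg r_n (by decide), hf₃.reg r_n (by decide), hf₂.reg r_n (by decide),
      hf₁.reg r_n (by decide), hn]
  · rw [hf₄.coins rfl, hf₃.coins rfl, hf₂.coins rfl]
    exact (hf₁.coins rfl).trans hc
  · exact two_pow_lt_length (by omega)
  · refine ⟨?_, ?_, ?_, ?_, ?_, ?_, ?_, h₅⟩
    · simp [hf₅.reg r_n (by decide), hf₄.reg r_n (by decide), hf₃.reg r_n (by decide),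
        hf₂.reg r_n (by decide), hf₁.reg r_n (by decide), hn, params]
    · simp [hf₅.reg r_k (by decide), hf₄.reg r_k (by decide), hf₃.reg r_k (by decide),
        hf₂.reg r_k (by decide), hf₁.reg r_k (by decide), hk, params]
    · simp [hf₅.reg r_Z (by decide), hf₄.reg r_Z (by decide), hf₃.reg r_Z (by decide),
        hf₂.reg r_Z (by decide), hf₁.reg r_Z (by decide), hn, hp, params]
    · simp [hf₅.reg r_base (by decide), hf₄.reg r_base (by decide), hf₃.reg r_base (by decide),
        hf₂.reg r_base (by decide), hf₁.reg r_base (by decide), hn, hp, params]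
    · simp [hf₅.reg r_B (by decide), hf₄.reg r_B (by decide), hf₃.reg r_B (by decide), h₂, params]
    · simp [hf₅.reg r_K (by decide), hf₄.reg r_K (by decide), h₃, h₂, params]
    · simp [hf₅.reg r_M (by decide), h₄, hf₃.reg r_B (by decide), h₂, params]
  · have hinc := fun x => (inc_edges_le (G := G) (P := P) x).trans_lt
      ((G.degree_lt_card_verts x).trans_eq (Fintype.card_fin n))
    refine ⟨fun z hz => (mem_edges.1 hz).1.lt, fun z hz => (mem_edges.1 hz).1.1.ne, ?_, hinc⟩
    rw [hf₅.mem rfl, hf₄.mem rfl, hf₃.mem rfl, hf₂.mem rfl]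
    exact h₁.1
  · intro kind hkind i hi
    rw [hf₅.mem rfl, hf₄.mem rfl, hf₃.mem rfl, hf₂.mem rfl]
    refine h₁.2 _ ?_ fun z hz => ?_
    · change _ ≤ 8 * (3 + n * n + p * n + i) + kind
      omega
    · have := (cellAddr_inj (by omega) (by decide)).1 hz
      omega
  · exact dictionaries_lt hkn
  · simp [params, Params.evalCost, Params.transferCost, costBound]
    have := Nat.le_mul_self n
    linarith

theorem runs_coloring_of_lt (hk0 : 0 < k) (hkn : k < n)
    (hne : colorSum (fstEnd n) (sndEnd n) (edges G P)
      (trimmed (fstEnd n) (sndEnd n) (edges G P) fun _ => range k)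
      (fun x => (params n k p ω).digit x) ≠ 0) :
    Runs (lengthBound n k p) ω coloringProg (initialState k G P)
      (costBound n k p ((G.maxDegree / 2 + 1) ^ (P.width + 1)) + n * 30 + 200)
      (HoldsColoring k G) := by
  obtain ⟨-, -, -, h5⟩ := size_facts n p
  refine Runs.mono_cost (Runs.ifte (N₁ := costBound n k p ((G.maxDegree / 2 + 1) ^ (P.width + 1))
    + n * 30 + 150) (N₂ := 1) (fun _ => Runs.mono_cost (Runs.seq (Runs.assign ?_ fun _ =>
      Runs.seq (Runs.assign ?_ fun _ => Runs.seq (Runs.assign ?_ fun _ => Runs.ifte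
        (N₁ := costBound n k p ((G.maxDegree / 2 + 1) ^ (P.width + 1))) (N₂ := n * 30 + 30)
        (fun _ => ((runs_main ?_ ?_ ?_ ?_ rfl hk0 hkn hne).mono le_rfl
        fun τ hτ => holdsColoring_of_edges hτ.1 hτ.2)) fun h0 => ?_)))) ?_)
    fun h0 => ?_) ?_
  · exact lt_length (e := n) (by omega)
  · exact (show k < _ from lt_length (by omega))
  · exact lt_length (e := p) (by omega)
  · exact isInput_initialState k G P
  · rfl
  · rfl
  · rfl
  · exact absurd (show n - k = 0 from h0) (by omega)
  · simp
    omega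
  · exact absurd (show n = 0 from h0) (NeZero.ne n)
  · simp
    omega

theorem runs_coloring_of_le (hkn : n ≤ k) :
    Runs (lengthBound n k p) ω coloringProg (initialState k G P)
      (n * 30 + 200) (HoldsColoring k G) := by
  obtain ⟨-, -, -, h5⟩ := size_facts n p
  have hk : k < 2 ^ lengthBound n k p :=
    (Nat.lt_size_self k).trans_le (Nat.pow_le_pow_right two_pos (Nat.le_add_left _ _))
  refine Runs.mono_cost (Runs.ifte (N₁ := n * 30 + 150) (N₂ := 1) (fun _ => Runs.mono_cost
    (Runs.seq (Runs.assign ?_ fun _ => Runs.seq (Runs.assign ?_ fun _ =>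
      Runs.seq (Runs.assign ?_ fun _ => Runs.ifte (N₁ := 0) (N₂ := n * 30 + 30)
        (fun h0 => ?_) fun _ => (runs_identity (n := n) rfl ?_).mono le_rfl fun τ hτ => ?_)))) ?_)
    fun h0 => ?_) ?_
  · exact lt_length (e := n) (by omega)
  · exact hk
  · exact lt_length (e := p) (by omega)
  · exact absurd (show n - k = 0 by omega) h0
  · exact lt_length (by omega)
  · refine ⟨SimpleGraph.Coloring.mk (fun v => Fin.castLE hkn v) ?_, fun v => hτ v v.2⟩
    intro u v hadj he
    exact hadj.ne (Fin.castLE_injective hkn he)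
  · simp
    omega
  · exact absurd (show n = 0 from h0) (NeZero.ne n)
  · simp
    omega

end RAM

/-! ### The probability that the color sum vanishes -/

namespace Orient

open Finset MvPolynomial

variable {n : ℕ} (u v : ℕ → Fin n) (E : Finset ℕ) (L : Fin n → Finset ℕ)

/-- The color sum as a polynomial in the weights of the vertices. -/
noncomputable def colorPoly : MvPolynomial (Fin n) ℤ :=
  ∑ c ∈ Fintype.piFinset L, monomial (Finsupp.equivFunOnFinite.symm c)
    (∏ z ∈ E, ((c (u z) : ℤ) - c (v z)))

variable {u v E L}

theorem eval_colorPoly (r : Fin n → ℤ) :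
    eval r (colorPoly u v E L) = colorSum u v E L r := by
  simp only [colorPoly, colorSum, map_sum, eval_monomial]
  refine sum_congr rfl fun c _ => ?_
  rw [mul_comm, Finsupp.prod_fintype _ _ (by simp)]
  simp

/-- The exponents of a monomial are the coloring it comes from, so no two colorings can cancel. -/
theorem coeff_colorPoly (m : Fin n →₀ ℕ) :
    coeff m (colorPoly u v E L)
      = if ⇑m ∈ Fintype.piFinset L then ∏ z ∈ E, ((m (u z) : ℤ) - m (v z)) else 0 := by
  classical
  simp only [colorPoly, coeff_sum, coeff_monomial]
  have h : ∀ c : Fin n → ℕ, Finsupp.equivFunOnFinite.symm c = m ↔ c = m := by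
    intro c
    rw [Equiv.symm_apply_eq]
    rfl
  simp only [h]
  split_ifs with hm
  · rw [sum_eq_single_of_mem _ hm fun c _ hc => if_neg hc, if_pos rfl]
  · refine sum_eq_zero fun c hc => if_neg ?_
    rintro rfl
    exact hm hc

theorem degreeOf_colorPoly_le {k : ℕ} (hL : ∀ x, ∀ a ∈ L x, a ≤ k) (x : Fin n) :
    degreeOf x (colorPoly u v E L) ≤ k := by
  rw [degreeOf_le_iff]
  intro m hm
  rw [mem_support_iff, coeff_colorPoly] at hm
  have hm' : ⇑m ∈ Fintype.piFinset L := by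
    by_contra h
    exact hm (if_neg h)
  exact hL x _ (Fintype.mem_piFinset.1 hm' x)

theorem colorPoly_ne_zero {c : Fin n → ℕ} (hc : ∀ x, c x ∈ L x)
    (h : ∀ z ∈ E, c (u z) ≠ c (v z)) : colorPoly u v E L ≠ 0 := by
  intro h0
  have h1 := coeff_colorPoly (u := u) (v := v) (E := E) (L := L) (Finsupp.equivFunOnFinite.symm c)
  have h2 : ⇑(Finsupp.equivFunOnFinite.symm c) ∈ Fintype.piFinset L := Fintype.mem_piFinset.2 hc
  rw [h0, coeff_zero, if_pos h2] at h1
  refine prod_ne_zero_iff.2 (fun z hz => ?_) h1.symm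
  rw [sub_ne_zero]
  exact_mod_cast h z hz

/-- A color sum vanishes for few weights. -/
theorem card_colorSum_eq_zero {k B : ℕ} (hL : ∀ x, ∀ a ∈ L x, a ≤ k) (hB : 2 * (n * k) ≤ B)
    (hB0 : 0 < B) {c : Fin n → ℕ} (hc : ∀ x, c x ∈ L x) (h : ∀ z ∈ E, c (u z) ≠ c (v z)) :
    2 * #{R ∈ range (B ^ n) | colorSum u v E L (fun x => ((R / B ^ (x : ℕ) % B : ℕ) : ℤ)) = 0}
      ≤ B ^ n := by
  classical
  set s : Finset ℤ := (range B).image Nat.cast with hs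
  have hcard : #s = B := by
    rw [hs, card_image_of_injective _ Nat.cast_injective, card_range]
  have key := schwartz_zippel_sum_degreeOf (colorPoly_ne_zero hc h) fun _ => s
  -- The `n` digits in base `B` of a number below `B ^ n` determine it, so the bad numbers embed
  -- into the zeros on the grid `{0, …, B - 1} ^ n`.
  have h1 : #{R ∈ range (B ^ n) | colorSum u v E L (fun x => ((R / B ^ (x : ℕ) % B : ℕ) : ℤ)) = 0}
      ≤ #{x ∈ Fintype.piFinset (fun _ : Fin n => s) | eval x (colorPoly u v E L) = 0} := by
    refine card_le_card_of_injOn (fun R x => ((R / B ^ (x : ℕ) % B : ℕ) : ℤ)) ?_ ?_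
    · intro R hR
      rw [mem_coe, mem_filter] at hR ⊢
      refine ⟨Fintype.mem_piFinset.2 fun x => mem_image_of_mem _ (mem_range.2 (Nat.mod_lt _ hB0)),
        ?_⟩
      rw [eval_colorPoly]
      exact hR.2
    · intro R hR R' hR' he
      rw [mem_coe, mem_filter, mem_range] at hR hR'
      have h2 : finFunctionFinEquiv.symm ⟨R, hR.1⟩ = finFunctionFinEquiv.symm ⟨R', hR'.1⟩ := by
        funext x
        have h3 := congrFun he x
        simp only [Nat.cast_inj] at h3
        exact Fin.ext h3
      exact Fin.val_eq_of_eq (finFunctionFinEquiv.symm.injective h2)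
  have h2 : ∑ i : Fin n, (((colorPoly u v E L).degreeOf i : ℚ≥0) / #s) ≤ 1 / 2 := by
    calc ∑ i : Fin n, (((colorPoly u v E L).degreeOf i : ℚ≥0) / #s)
        ≤ ∑ i : Fin n, ((k : ℚ≥0) / B) := by
          rw [hcard]
          gcongr with i
          exact degreeOf_colorPoly_le hL i
      _ = (n * k : ℕ) / (B : ℚ≥0) := by simp; ring
      _ ≤ 1 / 2 := by
          rw [div_le_div_iff₀ (by exact_mod_cast hB0) (by norm_num), one_mul]
          exact_mod_cast (mul_comm _ _).trans_le hB
  have h3 := key.trans h2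
  rw [prod_const, hcard, card_univ, Fintype.card_fin,
    div_le_div_iff₀ (by exact_mod_cast Nat.pow_pos hB0) (by norm_num), one_mul] at h3
  have h4 : #{x ∈ Fintype.piFinset (fun _ : Fin n => s) | eval x (colorPoly u v E L) = 0} * 2
      ≤ B ^ n := by exact_mod_cast h3
  omega

/-- There are at most `B ^ n` colorings; in each term the weights contribute at most `B ^ (n * k)`
and every edge at most `B`. -/
theorem abs_colorSum_le {k B : ℕ} (hL : ∀ x, #(L x) ≤ k) (hL' : ∀ x, ∀ a ∈ L x, a ≤ k)
    {r : Fin n → ℕ} (hr : ∀ x, r x ≤ B) (hk : k ≤ B) (hB : 0 < B) :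
    |colorSum u v E L fun x => (r x : ℤ)| ≤ B ^ (n + n * k + #E) := by
  unfold colorSum
  calc |∑ c ∈ Fintype.piFinset L, (∏ x, (r x : ℤ) ^ c x) * ∏ z ∈ E, ((c (u z) : ℤ) - c (v z))|
      ≤ ∑ c ∈ Fintype.piFinset L, |(∏ x, (r x : ℤ) ^ c x) * ∏ z ∈ E, ((c (u z) : ℤ) - c (v z))| :=
        abs_sum_le_sum_abs _ _
    _ ≤ ∑ c ∈ Fintype.piFinset L, ((B : ℤ) ^ (n * k) * B ^ #E) := by
        refine sum_le_sum fun c hc => ?_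
        rw [Fintype.mem_piFinset] at hc
        rw [abs_mul, abs_prod, abs_prod]
        refine mul_le_mul ?_ ?_ (prod_nonneg fun _ _ => abs_nonneg _) (by positivity)
        · calc ∏ x, |(r x : ℤ) ^ c x| ≤ ∏ x : Fin n, (B : ℤ) ^ k := by
                refine prod_le_prod (fun _ _ => abs_nonneg _) fun x _ => ?_
                rw [abs_of_nonneg (by positivity)]
                calc (r x : ℤ) ^ c x ≤ (B : ℤ) ^ c x := by
                      gcongr; exact_mod_cast hr x
                  _ ≤ (B : ℤ) ^ k := by
                      gcongr
                      · exact_mod_cast hB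
                      · exact hL' x _ (hc x)
            _ = (B : ℤ) ^ (n * k) := by
                rw [prod_const, card_univ, Fintype.card_fin, ← pow_mul, mul_comm]
        · calc ∏ z ∈ E, |(c (u z) : ℤ) - c (v z)| ≤ ∏ z ∈ E, (B : ℤ) := by
                refine prod_le_prod (fun _ _ => abs_nonneg _) fun z _ => ?_
                have h1 := hL' _ _ (hc (u z))
                have h2 := hL' _ _ (hc (v z))
                rw [abs_le]
                omega
            _ = (B : ℤ) ^ #E := by rw [prod_const]
    _ = (∏ x, #(L x) : ℕ) * ((B : ℤ) ^ (n * k) * B ^ #E) := by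
        rw [sum_const, Fintype.card_piFinset, nsmul_eq_mul]
    _ ≤ (B : ℤ) ^ n * ((B : ℤ) ^ (n * k) * B ^ #E) := by
        gcongr
        have : ∏ x, #(L x) ≤ ∏ x : Fin n, B := by
          gcongr with x
          exact (hL x).trans hk
        rw [prod_const, card_univ, Fintype.card_fin] at this
        exact_mod_cast this
    _ = (B : ℤ) ^ (n + n * k + #E) := by ring

end Orient

namespace RAM

open Orient Finset MeasureTheory

/-! The law of the random number -/

theorem bitsNum_congr {ω ω' : ℕ → Bool} {N : ℕ} (h : ∀ i < N, ω i = ω' i) :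
    bitsNum ω N = bitsNum ω' N := by
  induction N with
  | zero => rfl
  | succ N ih => rw [bitsNum, bitsNum, ih fun i hi => h i (by omega), h N (by omega)]

theorem exists_bitsNum_eq {N m : ℕ} (h : m < 2 ^ N) : ∃ ω, bitsNum ω N = m := by
  induction N generalizing m with
  | zero => exact ⟨fun _ => false, by simp at h; simp [bitsNum, h]⟩
  | succ N ih =>
    obtain ⟨ω, hω⟩ := ih (m := m / 2) (by rw [pow_succ] at h; omega)
    refine ⟨Function.update ω N (decide (m % 2 = 1)), ?_⟩
    rw [bitsNum, Function.update_self, bitsNum_congr (ω' := ω) fun i hi =>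
      Function.update_of_ne hi.ne _ _, hω]
    rcases Nat.mod_two_eq_zero_or_one m with h2 | h2 <;> simp [h2] <;> omega

theorem measurable_bitsNum (N : ℕ) : Measurable fun ω => bitsNum ω N := by
  induction N with
  | zero => exact measurable_const
  | succ N ih =>
    simp only [bitsNum]
    exact (ih.const_mul 2).add
      ((measurable_of_countable Bool.toNat).comp (measurable_pi_apply N))

instance : IsProbabilityMeasure coinMeasure := by
  unfold coinMeasure
  infer_instance

/-- The event contains the cylinder of the first `N` outcomes of one sequence that yields `m`. The
lower bound is all that is needed. -/
theorem le_coinMeasure_bitsNum {N m : ℕ} (h : m < 2 ^ N) :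
    (2⁻¹ : ENNReal) ^ N ≤ coinMeasure ((fun ω => bitsNum ω N) ⁻¹' {m}) := by
  obtain ⟨ω₀, hω₀⟩ := exists_bitsNum_eq h
  calc (2⁻¹ : ENNReal) ^ N = coinMeasure (Set.pi (range N : Set ℕ) fun i => {ω₀ i}) := by
        unfold coinMeasure
        rw [Measure.infinitePi_pi _ fun i _ => measurableSet_singleton _]
        simp
    _ ≤ _ := by
        refine measure_mono fun ω hω => ?_
        rw [Set.mem_preimage, Set.mem_singleton_iff, ← hω₀]
        refine bitsNum_congr fun i hi => hω i (by simpa using hi)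

/-- A property of half of the numbers holds for the random number with probability at least one
half. -/
theorem half_le_coinMeasure {N : ℕ} {q : ℕ → Prop} [DecidablePred q]
    (h : 2 * #{m ∈ range (2 ^ N) | ¬ q m} ≤ 2 ^ N) :
    1 / 2 ≤ coinMeasure.real {ω | q (bitsNum ω N)} := by
  set s := {m ∈ range (2 ^ N) | q m} with hs
  have h1 : 2 ^ N ≤ 2 * #s := by
    have := card_filter_add_card_filter_not (s := range (2 ^ N)) q
    rw [card_range, ← hs] at this
    omega
  have h2 : (2⁻¹ : ENNReal) ≤ coinMeasure {ω | q (bitsNum ω N)} := by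
    calc (2⁻¹ : ENNReal) ≤ #s * (2⁻¹ : ENNReal) ^ N := by
          have h3 : (2 : ENNReal) ^ N ≤ 2 * #s := by exact_mod_cast h1
          calc (2⁻¹ : ENNReal) = 2⁻¹ * (2 ^ N * 2⁻¹ ^ N) := by
                rw [← mul_pow, ENNReal.mul_inv_cancel (by simp) (by simp), one_pow, mul_one]
            _ ≤ 2⁻¹ * (2 * #s * 2⁻¹ ^ N) := by gcongr
            _ = #s * 2⁻¹ ^ N := by
                rw [mul_assoc, ← mul_assoc, ENNReal.inv_mul_cancel (by simp) (by simp), one_mul]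
      _ = ∑ m ∈ s, (2⁻¹ : ENNReal) ^ N := by rw [sum_const, nsmul_eq_mul]
      _ ≤ ∑ m ∈ s, coinMeasure ((fun ω => bitsNum ω N) ⁻¹' {m}) :=
          sum_le_sum fun m hm => le_coinMeasure_bitsNum (mem_range.1 (mem_filter.1 hm).1)
      _ = coinMeasure ((fun ω => bitsNum ω N) ⁻¹' s) :=
          sum_measure_preimage_singleton _ fun m _ =>
            measurable_bitsNum N (measurableSet_singleton m)
      _ ≤ _ := measure_mono fun ω hω => (mem_filter.1 (show bitsNum ω N ∈ s from hω)).2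
  have h3 := ENNReal.toReal_mono (measure_ne_top _ _) h2
  simpa [Measure.real] using h3

variable {n k p : ℕ} [NeZero n] {G : SimpleGraph (Fin n)} {P : PathDecomposition G p}

/-- Schwartz–Zippel over `ℤ` with `B = 4 ^ n ≥ 2 * n * k`, transported to `ZMod M`: the integer sum
is smaller than `M` in absolute value, so it is zero if its residue is. -/
theorem half_le_coinMeasure_colorSum (hk0 : 0 < k) (hkn : k < n) (hG : G.Colorable k) :
    1 / 2 ≤ coinMeasure.real {ω | colorSum (fstEnd n) (sndEnd n) (edges G P)
      (trimmed (fstEnd n) (sndEnd n) (edges G P) fun _ => range k)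
      (fun x => (params n k p ω).digit x) ≠ 0} := by
  classical
  set L := trimmed (fstEnd n) (sndEnd n) (edges G P) fun _ => range k with hL
  have hLlt : ∀ x, ∀ a ∈ L x, a < k := by
    intro x a ha
    rw [hL, trimmed] at ha
    split_ifs at ha
    · rw [mem_singleton] at ha; omega
    · exact mem_range.1 ha
  have hLcard : ∀ x, #(L x) ≤ k := by
    intro x
    rw [hL, trimmed]
    split_ifs
    · simp; omega
    · simp
  obtain ⟨C⟩ := hG
  -- A proper coloring adapted to the trimmed lists, which allow only `0` at the vertices without
  -- edges.
  set c : Fin n → ℕ := fun x =>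
    if inc (fstEnd n) (sndEnd n) (edges G P) x = 0 then 0 else (C x : ℕ) with hc
  have hcL : ∀ x, c x ∈ L x := by
    intro x
    simp only [hc, hL, trimmed]
    split_ifs <;> simp
  have hinc : ∀ z ∈ edges G P, ∀ x, fstEnd n z = x ∨ sndEnd n z = x →
      inc (fstEnd n) (sndEnd n) (edges G P) x ≠ 0 := by
    intro z hz x hx
    exact card_ne_zero.2 ⟨z, mem_filter.2 ⟨hz, hx⟩⟩
  have hcE : ∀ z ∈ edges G P, c (fstEnd n z) ≠ c (sndEnd n z) := by
    intro z hz h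
    simp only [hc] at h
    rw [if_neg (hinc z hz _ (.inl rfl)), if_neg (hinc z hz _ (.inr rfl))] at h
    exact C.valid (mem_edges.1 hz).1.2.1 (Fin.ext h)
  have hn : 0 < n := NeZero.pos n
  have hB : 2 * (n * k) ≤ 4 ^ n := by
    have h1 : n - 1 < 2 ^ (n - 1) := Nat.lt_two_pow_self
    have h2 : 2 * n ≤ 2 ^ n := by
      obtain ⟨m, rfl⟩ : ∃ m, n = m + 1 := ⟨n - 1, by omega⟩
      rw [pow_succ]
      simp at h1
      omega
    calc 2 * (n * k) = 2 * n * k := (mul_assoc _ _ _).symm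
      _ ≤ 2 ^ n * 2 ^ n := Nat.mul_le_mul h2 (by omega)
      _ = 4 ^ n := by rw [← mul_pow]; norm_num
  have key := card_colorSum_eq_zero (fun x a ha => (hLlt x a ha).le) hB (by positivity) hcL hcE
  -- The `2 * n * n` coin flips give exactly `n` digits in base `4 ^ n`.
  have hN : (4 ^ n) ^ n = 2 ^ (2 * n * n) := by
    rw [← pow_mul, mul_assoc, pow_mul 2 2]
    norm_num
  rw [hN] at key
  refine (half_le_coinMeasure (N := 2 * n * n) (q := fun R => colorSum (fstEnd n) (sndEnd n)
    (edges G P) L (fun x => ((R / (4 ^ n) ^ (x : ℕ) % 4 ^ n : ℕ) : ℤ)) ≠ 0) ?_).trans ?_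
  · simpa only [ne_eq, not_not] using key
  · refine measureReal_mono fun ω hω h0 => hω ?_
    have h1 := colorSum_map (u := fstEnd n) (v := sndEnd n) (E := edges G P)
      (Int.castRingHom (ZMod ((4 ^ n) ^ (4 * n * n)))) L
      (fun x => ((bitsNum ω (2 * n * n) / (4 ^ n) ^ (x : ℕ) % 4 ^ n : ℕ) : ℤ))
    simp only [map_natCast] at h1
    have h2 := (ZMod.intCast_zmod_eq_zero_iff_dvd _ _).1 (h1.trans h0)
    refine Int.eq_zero_of_abs_lt_dvd h2 ((abs_colorSum_le (k := k) (B := 4 ^ n) hLcard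
      (fun x a ha => (hLlt x a ha).le) (fun x => (Nat.mod_lt _ (by positivity)).le)
      (hkn.le.trans (Nat.lt_pow_self (by norm_num)).le) (by positivity)).trans_lt ?_)
    -- The exponent `n + n * k + #E` is at most `2 * n * n`, below the `4 * n * n` of the modulus.
    have hE := card_edges_le (G := G) (P := P)
    have hnk : n * k + n ≤ n * n := by
      have := Nat.mul_le_mul_left n (Nat.succ_le_of_lt hkn)
      rwa [Nat.mul_succ] at this
    have hnn : 0 < n * n := Nat.mul_pos hn hn
    push_cast
    refine pow_lt_pow_right₀ ?_ ?_
    · exact one_lt_pow₀ (by norm_num) hn.ne'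
    · rw [mul_assoc 4]
      omega

end RAM

/-! ### The running time -/

namespace RAM

open Orient Finset MeasureTheory

/-- Permuting the colors of one proper coloring by a transposition gives the vertex `0` any
prescribed color. -/
theorem le_card_coloring {n k : ℕ} [NeZero n] {G : SimpleGraph (Fin n)} (hG : G.Colorable k) :
    k ≤ Nat.card (G.Coloring (Fin k)) := by
  obtain ⟨c⟩ := hG
  have : Finite (G.Coloring (Fin k)) := DFunLike.finite _
  have h := Nat.card_le_card_of_injective (fun a : Fin k =>
    (SimpleGraph.Coloring.mk (fun v => Equiv.swap (c 0) a (c v))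
      fun hadj he => c.valid hadj ((Equiv.swap (c 0) a).injective he) : G.Coloring (Fin k)))
    fun a b hab => by
      have : Equiv.swap (c 0) a (c 0) = Equiv.swap (c 0) b (c 0) := DFunLike.congr_fun hab 0
      simpa using this
  simpa using h

theorem card_coloring_pos {n k : ℕ} {G : SimpleGraph (Fin n)} (hG : G.Colorable k) :
    0 < Nat.card (G.Coloring (Fin k)) := by
  obtain ⟨c⟩ := hG
  have : Finite (G.Coloring (Fin k)) := DFunLike.finite _
  exact Nat.card_pos_iff.2 ⟨⟨c⟩, this⟩

theorem costBound_le {n k p X q : ℕ} (hk : k ≤ n) (hX : 1 ≤ X) (hq : q = n + p + 1) :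
    costBound n k p (X * q) + n * 30 + 200 ≤ 20000 * X * q ^ 9 := by
  have h1 : 1 ≤ q := by omega
  have hn : n ≤ q := by omega
  have hp : p ≤ q := by omega
  have hkq : k ≤ q := by omega
  have hZ : p * n * n ≤ q ^ 3 := by
    calc p * n * n ≤ q * q * q := by gcongr
      _ = q ^ 3 := by ring
  have hle : ∀ a b, a ≤ b → q ^ a ≤ X * q ^ b := fun a b hab =>
    (Nat.pow_le_pow_right h1 hab).trans (Nat.le_mul_of_pos_left _ hX)
  have e0 := hle 0 9 (by norm_num)
  have e1 := hle 1 9 (by norm_num)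
  have e2 := hle 2 9 (by norm_num)
  have e3 := hle 3 9 (by norm_num)
  have f0 := hle 0 4 (by norm_num)
  have f1 := hle 1 4 (by norm_num)
  have f3 := hle 3 4 (by norm_num)
  have g0 := hle 0 7 (by norm_num)
  rw [pow_zero] at e0 f0 g0
  rw [pow_one] at e1 f1
  have hA : n * (n * (60 * n + 200) + 2000) + 700 ≤ 2960 * q ^ 3 := by
    have d2 : q ^ 2 ≤ q ^ 3 := Nat.pow_le_pow_right h1 (by norm_num)
    have d1 : q ≤ q ^ 3 := Nat.le_self_pow (by norm_num) q
    calc n * (n * (60 * n + 200) + 2000) + 700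
        ≤ q * (q * (60 * q + 200) + 2000) + 700 := by gcongr
      _ = 60 * q ^ 3 + 200 * q ^ 2 + 2000 * q + 700 := by ring
      _ ≤ 2960 * q ^ 3 := by omega
  have hT : 700 * (p * n * n) + 20 * n + X * q * (n * (n * (60 * n + 200) + 2000) + 700) + 200
      ≤ 3880 * (X * q ^ 4) := by
    have : X * q * (n * (n * (60 * n + 200) + 2000) + 700) ≤ 2960 * (X * q ^ 4) := by
      calc _ ≤ X * q * (2960 * q ^ 3) := by gcongr
        _ = _ := by ring
    omega
  have hV : (p * n * n) * (4 * (700 * (p * n * n) + 20 * n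
      + X * q * (n * (n * (60 * n + 200) + 2000) + 700) + 200) + 600) + 1100
      ≤ 17220 * (X * q ^ 7) := by
    have : (p * n * n) * (4 * (700 * (p * n * n) + 20 * n
        + X * q * (n * (n * (60 * n + 200) + 2000) + 700) + 200) + 600)
        ≤ 16120 * (X * q ^ 7) := by
      calc _ ≤ q ^ 3 * (16120 * (X * q ^ 4)) := Nat.mul_le_mul hZ (by omega)
        _ = _ := by ring
    linarith
  have hnn : n * n ≤ q ^ 2 := by
    calc n * n ≤ q * q := by gcongr
      _ = q ^ 2 := by ring
  have hW : n * (k * ((p * n * n) * (4 * (700 * (p * n * n) + 20 * n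
      + X * q * (n * (n * (60 * n + 200) + 2000) + 700) + 200) + 600) + 1100) + 100)
      ≤ 17320 * (X * q ^ 9) := by
    calc _ ≤ q * (q * (17220 * (X * q ^ 7)) + 100) := by gcongr
      _ = 17220 * (X * q ^ 9) + 100 * q := by ring
      _ ≤ _ := by omega
  unfold costBound
  rw [mul_assoc 300, mul_assoc 20000]
  linarith

/-- Every operation is charged by the length bound, which includes the length of `k`. As `k` may be
huge compared with `n` and `p`, this is where the factor `s` is used. -/
theorem lengthBound_succ_le {n k p s q : ℕ} (hq : q = n + p + 1) (hs : 0 < s) (hk : k ≤ q * s) :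
    lengthBound n k p + 1 ≤ 52 * q ^ 3 * s := by
  have h1 : 1 ≤ q := by omega
  have h2 : k.size ≤ k := Nat.size_le.2 Nat.lt_two_pow_self
  have h3 : q * s ≤ q ^ 3 * s := Nat.mul_le_mul_right _ (Nat.le_self_pow (by norm_num) q)
  have h4 : 1 ≤ q * s := Nat.mul_pos h1 hs
  have h5 : q ^ 3 ≤ q ^ 3 * s := Nat.le_mul_of_pos_right _ hs
  unfold lengthBound
  rw [← hq, mul_assoc]
  omega

variable {n k p T : ℕ} {G : SimpleGraph (Fin n)} [DecidableRel G.Adj] {P : PathDecomposition G p}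
  {ω : ℕ → Bool}

theorem Runs.mem_successEvent {N : ℕ}
    (h : Runs (lengthBound n k p) ω coloringProg (initialState k G P) N (HoldsColoring k G))
    (hT : N * (lengthBound n k p + 1) ≤ T) : ω ∈ successEvent coloringProg k G P T := by
  obtain ⟨t, τ, ht, he, -, hq⟩ := h bounded_initialState
  exact ⟨t, ht.trans hT, τ, he, hq⟩

theorem half_le_of_forall (h : ∀ ω, ω ∈ successEvent coloringProg k G P T) :
    1 / 2 ≤ coinMeasure.real (successEvent coloringProg k G P T) := by
  rw [Set.eq_univ_of_forall h, probReal_univ]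
  norm_num

end RAM

-- The three cases are no vertices, at least as many colors as vertices, and the randomized search.
-- In the search, `q ^ 9` comes from the number of operations and `q ^ 3 * s` from the lengths of
-- the numbers, whence the exponent `12`.
open RAM in
theorem half_le_successEvent (n k p : ℕ) (G : SimpleGraph (Fin n)) [DecidableRel G.Adj]
    (P : PathDecomposition G p) (hG : G.Colorable k) :
    1 / 2 ≤ coinMeasure.real (successEvent coloringProg k G P
      ((G.maxDegree / 2 + 1) ^ P.width * (2000000 * (n + p + 1) ^ 12) *
        Nat.card (G.Coloring (Fin k)))) := by
  have hs := card_coloring_pos hG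
  set s := Nat.card (G.Coloring (Fin k)) with hs'
  set X := (G.maxDegree / 2 + 1) ^ P.width with hX'
  have hX : 1 ≤ X := Nat.one_le_pow _ _ (Nat.succ_pos _)
  obtain ⟨q, hq⟩ : ∃ q, q = n + p + 1 := ⟨_, rfl⟩
  have h1 : 1 ≤ q := by omega
  rw [← hq]
  rcases Nat.eq_zero_or_pos n with rfl | hn
  -- Testing the cell `0` costs `3` and `skip` costs `1`.
  · refine half_le_of_forall fun ω => ⟨4, ?_, initialState k G P,
      .ifte_false (by rfl) (.skip _), ?_⟩
    · have h2 : 1 ≤ X * (q ^ 12) * s := Nat.mul_pos (Nat.mul_pos hX (Nat.pow_pos h1)) hs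
      calc 4 ≤ 2000000 * (X * q ^ 12 * s) := by omega
        _ = _ := by ring
    · exact ⟨SimpleGraph.Coloring.mk Fin.elim0 fun {u} => u.elim0, fun v => v.elim0⟩
  · have : NeZero n := ⟨hn.ne'⟩
    have hk := le_card_coloring hG
    have hlen : lengthBound n k p + 1 ≤ 52 * q ^ 3 * s :=
      lengthBound_succ_le hq hs (hk.trans (Nat.le_mul_of_pos_left _ h1))
    have hk0 : 0 < k := by
      rcases Nat.eq_zero_or_pos k with rfl | h
      · obtain ⟨c⟩ := hG
        exact (c 0).elim0
      · exact h
    have hT : ∀ N, N ≤ 20000 * X * q ^ 9 →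
        N * (lengthBound n k p + 1) ≤ X * (2000000 * q ^ 12) * s := by
      intro N hN
      calc N * (lengthBound n k p + 1) ≤ 20000 * X * q ^ 9 * (52 * q ^ 3 * s) :=
            Nat.mul_le_mul hN hlen
        _ = 1040000 * (X * q ^ 12 * s) := by ring
        _ ≤ 2000000 * (X * q ^ 12 * s) := Nat.mul_le_mul_right _ (by norm_num)
        _ = _ := by ring
    rcases le_or_gt n k with hnk | hkn
    · refine half_le_of_forall fun ω => (runs_coloring_of_le hnk).mem_successEvent (hT _ ?_)
      refine le_trans ?_ (costBound_le (k := 0) (Nat.zero_le n) hX hq)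
      omega
    · refine (half_le_coinMeasure_colorSum (P := P) hk0 hkn hG).trans
        (MeasureTheory.measureReal_mono fun ω hω => ?_)
      refine (runs_coloring_of_lt hk0 hkn hω).mem_successEvent (hT _ ?_)
      refine le_trans ?_ (costBound_le hkn.le hX hq)
      -- A bag has up to `width + 1` vertices; the one superfluous factor is at most `n`, since the
      -- maximum degree is less than `n`.
      have hm : (G.maxDegree / 2 + 1) ^ (P.width + 1) ≤ X * q := by
        rw [pow_succ]
        refine Nat.mul_le_mul_left _ ?_
        have := G.maxDegree_lt_card_verts
        rw [Fintype.card_fin] at this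
        omega
      unfold costBound
      gcongr

theorem corollary2 :
    ∃ (A : RAM.Prog) (c : ℝ) (C d : ℕ), 0 < c ∧
      ∀ (n k p : ℕ) (G : SimpleGraph (Fin n)) [DecidableRel G.Adj] (P : PathDecomposition G p),
        G.Colorable k →
          c ≤ RAM.coinMeasure.real (successEvent A k G P
            ((G.maxDegree / 2 + 1) ^ P.width * (C * (n + p + 1) ^ d) *
              Nat.card (G.Coloring (Fin k)))) :=
  ⟨RAM.coloringProg, 1 / 2, 2000000, 12, by norm_num, fun n k p G _ P hG =>
    half_le_successEvent n k p G P hG⟩
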